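/- Let $s$ be a fixed constant. Consider the following problem $1|jrp,s=const,p_j=1,r_j|\sum w_jC_j+c_{\mathcal Q}$. An instance consists of $n$ jobs with unit processing times $p_j=1$, release dates $r_j\in\mathbb Z_{\ge 0}$, weights $w_j\in\mathbb Z_{>0}$ and non-empty sets $R(j)\subseteq\{R_1,\dots,R_s\}$ of required resources, together with costs $K_0,K_1,\dots,K_s\in\mathbb Z_{\ge 0}$ (all numbers are encoded in binary). A solution is a pair $(S,\mathcal Q)$, where $S$ assigns a real starting time $S_j$ to each job $j$, and $\mathcal Q=\{(\mathcal R_1,t_1),\dots,(\mathcal R_q,t_q)\}$ with $\mathcal R_\ell\subseteq\{R_1,\dots,R_s\}$ and real time moments $t_1<\dots<t_q$ at which the resources in $\mathcal R_\ell$ are replenished. It is feasible if the jobs do not overlap on the single machine ($S_j+p_j\le S_k$ or $S_k+p_k\le S_j$ for all $j\ne k$) and, for each job $j$, every resource in $R(j)$ is replenished at some moment in $[r_j,S_j]$. Its cost is $\sum_j w_jC_j+\sum_{\ell=1}^q\bigl(K_0+\sum_{R_i\in\mathcal R_\ell}K_i\bigr)$, where $C_j=S_j+p_j$. For every constant $s$,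 there is an algorithm which, for every instance with $s$ resources, computes a feasible solution of minimum cost among all feasible solutions, in time polynomial in the length of the binary encoding of the instance. -/

import Mathlib

/-! ## Random access machine programs with logarithmic (bit) cost -/

namespace RAM

/-- The memory consists of arrays of natural numbers: `σ a i` is the content of cell `i` of
array `a`. A program mentions only finitely many arrays, by fixed names. -/
abbrev Store : Type := ℕ → ℕ → ℕ

/-- Write the value `v` into cell `i` of array `a`. -/
def Store.set (σ : Store) (a i v : ℕ) : Store :=
  Function.update σ a (Function.update (σ a) i v)

/-- Arithmetic expressions: constants, indexed reads, and the operations of `ℕ`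
(truncated subtraction, division with rounding down). -/
inductive Exp : Type
  | lit (m : ℕ)
  | read (a : ℕ) (idx : Exp)
  | add (e₁ e₂ : Exp)
  | sub (e₁ e₂ : Exp)
  | mul (e₁ e₂ : Exp)
  | div (e₁ e₂ : Exp)

/-- The value of an expression. -/
def Exp.val (σ : Store) : Exp → ℕ
  | lit m => m
  | read a idx => σ a (idx.val σ)
  | add e₁ e₂ => e₁.val σ + e₂.val σ
  | sub e₁ e₂ => e₁.val σ - e₂.val σ
  | mul e₁ e₂ => e₁.val σ * e₂.val σ
  | div e₁ e₂ => e₁.val σ / e₂.val σ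

/-- The cost of evaluating an expression: every operation is charged one unit plus the binary
lengths of the numbers (operands, addresses, cell contents) that it handles. -/
def Exp.cost (σ : Store) : Exp → ℕ
  | lit m => m.size + 1
  | read a idx => idx.cost σ + (idx.val σ).size + (σ a (idx.val σ)).size + 1
  | add e₁ e₂ => e₁.cost σ + e₂.cost σ + (e₁.val σ).size + (e₂.val σ).size + 1
  | sub e₁ e₂ => e₁.cost σ + e₂.cost σ + (e₁.val σ).size + (e₂.val σ).size + 1
  | mul e₁ e₂ => e₁.cost σ + e₂.cost σ + (e₁.val σ).size + (e₂.val σ).size + 1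
  | div e₁ e₂ => e₁.cost σ + e₂.cost σ + (e₁.val σ).size + (e₂.val σ).size + 1

/-- Programs. A test succeeds if the value of the expression is not `0`. -/
inductive Cmd : Type
  | skip
  | write (a : ℕ) (idx e : Exp)
  | seq (c₁ c₂ : Cmd)
  | ite (b : Exp) (c₁ c₂ : Cmd)
  | loop (b : Exp) (c : Cmd)

/-- The cost of evaluating and testing the condition `b`. -/
def testCost (σ : Store) (b : Exp) : ℕ := b.cost σ + (b.val σ).size + 1

/-- `Exec c σ σ' t`: the program `c`, started with memory `σ`, halts with memory `σ'`, and the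
whole run costs `t`. `loop b c` repeats `c` while the value of `b` is not `0`. -/
inductive Exec : Cmd → Store → Store → ℕ → Prop
  | skip (σ : Store) : Exec .skip σ σ 1
  | write (σ : Store) (a : ℕ) (idx e : Exp) :
      Exec (.write a idx e) σ (σ.set a (idx.val σ) (e.val σ))
        (idx.cost σ + e.cost σ + (idx.val σ).size + (e.val σ).size + 1)
  | seq {c₁ c₂ : Cmd} {σ₁ σ₂ σ₃ : Store} {t₁ t₂ : ℕ} :
      Exec c₁ σ₁ σ₂ t₁ → Exec c₂ σ₂ σ₃ t₂ → Exec (.seq c₁ c₂) σ₁ σ₃ (t₁ + t₂)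
  | iteTrue {b : Exp} {c₁ c₂ : Cmd} {σ σ' : Store} {t : ℕ} :
      b.val σ ≠ 0 → Exec c₁ σ σ' t → Exec (.ite b c₁ c₂) σ σ' (testCost σ b + t)
  | iteFalse {b : Exp} {c₁ c₂ : Cmd} {σ σ' : Store} {t : ℕ} :
      b.val σ = 0 → Exec c₂ σ σ' t → Exec (.ite b c₁ c₂) σ σ' (testCost σ b + t)
  | loopTrue {b : Exp} {c : Cmd} {σ₁ σ₂ σ₃ : Store} {t₁ t₂ : ℕ} :
      b.val σ₁ ≠ 0 → Exec c σ₁ σ₂ t₁ → Exec (.loop b c) σ₂ σ₃ t₂ →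
        Exec (.loop b c) σ₁ σ₃ (testCost σ₁ b + t₁ + t₂)
  | loopFalse {b : Exp} {c : Cmd} {σ : Store} :
      b.val σ = 0 → Exec (.loop b c) σ σ (testCost σ b)

/-- The initial memory: the input list in array `0`, and `0` in all other cells. -/
def initial (x : List ℕ) : Store := fun a i => if a = 0 then x.getD i 0 else 0

/-- The memory holds the list `y` at the beginning of array `1`. -/
def Outputs (σ : Store) (y : List ℕ) : Prop := ∀ i (h : i < y.length), σ 1 i = y[i]

/-- The size of an input list: the binary lengths of its entries, with one separator each. -/
def bitSize (x : List ℕ) : ℕ := (x.map fun m => m.size + 1).sum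

/-- A computational problem with instances `x : α`, candidate answers `y : β x`, and
`Solves x y` expressing that `y` is a correct answer for `x`, is solvable in polynomial time
(with respect to the given encodings of instances and answers) if some program halts on every
instance with a correct answer, at a cost that is polynomially bounded in the bit size of the
encoded instance. -/
def SolvableInPolyTime {α : Type} {β : α → Type} (encIn : α → List ℕ)
    (encOut : ∀ x, β x → List ℕ) (Solves : ∀ x, β x → Prop) : Prop :=
  ∃ (c : Cmd) (p : Polynomial ℕ), ∀ x : α, ∃ (y : β x) (σ : Store) (t : ℕ),
    Exec c (initial (encIn x)) σ t ∧ t ≤ p.eval (bitSize (encIn x)) ∧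
      Outputs σ (encOut x y) ∧ Solves x y

end RAM

/-! ## Single machine scheduling with joint replenishment -/

namespace JRP

/-- An instance of the single machine scheduling problem with joint replenishment with `s`
resources: `n` jobs with processing times `p`, release dates `r`, weights `w` and non-empty sets
`R` of required resources, a fixed cost `K₀` of every replenishment moment, and a fixed cost `K i`
of replenishing resource `i`. Numerical data are integers. -/
structure Instance (s : ℕ) where
  n : ℕ
  p : Fin n → ℕ
  r : Fin n → ℕ
  w : Fin n → ℕ
  R : Fin n → Finset (Fin s)
  K₀ : ℕ
  K : Fin s → ℕ
  p_pos : ∀ j, 0 < p j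
  w_pos : ∀ j, 0 < w j
  R_nonempty : ∀ j, (R j).Nonempty

/-- A starting time for each of `n` jobs, and a list of replenishments: pairs of a time moment
and the set of resources replenished at that moment. Times are of type `T`. -/
structure Solution (T : Type) (n s : ℕ) where
  start : Fin n → T
  repl : List (T × Finset (Fin s))

/-- An integral solution, viewed as a solution in real time. -/
def Solution.toReal {n s : ℕ} (σ : Solution ℕ n s) : Solution ℝ n s where
  start j := (σ.start j : ℝ)
  repl := σ.repl.map fun e => ((e.1 : ℝ), e.2)

variable {s : ℕ}

/-- Job `j` is ready to be started at time `t`: each resource that it requires is replenished at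
some moment in `[r j, t]`. -/
def Instance.Ready (I : Instance s) (Q : List (ℝ × Finset (Fin s))) (j : Fin I.n) (t : ℝ) : Prop :=
  ∀ i ∈ I.R j, ∃ e ∈ Q, (I.r j : ℝ) ≤ e.1 ∧ e.1 ≤ t ∧ i ∈ e.2

/-- Feasible solutions. -/
structure Instance.Feasible (I : Instance s) (σ : Solution ℝ I.n s) : Prop where
  increasing : σ.repl.Pairwise fun e e' => e.1 < e'.1
  no_overlap : ∀ j k, j ≠ k →
    σ.start j + I.p j ≤ σ.start k ∨ σ.start k + I.p k ≤ σ.start j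
  ready : ∀ j, I.Ready σ.repl j (σ.start j)

/-- The total weighted completion time `∑ w_j C_j`. -/
noncomputable def Instance.schedulingCost (I : Instance s) (σ : Solution ℝ I.n s) : ℝ :=
  ∑ j, (I.w j : ℝ) * (σ.start j + I.p j)

/-- The replenishment cost `c_Q`. -/
noncomputable def Instance.replenishmentCost (I : Instance s) (σ : Solution ℝ I.n s) : ℝ :=
  (σ.repl.map fun e => (I.K₀ : ℝ) + ∑ i ∈ e.2, (I.K i : ℝ)).sum

/-- The cost of a solution. -/
noncomputable def Instance.cost (I : Instance s) (σ : Solution ℝ I.n s) : ℝ :=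
  I.schedulingCost σ + I.replenishmentCost σ

/-- A feasible solution of minimum cost over all feasible solutions in real time. -/
def Instance.IsOptimal (I : Instance s) (σ : Solution ℝ I.n s) : Prop :=
  I.Feasible σ ∧ ∀ σ', I.Feasible σ' → I.cost σ ≤ I.cost σ'

/-- The instances with unit-time jobs. -/
def UnitInstance (s : ℕ) : Type := {I : Instance s // ∀ j, I.p j = 1}

/-- A set of resources as a list of `s` numbers in `{0, 1}`. -/
def encodeSet (A : Finset (Fin s)) : List ℕ := List.ofFn fun i => if i ∈ A then 1 else 0

/-- The input: `n, K₀, K 0, …, K (s - 1)`, followed by `p j, r j, w j` and the set `R j`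
for every job `j`. -/
def Instance.encode (I : Instance s) : List ℕ :=
  I.n :: I.K₀ :: (List.ofFn I.K ++
    (List.ofFn fun j => I.p j :: I.r j :: I.w j :: encodeSet (I.R j)).flatten)

/-- The output: the `n` starting times, followed by the number of replenishments and the
time moment and the set of resources of every replenishment. -/
def Solution.encode {n : ℕ} (σ : Solution ℕ n s) : List ℕ :=
  List.ofFn σ.start ++ σ.repl.length ::
    (σ.repl.map fun e => e.1 :: encodeSet e.2).flatten

end JRP

/-! The algorithm is a dynamic program over time windows; correctness rests on a discretization and
an exchange argument, and the running time on a restricted form of table-filling programs.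

Discretization. A real solution can be rounded without raising its cost. Every replenishment moves
back to the latest release date not after it; it serves the same jobs, and replenishments that
coincide are merged, which saves fixed costs. The floors of the starting times of unit jobs are
distinct, and shifting the jobs left in this order makes every start a release date plus at most
`n`. Hence only quadratically many moments matter and, `s` being fixed, only `(n + 1) ^ s` vectors
of last replenishments (`Describes.exists_schedules_le`).

Splitting. Whether a job may start depends only on the last replenishment of each resource it needs.
Number the jobs by nonincreasing weight. A window carries the vectors `u` before it and `v` at its
end; its jobs are those ready for `v` but not for `u`. Let `k` be its lightest job. If some job
starts after `k` although it was ready when `k` started, exchanging the two does not raise the cost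
and postpones `k` (`Normal.swap`). So one may assume that, with `x` the vector at the start `t` of
`k`, the other jobs ready for `x` run before `t` and the remaining ones after `t`. This leaves two
independent windows with vectors `u, x` and `x, v` and only jobs below `k`. The recursion is a lower
bound by `value_le` and is attained by `fits_start_repl`; `root_optimal` combines the two. When no
jobs are left, each resource is replenished exactly where `v` says.

Polynomial time. The program is a fixed list of loops, each filling one array cell by cell. The
numbers of rounds are polynomials in `n`, and `n` is at most the input length. Stored values are
`Tame`: one write lengthens numbers only by an additive term linear in the input length, so lengths
and costs stay polynomial (`exec_program`). Each array except the loop counter is written by a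
single line, so the final memory satisfies the defining equation of every cell (`run_line`).
Correctness is then a matter of evaluating these equations: the recursion in `slot_spec`, the
backtracking in `walkLine_spec`, the ordered list of replenishments in `moments_spec` and the answer
in `outputLine_spec`. -/

namespace RAM

/-! ### Bit lengths and costs of expressions -/

namespace Exp

/-- A constant bounding cost and value length of an expression relative to the memory. -/
def weight : Exp → ℕ
  | lit m => m.size + 1
  | read _ idx => 2 * weight idx + 1
  | add e₁ e₂ => 2 * weight e₁ + 2 * weight e₂ + 1
  | sub e₁ e₂ => 2 * weight e₁ + 2 * weight e₂ + 1
  | mul e₁ e₂ => 2 * weight e₁ + 2 * weight e₂ + 1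
  | div e₁ e₂ => 2 * weight e₁ + 2 * weight e₂ + 1

/-- Expressions whose value exceeds the cells in length only by an additive term: products occur
only with an input cell as the first factor (or where they do not increase the value). -/
def Tame : Exp → Prop
  | lit _ => True
  | read _ _ => True
  | add e₁ e₂ => Tame e₁ ∧ Tame e₂
  | sub e₁ _ => Tame e₁
  | div e₁ _ => Tame e₁
  | mul (read 0 _) e => Tame e
  | mul _ _ => False

/-- The additive term of a tame expression, as a multiple of the input length. -/
def growth : Exp → ℕ
  | lit m => m.size
  | read _ _ => 0
  | add e₁ e₂ => growth e₁ + growth e₂ + 1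
  | sub e₁ _ => growth e₁
  | div e₁ _ => growth e₁
  | mul _ e => growth e + 1

end Exp

theorem size_add_le (x y : ℕ) : (x + y).size ≤ max x.size y.size + 1 := by
  rw [Nat.size_le, pow_succ]
  have hx : x < 2 ^ max x.size y.size :=
    (Nat.lt_size_self x).trans_le (Nat.pow_le_pow_right (by norm_num) (le_max_left _ _))
  have hy : y < 2 ^ max x.size y.size :=
    (Nat.lt_size_self y).trans_le (Nat.pow_le_pow_right (by norm_num) (le_max_right _ _))
  omega

theorem size_mul_le (x y : ℕ) : (x * y).size ≤ x.size + y.size := by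
  rw [Nat.size_le, pow_add]
  exact Nat.mul_lt_mul'' (Nat.lt_size_self x) (Nat.lt_size_self y)

/-- Bounds the cost of a single round. As a bound on stored values it would be useless: the factor
in front of `B` would compound over the rounds of a loop. -/
theorem Exp.size_cost_le {σ : Store} {B : ℕ} (h : ∀ a i, (σ a i).size ≤ B) (e : Exp) :
    (e.val σ).size ≤ e.weight * (B + 1) ∧ e.cost σ ≤ e.weight * (B + 1) := by
  induction e with
  | lit m => simp only [val, cost, weight]; constructor <;> nlinarith [Nat.zero_le m.size]
  | read a idx ih =>
    simp only [val, cost, weight]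
    have := h a (idx.val σ)
    constructor <;> nlinarith
  | add e₁ e₂ ih₁ ih₂ =>
    simp only [val, cost, weight]
    have := size_add_le (e₁.val σ) (e₂.val σ)
    have h3 : max (e₁.val σ).size (e₂.val σ).size ≤ (e₁.val σ).size + (e₂.val σ).size :=
      max_le_add_of_nonneg (Nat.zero_le _) (Nat.zero_le _)
    constructor <;> nlinarith
  | sub e₁ e₂ ih₁ ih₂ =>
    simp only [val, cost, weight]
    have := Nat.size_le_size (Nat.sub_le (e₁.val σ) (e₂.val σ))
    constructor <;> nlinarith
  | mul e₁ e₂ ih₁ ih₂ =>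
    simp only [val, cost, weight]
    have := size_mul_le (e₁.val σ) (e₂.val σ)
    constructor <;> nlinarith
  | div e₁ e₂ ih₁ ih₂ =>
    simp only [val, cost, weight]
    have := Nat.size_le_size (Nat.div_le_self (e₁.val σ) (e₂.val σ))
    constructor <;> nlinarith

/-- The coefficient of `B` is one, so iterating the bound adds up instead of compounding. A product
costs only `L` because its first factor is an input cell. -/
theorem Exp.size_le_of_tame {σ : Store} {B L : ℕ} (h : ∀ a i, (σ a i).size ≤ B)
    (h0 : ∀ i, (σ 0 i).size ≤ L) (e : Exp) (he : e.Tame) :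
    (e.val σ).size ≤ B + e.growth * (L + 1) := by
  induction e with
  | lit m => simp only [val, growth]; nlinarith [Nat.zero_le m.size]
  | read a idx ih => simpa [val, growth] using h a _
  | add e₁ e₂ ih₁ ih₂ =>
    simp only [val, growth]
    have h1 := ih₁ he.1
    have h2 := ih₂ he.2
    have := size_add_le (e₁.val σ) (e₂.val σ)
    have h3 : max (e₁.val σ).size (e₂.val σ).size ≤
        B + e₁.growth * (L + 1) + e₂.growth * (L + 1) := max_le (by omega) (by omega)
    nlinarith
  | sub e₁ e₂ ih₁ _ =>
    exact (Nat.size_le_size (Nat.sub_le (e₁.val σ) (e₂.val σ))).trans (ih₁ he)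
  | mul e₁ e₂ _ ih₂ =>
    cases e₁ with
    | read a idx =>
      cases a with
      | zero =>
        have := size_mul_le (σ 0 (idx.val σ)) (e₂.val σ)
        have h1 := ih₂ he
        have h2 := h0 (idx.val σ)
        simp only [val, growth]
        nlinarith
      | succ a => exact he.elim
    | _ => exact he.elim
  | div e₁ e₂ ih₁ _ =>
    exact (Nat.size_le_size (Nat.div_le_self (e₁.val σ) (e₂.val σ))).trans (ih₁ he)

/-! ### Decision trees -/

/-- Decision trees with expressions at the leaves. -/
inductive Tree : Type
  | leaf (e : Exp)
  | ite (b : Exp) (t₁ t₂ : Tree)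

/-- The loop counter of the tables: cell `0` of array `2`. -/
def counter : Exp := .read 2 (.lit 0)

namespace Tree

def val (σ : Store) : Tree → ℕ
  | leaf e => e.val σ
  | ite b t₁ t₂ => if b.val σ ≠ 0 then t₁.val σ else t₂.val σ

/-- Write the value of the tree into the cell of `a` given by the counter. -/
def cmd (a : ℕ) : Tree → Cmd
  | leaf e => .write a counter e
  | ite b t₁ t₂ => .ite b (t₁.cmd a) (t₂.cmd a)

def Tame : Tree → Prop
  | leaf e => e.Tame
  | ite _ t₁ t₂ => t₁.Tame ∧ t₂.Tame

def weight : Tree → ℕ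
  | leaf e => 2 * e.weight + 7
  | ite b t₁ t₂ => 2 * b.weight + 1 + t₁.weight + t₂.weight

def growth : Tree → ℕ
  | leaf e => e.growth
  | ite _ t₁ t₂ => t₁.growth + t₂.growth

theorem size_le {σ : Store} {B L : ℕ} (h : ∀ a i, (σ a i).size ≤ B)
    (h0 : ∀ i, (σ 0 i).size ≤ L) (t : Tree) (ht : t.Tame) :
    (t.val σ).size ≤ B + t.growth * (L + 1) := by
  induction t with
  | leaf e => exact e.size_le_of_tame h h0 ht
  | ite b t₁ t₂ ih₁ ih₂ =>
    have h1 := ih₁ ht.1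
    have h2 := ih₂ ht.2
    simp only [val, growth]
    split_ifs <;> nlinarith [Nat.zero_le (t₁.growth * (L+1)), Nat.zero_le (t₂.growth * (L+1))]

theorem exec {σ : Store} {B : ℕ} (h : ∀ a i, (σ a i).size ≤ B) (a : ℕ) (t : Tree) :
    ∃ c, Exec (t.cmd a) σ (σ.set a (σ 2 0) (t.val σ)) c ∧ c ≤ t.weight * (B + 1) := by
  induction t with
  | leaf e =>
    refine ⟨_, Exec.write σ a counter e, ?_⟩
    have h1 := e.size_cost_le h
    have h2 := h 2 0
    have h3 : (0 : ℕ).size = 0 := rfl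
    simp only [counter, Exp.cost, Exp.val, weight, h3]
    nlinarith
  | ite b t₁ t₂ ih₁ ih₂ =>
    obtain ⟨c₁, e₁, l₁⟩ := ih₁
    obtain ⟨c₂, e₂, l₂⟩ := ih₂
    have h1 := b.size_cost_le h
    by_cases hb : b.val σ = 0
    · have e := Exec.iteFalse (c₁ := t₁.cmd a) hb e₂
      refine ⟨_, by simpa only [val, cmd, hb, ne_eq, not_true_eq_false, if_false] using e, ?_⟩
      simp only [testCost, weight]
      nlinarith [Nat.zero_le (t₁.weight * (B + 1))]
    · have e := Exec.iteTrue (c₂ := t₂.cmd a) hb e₁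
      refine ⟨_, by simpa only [val, cmd, hb, ne_eq, not_false_eq_true, if_true] using e, ?_⟩
      simp only [testCost, weight]
      nlinarith [Nat.zero_le (t₂.weight * (B + 1))]

end Tree

/-! ### Loops that fill one array -/

/-- One line of a table program: the cells `0, …, bound - 1` of the array `arr` are filled in
this order by the values of `tree`. -/
structure Line where
  arr : ℕ
  bound : Exp
  tree : Tree

namespace Line

def cmd (ℓ : Line) : Cmd :=
  .seq (.write 2 (.lit 0) (.lit 0))
    (.loop (.sub ℓ.bound counter)
      (.seq (ℓ.tree.cmd ℓ.arr) (.write 2 (.lit 0) (.add counter (.lit 1)))))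

/-- The memory after `i` rounds of the loop. -/
def fill (ℓ : Line) (σ : Store) : ℕ → Store
  | 0 => σ.set 2 0 0
  | i + 1 => ((ℓ.fill σ i).set ℓ.arr i (ℓ.tree.val (ℓ.fill σ i))).set 2 0 (i + 1)

def result (ℓ : Line) (σ : Store) : Store := ℓ.fill σ (ℓ.bound.val σ)

/-- The conditions under which a line is run. -/
structure Good (ℓ : Line) : Prop where
  arr_ne_zero : ℓ.arr ≠ 0
  arr_ne_two : ℓ.arr ≠ 2
  tame : ℓ.tree.Tame
  bound_congr : ∀ σ σ' : Store, σ 0 = σ' 0 → ℓ.bound.val σ = ℓ.bound.val σ'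
  bound_le : ∃ p : Polynomial ℕ, ∀ σ : Store, ℓ.bound.val σ ≤ p.eval (σ 0 0)

variable {ℓ : Line} (σ : Store)

theorem fill_of_ne (b : ℕ) (h : b ≠ ℓ.arr) (h2 : b ≠ 2) (i : ℕ) : ℓ.fill σ i b = σ b := by
  induction i with
  | zero => simp [fill, Store.set, Function.update_of_ne h2]
  | succ i ih => simp [fill, Store.set, Function.update_of_ne h2, Function.update_of_ne h, ih]

theorem fill_counter (i : ℕ) : ℓ.fill σ i 2 0 = i := by
  cases i <;> simp [fill, Store.set]

theorem fill_stable (hg : ℓ.Good) (i d j : ℕ) (h : j < i) :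
    ℓ.fill σ (i + d) ℓ.arr j = ℓ.fill σ i ℓ.arr j := by
  induction d with
  | zero => rfl
  | succ d ih =>
    rw [← ih, ← add_assoc]
    simp [fill, Store.set, Function.update_of_ne hg.arr_ne_two,
      Function.update_of_ne (show j ≠ i + d by omega)]

theorem fill_at (hg : ℓ.Good) (m i : ℕ) (h : i < m) :
    ℓ.fill σ m ℓ.arr i = ℓ.tree.val (ℓ.fill σ i) := by
  obtain ⟨d, rfl⟩ := Nat.exists_eq_add_of_le (show i + 1 ≤ m from h)
  rw [fill_stable σ hg _ _ _ (Nat.lt_succ_self i)]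
  simp [fill, Store.set, Function.update_of_ne hg.arr_ne_two]

theorem size_set_le {σ : Store} {B : ℕ} (h : ∀ a i, (σ a i).size ≤ B) (a i v : ℕ)
    (hv : v.size ≤ B) (b j : ℕ) : (σ.set a i v b j).size ≤ B := by
  unfold Store.set
  rcases eq_or_ne b a with rfl | hb
  · rcases eq_or_ne j i with rfl | hj
    · simpa using hv
    · simpa [Function.update_of_ne hj] using h _ _
  · simpa [Function.update_of_ne hb] using h _ _

theorem size_fill_le {σ : Store} (hg : ℓ.Good) {B L : ℕ} (h : ∀ a i, (σ a i).size ≤ B)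
    (h0 : ∀ i, (σ 0 i).size ≤ L) (i a j : ℕ) :
    (ℓ.fill σ i a j).size ≤ B + i * ((ℓ.tree.growth + 1) * (L + 1)) := by
  induction i generalizing a j with
  | zero => simpa [fill] using size_set_le h 2 0 0 (by simp) a j
  | succ i ih =>
    have hr : ∀ j, (ℓ.fill σ i 0 j).size ≤ L := fun j => by
      rw [fill_of_ne σ 0 hg.arr_ne_zero.symm (by norm_num)]; exact h0 j
    have h1 := ℓ.tree.size_le ih hr hg.tame
    -- The round also writes the counter. Its old value lies in memory and is covered by the
    -- induction hypothesis; incrementing adds at most one bit.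
    have h2 : (i + 1).size ≤ B + i * ((ℓ.tree.growth + 1) * (L + 1)) + 1 := by
      have h3 := ih 2 0
      rw [fill_counter] at h3
      have := size_add_le i 1
      have h4 : (1 : ℕ).size = 1 := Nat.size_one
      have h5 : max i.size (1 : ℕ).size ≤ max i.size 1 := by rw [h4]
      rcases Nat.eq_zero_or_pos i with rfl | hi
      · simp
      · have : 1 ≤ i.size := Nat.size_pos.2 hi
        omega
    have h3 : ∀ a j, (ℓ.fill σ i a j).size ≤
        B + (i + 1) * ((ℓ.tree.growth + 1) * (L + 1)) :=
      fun a j => (ih a j).trans (by nlinarith [Nat.zero_le ((ℓ.tree.growth + 1) * (L + 1))])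
    have h4 : 1 ≤ (ℓ.tree.growth + 1) * (L + 1) := Nat.mul_pos (by omega) (by omega)
    exact size_set_le (size_set_le h3 _ _ _ (by nlinarith)) _ _ _ (by nlinarith) a j

theorem exec {σ : Store} (hg : ℓ.Good) {B L N : ℕ} (h : ∀ a i, (σ a i).size ≤ B)
    (h0 : ∀ i, (σ 0 i).size ≤ L) (hN : ℓ.bound.val σ = N) :
    ∃ c, Exec ℓ.cmd σ (ℓ.result σ) c ∧ c ≤ (N + 1) *
      ((4 * ℓ.bound.weight + ℓ.tree.weight + 40) *
        (B + N * ((ℓ.tree.growth + 1) * (L + 1)) + 1)) + 40 := by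
  -- `B'` bounds every cell in every state of the loop, so a single constant `C` bounds the cost of
  -- each round.
  set B' := B + N * ((ℓ.tree.growth + 1) * (L + 1)) with hB'
  set C := (4 * ℓ.bound.weight + ℓ.tree.weight + 40) * (B' + 1) with hC
  have hbd : ∀ i ≤ N, ∀ a j, (ℓ.fill σ i a j).size ≤ B' := fun i hi a j =>
    (size_fill_le hg h h0 i a j).trans (by rw [hB']; gcongr)
  have hb : ∀ i, ℓ.bound.val (ℓ.fill σ i) = N := fun i => by
    rw [← hN]; exact hg.bound_congr _ _ (fill_of_ne σ 0 hg.arr_ne_zero.symm (by norm_num) i)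
  have hval : ∀ i, (Exp.sub ℓ.bound counter).val (ℓ.fill σ i) = N - i := fun i => by
    simp [Exp.val, counter, hb, fill_counter]
  have htest : ∀ i ≤ N, testCost (ℓ.fill σ i) (Exp.sub ℓ.bound counter) ≤
      (4 * ℓ.bound.weight + 16) * (B' + 1) := fun i hi => by
    have h1 := (Exp.sub ℓ.bound counter).size_cost_le (hbd i hi)
    have h2 : (Exp.sub ℓ.bound counter).weight = 2 * ℓ.bound.weight + 7 := rfl
    rw [h2] at h1
    unfold testCost
    nlinarith
  -- Induction on the number `d` of rounds still to be done, matching the right-recursive rule for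
  -- loops.
  have key : ∀ d i, i + d = N → ∃ c, Exec (.loop (.sub ℓ.bound counter)
      (.seq (ℓ.tree.cmd ℓ.arr) (.write 2 (.lit 0) (.add counter (.lit 1)))))
      (ℓ.fill σ i) (ℓ.fill σ N) c ∧ c ≤ (d + 1) * C := by
    intro d
    induction d with
    | zero =>
      rintro i rfl
      refine ⟨_, Exec.loopFalse (by simp [hval]), (htest _ (by omega)).trans ?_⟩
      rw [hC, zero_add, one_mul]
      exact Nat.mul_le_mul_right _ (by omega)
    | succ d ih =>
      intro i hi
      obtain ⟨c, e, hc⟩ := ih (i + 1) (by omega)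
      obtain ⟨c₁, e₁, hc₁⟩ := ℓ.tree.exec (hbd i (by omega)) ℓ.arr
      rw [fill_counter] at e₁
      set σ₁ := (ℓ.fill σ i).set ℓ.arr i (ℓ.tree.val (ℓ.fill σ i)) with hσ₁
      have hcnt : σ₁ 2 0 = i := by
        rw [hσ₁]
        simp [Store.set, Function.update_of_ne hg.arr_ne_two.symm, fill_counter]
      have e₂ := Exec.write σ₁ 2 (.lit 0) (.add counter (.lit 1))
      have hset : σ₁.set 2 ((Exp.lit 0).val σ₁) ((Exp.add counter (.lit 1)).val σ₁) =
          ℓ.fill σ (i + 1) := by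
        simp only [Exp.val, counter, hcnt, fill]
        rfl
      rw [hset] at e₂
      refine ⟨_, Exec.loopTrue (by rw [hval]; omega) (Exec.seq e₁ e₂) e, ?_⟩
      have h1 := htest i (by omega)
      have hsi : i.size ≤ B' := by
        have := hbd i (by omega) 2 0
        rwa [fill_counter] at this
      have hsi1 : (i + 1).size ≤ B' := by
        have := hbd (i + 1) (by omega) 2 0
        rwa [fill_counter] at this
      have h2 : (Exp.lit 0).cost σ₁ + (Exp.add counter (.lit 1)).cost σ₁ +
          ((Exp.lit 0).val σ₁).size + ((Exp.add counter (.lit 1)).val σ₁).size + 1 ≤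
          20 * (B' + 1) := by
        have h3 : (0 : ℕ).size = 0 := rfl
        have h4 : (1 : ℕ).size = 1 := Nat.size_one
        simp only [Exp.cost, Exp.val, counter, hcnt, h3, h4]
        omega
      have : C = (4 * ℓ.bound.weight + 16) * (B' + 1) + ℓ.tree.weight * (B' + 1)
          + 24 * (B' + 1) := by rw [hC]; ring
      nlinarith
  obtain ⟨c, e, hc⟩ := key N 0 (zero_add N)
  have e₀ := Exec.write σ 2 (.lit 0) (.lit 0)
  rw [result, hN]
  refine ⟨_, Exec.seq e₀ e, ?_⟩
  have h3 : (0 : ℕ).size = 0 := rfl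
  simp only [Exp.cost, Exp.val, h3]
  omega

end Line

/-! ### Sequences of loops -/

/-- Run the lines in order. -/
def program : List Line → Cmd
  | [] => .skip
  | ℓ :: ls => .seq ℓ.cmd (program ls)

def run : List Line → Store → Store
  | [], σ => σ
  | ℓ :: ls, σ => run ls (ℓ.result σ)

theorem eval_mono (p : Polynomial ℕ) {m n : ℕ} (h : m ≤ n) : p.eval m ≤ p.eval n := by
  rw [Polynomial.eval_eq_sum_range, Polynomial.eval_eq_sum_range]
  gcongr

/-- The list of lines does not depend on the instance, so the polynomial for cell lengths is updated
a fixed number of times. The value of `n` in cell `0` never changes, which keeps the numbers of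
rounds polynomial throughout. -/
theorem exec_program {α : Type} (sz : α → ℕ) (ls : List Line) (hg : ∀ ℓ ∈ ls, ℓ.Good)
    (σ : α → Store) (hB : ∃ p : Polynomial ℕ, ∀ x a i, (σ x a i).size ≤ p.eval (sz x))
    (hn : ∃ p : Polynomial ℕ, ∀ x, σ x 0 0 ≤ p.eval (sz x)) :
    ∃ p : Polynomial ℕ, ∀ x, ∃ t, Exec (program ls) (σ x) (run ls (σ x)) t ∧
      t ≤ p.eval (sz x) := by
  induction ls generalizing σ with
  | nil => exact ⟨1, fun x => ⟨1, Exec.skip _, by simp⟩⟩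
  | cons ℓ ls ih =>
    have hℓ := hg ℓ (by simp)
    obtain ⟨p, hp⟩ := hB
    obtain ⟨q, hq⟩ := hn
    obtain ⟨r, hr⟩ := hℓ.bound_le
    have hN : ∀ x, ℓ.bound.val (σ x) ≤ (r.comp q).eval (sz x) := fun x => by
      rw [Polynomial.eval_comp]
      exact (hr _).trans (eval_mono r (hq x))
    obtain ⟨P, hP⟩ := ih (fun ℓ hm => hg ℓ (by simp [hm])) (fun x => ℓ.result (σ x))
      -- Length bound after this line: the old bound plus the growth per round times the number of
      -- rounds.
      ⟨p + r.comp q * ((ℓ.tree.growth + 1 : ℕ) * (p + 1)), fun x a i => by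
        refine (Line.size_fill_le hℓ (hp x) (fun i => hp x 0 i) _ a i).trans ?_
        simp only [Polynomial.eval_add, Polynomial.eval_mul, Polynomial.eval_natCast,
          Polynomial.eval_one]
        have := hN x
        simp only [Nat.cast_id]
        gcongr⟩
      ⟨q, fun x => by
        simp only [Line.result]
        rw [Line.fill_of_ne _ 0 hℓ.arr_ne_zero.symm (by norm_num)]
        exact hq x⟩
    refine ⟨(r.comp q + 1) * ((4 * ℓ.bound.weight + ℓ.tree.weight + 40 : ℕ) *
      (p + r.comp q * ((ℓ.tree.growth + 1 : ℕ) * (p + 1)) + 1)) + (40 : ℕ) + P, fun x => ?_⟩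
    obtain ⟨t, e, ht⟩ := hP x
    obtain ⟨c, e', hc⟩ := Line.exec hℓ (hp x) (fun i => hp x 0 i) rfl
    refine ⟨_, Exec.seq e' e, ?_⟩
    rw [Polynomial.eval_add, Polynomial.eval_add]
    refine add_le_add (hc.trans ?_) ht
    simp only [Polynomial.eval_add, Polynomial.eval_mul, Polynomial.eval_natCast,
          Polynomial.eval_one, Nat.cast_id]
    have := hN x
    gcongr

theorem run_of_not_mem (ls : List Line) (σ : Store) (b : ℕ) (h2 : b ≠ 2)
    (hb : b ∉ ls.map Line.arr) : run ls σ b = σ b := by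
  induction ls generalizing σ with
  | nil => rfl
  | cons ℓ ls ih =>
    simp only [List.map_cons, List.mem_cons, not_or] at hb
    rw [run, ih _ hb.2, Line.result, Line.fill_of_ne _ _ hb.1 h2]

theorem run_append (ls ls' : List Line) (σ : Store) : run (ls ++ ls') σ = run ls' (run ls σ) := by
  induction ls generalizing σ with
  | nil => rfl
  | cons ℓ ls ih => simp [run, ih]

/-- The cells of the array of a line, expressed by the final memory of the program. -/
theorem run_line (pre post : List Line) (ℓ : Line) (σ : Store)
    (hg : ∀ ℓ' ∈ pre ++ ℓ :: post, ℓ'.Good) (hn : ℓ.arr ∉ post.map Line.arr) (Ω : Store)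
    (hΩ : run (pre ++ ℓ :: post) σ = Ω) (i : ℕ) (hi : i < ℓ.bound.val Ω) :
    ∃ τ : Store, Ω ℓ.arr i = ℓ.tree.val τ ∧ τ 2 0 = i ∧
      (∀ b, b ≠ 2 → b ∉ (ℓ :: post).map Line.arr → τ b = Ω b) ∧
      ∀ k < i, τ ℓ.arr k = Ω ℓ.arr k := by
  subst hΩ
  have hℓ := hg ℓ (by simp)
  set σ₁ := run pre σ with hσ₁
  have h0 : ∀ ls : List Line, (∀ ℓ' ∈ ls, ℓ'.Good) → 0 ∉ ls.map Line.arr := by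
    intro ls hls hmem
    obtain ⟨ℓ', h1, h2⟩ := List.mem_map.1 hmem
    exact (hls ℓ' h1).arr_ne_zero h2
  rw [run_append, ← hσ₁] at hi ⊢
  -- The bound depends only on the input array, which no line writes.
  have hbound : ℓ.bound.val (run (ℓ :: post) σ₁) = ℓ.bound.val σ₁ :=
    hℓ.bound_congr _ _ (run_of_not_mem _ _ 0 (by norm_num)
      (h0 _ fun ℓ' h => hg ℓ' (List.mem_append_right _ h)))
  rw [hbound] at hi
  have hrow : run (ℓ :: post) σ₁ ℓ.arr = ℓ.fill σ₁ (ℓ.bound.val σ₁) ℓ.arr := by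
    rw [run, run_of_not_mem _ _ _ hℓ.arr_ne_two hn, Line.result]
  refine ⟨ℓ.fill σ₁ i, ?_, Line.fill_counter _ _, fun b h2 hb => ?_, fun k hk => ?_⟩
  · rw [hrow, Line.fill_at _ hℓ _ _ hi]
  · rw [run_of_not_mem _ _ _ h2 hb, Line.fill_of_ne _ _ (fun h => hb (by simp [h])) h2]
  · rw [hrow, Line.fill_at _ hℓ _ _ (hk.trans hi), Line.fill_at _ hℓ _ _ hk]

end RAM

namespace JRP

/-! ### Minimization over a range, with `0` as the value of infeasible candidates -/

/-- The minimum of two values, where `0` stands for infinity. -/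
def omin (x y : ℕ) : ℕ := if y = 0 then x else if x = 0 ∨ y < x then y else x

def scan (f : ℕ → ℕ) : ℕ → ℕ
  | 0 => 0
  | m + 1 => omin (scan f m) (f m)

/-- The last position before `m` at which the sequence `g` has changed. -/
def lastChange (g : ℕ → ℕ) : ℕ → ℕ
  | 0 => 0
  | m + 1 => if g (m + 1) = g m then lastChange g m else m

theorem scan_le (f : ℕ → ℕ) {m i : ℕ} (hi : i < m) (hf : f i ≠ 0) :
    scan f m ≠ 0 ∧ scan f m ≤ f i := by
  induction m with
  | zero => omega
  | succ m ih =>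
    simp only [scan, omin]
    rcases Nat.lt_succ_iff_lt_or_eq.1 hi with h | rfl
    · have := ih h
      split_ifs <;> omega
    · split_ifs <;> omega

/-- The running minimum changes only when it is improved strictly or becomes finite, so the last
change sits at a minimizer. -/
theorem scan_lastChange (f : ℕ → ℕ) {m : ℕ} (h : scan f m ≠ 0) :
    lastChange (scan f) m < m ∧ f (lastChange (scan f) m) = scan f m := by
  induction m with
  | zero => exact (h rfl).elim
  | succ m ih =>
    rw [lastChange]
    split_ifs with he
    · rw [he] at h ⊢
      exact ⟨(ih h).1.trans (Nat.lt_succ_self m), (ih h).2⟩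
    · refine ⟨Nat.lt_succ_self m, ?_⟩
      simp only [scan, omin] at he ⊢
      split_ifs at he ⊢ <;> omega

/-! ### The recursion -/

/-- The data of an instance with jobs `0, …, n - 1`. -/
structure Data (s : ℕ) where
  n : ℕ
  K₀ : ℕ
  K : Fin s → ℕ
  r : ℕ → ℕ
  w : ℕ → ℕ
  q : ℕ → Finset (Fin s)

/-- A window of time, from the moment `a` to the moment `b`, with the last replenishments `u`
before and `v` until the end of the window. All are given by their numbers. -/
@[ext] structure Window where
  a : ℕ
  b : ℕ
  u : ℕ
  v : ℕ

namespace Data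

variable {s : ℕ} (D : Data s)

/-- The number of time moments `r j + m`. -/
def M : ℕ := (D.n + 1) * (D.n + 2)

/-- The number of assignments of a release date or nothing to the resources. -/
def U : ℕ := (D.n + 1) ^ s

/-- Offsets run up to `n + 1`, one more than a start needs, so that the moment after a start has the
next code. The extra row `r n` belongs to no job; it keeps `M` positive for `n = 0` and is harmless.
-/
def time (c : ℕ) : ℕ := if c < D.M then D.r (c / (D.n + 2)) + c % (D.n + 2) else 0

/-- The successor of the `c`th release date, and `0` if there is none. -/
def rel (c : ℕ) : ℕ := if c < D.n then D.r c + 1 else 0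

/-- The successor of the last replenishment of resource `i` in the assignment `u`. -/
def last (u : ℕ) (i : Fin s) : ℕ := D.rel (u / (D.n + 1) ^ (i : ℕ) % (D.n + 1))

/-- Some replenishment lies at or after `r j` iff the last one does. The inequality is strict
because `last` is shifted by one, with `0` for "never". -/
def Ready (u j : ℕ) : Prop := ∀ i ∈ D.q j, D.r j < D.last u i

/-- The cost of replenishing the resources `A` at one moment, if there are any. -/
def orderCost (A : Finset (Fin s)) : ℕ := if A = ∅ then 0 else D.K₀ + ∑ i ∈ A, D.K i

def times (S : Window) : Finset ℕ := Finset.Icc (D.time S.a) (D.time S.b)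

/-- The resources that are replenished last at time `θ`. -/
def finalRepl (S : Window) (θ : ℕ) : Finset (Fin s) :=
  Finset.univ.filter fun i => D.last S.v i = θ + 1

open Classical in
-- Only the replenishments forced by `v` are paid for. The condition says that each entry of `v` is
-- inherited from `u` or lies in the window; the added one reserves `0` for infeasibility.
noncomputable def base (S : Window) : ℕ :=
  if ∀ i : Fin s, D.last S.v i = D.last S.u i ∨
    D.time S.a < D.last S.v i ∧ D.last S.v i ≤ D.time S.b + 1
  then ∑ θ ∈ D.times S, D.orderCost (D.finalRepl S θ) + 1 else 0

end Data

namespace Window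

def left (S : Window) (t x : ℕ) : Window := ⟨S.a, t, S.u, x⟩

def right (S : Window) (t x : ℕ) : Window := ⟨t + 1, S.b, x, S.v⟩

end Window

namespace Data

variable {s : ℕ} (D : Data s)

/-- Job `j` does not become ready in the window. -/
def Stays (j : ℕ) (S : Window) : Prop := D.Ready S.u j ∨ ¬ D.Ready S.v j

/-- The window can be split at time `t` with last replenishments `x`, where job `j` is started. -/
def Splits (V : Window → ℕ) (j : ℕ) (S : Window) (t x : ℕ) : Prop :=
  D.time S.a ≤ D.time t ∧ D.time t < D.time S.b ∧ D.time (t + 1) = D.time t + 1 ∧ D.Ready x j ∧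
    V (S.left t x) ≠ 0 ∧ V (S.right t x) ≠ 0

open Classical in
-- Both values of `V` are costs plus one, so one unit is taken off to get again a cost plus one.
noncomputable def candidate (V : Window → ℕ) (j : ℕ) (S : Window) (c : ℕ) : ℕ :=
  if D.Splits V j S (c / D.U) (c % D.U) then
    V (S.left (c / D.U) (c % D.U)) + V (S.right (c / D.U) (c % D.U)) +
      D.w j * (D.time (c / D.U) + 1) - 1
  else 0

open Classical in
/-- The successor of the minimum cost over the first `m` candidates, and `0` if all of them are
infeasible. -/
noncomputable def slots : ℕ → Window → ℕ → ℕ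
  | 0, S, _ => D.base S
  | k + 1, S, m =>
    if D.Stays k S then slots k S (D.M * D.U)
    else scan (D.candidate (fun S' => slots k S' (D.M * D.U)) k S) m

noncomputable def value (k : ℕ) (S : Window) : ℕ := D.slots k S (D.M * D.U)

noncomputable def choice (k : ℕ) (S : Window) : ℕ := lastChange (D.slots k S) (D.M * D.U)

/-- The moment at which the window is split. -/
noncomputable def cut (k : ℕ) (S : Window) : ℕ := D.choice k S / D.U

/-- The last replenishments at the moment at which the window is split. -/
noncomputable def mid (k : ℕ) (S : Window) : ℕ := D.choice k S % D.U

theorem value_zero (S : Window) : D.value 0 S = D.base S := rfl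

theorem value_succ_of_stays {k : ℕ} {S : Window} (h : D.Stays k S) :
    D.value (k + 1) S = D.value k S := by
  simp [value, slots, h]

theorem U_pos : 0 < D.U := Nat.pow_pos (Nat.succ_pos _)

theorem splits_of_value_ne_zero {k : ℕ} {S : Window} (h : ¬ D.Stays k S)
    (hv : D.value (k + 1) S ≠ 0) :
    D.cut (k + 1) S < D.M ∧ D.mid (k + 1) S < D.U ∧
    D.Splits (D.value k) k S (D.cut (k + 1) S) (D.mid (k + 1) S) ∧
    D.value (k + 1) S = D.value k (S.left (D.cut (k + 1) S) (D.mid (k + 1) S)) +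
      D.value k (S.right (D.cut (k + 1) S) (D.mid (k + 1) S)) +
      D.w k * (D.time (D.cut (k + 1) S) + 1) - 1 := by
  have hs : D.slots (k + 1) S = scan (D.candidate (D.value k) k S) := by
    funext m
    simp only [slots, h, if_false]
    rfl
  simp only [value, cut, mid, choice, hs] at hv ⊢
  obtain ⟨h1, h2⟩ := scan_lastChange _ hv
  set c := lastChange (scan (D.candidate (D.value k) k S)) (D.M * D.U)
  rw [← h2] at hv ⊢
  unfold candidate at hv ⊢
  split_ifs at hv ⊢ with h3
  · exact ⟨(Nat.div_lt_iff_lt_mul D.U_pos).2 h1, Nat.mod_lt _ D.U_pos, h3, rfl⟩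
  · exact (hv rfl).elim

theorem value_le_of_splits {k : ℕ} {S : Window} {t x : ℕ} (h : ¬ D.Stays k S) (ht : t < D.M)
    (hx : x < D.U) (hs : D.Splits (D.value k) k S t x) :
    D.value (k + 1) S ≠ 0 ∧ D.value (k + 1) S ≤ D.value k (S.left t x) +
      D.value k (S.right t x) + D.w k * (D.time t + 1) - 1 := by
  have hc : t * D.U + x < D.M * D.U := by
    have := Nat.mul_le_mul_right D.U (show t + 1 ≤ D.M from ht)
    rw [Nat.add_mul, one_mul] at this
    omega
  have h1 : (t * D.U + x) / D.U = t := by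
    rw [mul_comm, Nat.mul_add_div D.U_pos, Nat.div_eq_of_lt hx, add_zero]
  have h2 : (t * D.U + x) % D.U = x := by
    rw [mul_comm, Nat.mul_add_mod, Nat.mod_eq_of_lt hx]
  have hcand : D.candidate (D.value k) k S (t * D.U + x) = D.value k (S.left t x) +
      D.value k (S.right t x) + D.w k * (D.time t + 1) - 1 := by
    simp only [candidate, h1, h2, hs, if_true]
  have hv : D.value (k + 1) S = scan (D.candidate (D.value k) k S) (D.M * D.U) := by
    simp only [value, slots, h, if_false]
    rfl
  rw [hv, ← hcand]
  refine scan_le _ hc ?_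
  rw [hcand]
  have := hs.2.2.2.2
  omega

/-! ### The solution constructed from the recursion -/

open Classical in
-- Backtracking follows a single job: readiness at the cut decides which part contains it. Jobs
-- outside the window get irrelevant values.
noncomputable def start : ℕ → Window → ℕ → ℕ
  | 0, _, _ => 0
  | k + 1, S, j =>
    if D.Stays k S then start k S j
    else if j = k then D.time (D.cut (k + 1) S)
    else if D.Ready (D.mid (k + 1) S) j then
      start k (S.left (D.cut (k + 1) S) (D.mid (k + 1) S)) j
    else start k (S.right (D.cut (k + 1) S) (D.mid (k + 1) S)) j

open Classical in
noncomputable def repl : ℕ → Window → ℕ → Finset (Fin s)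
  | 0, S, θ => D.finalRepl S θ
  | k + 1, S, θ =>
    if D.Stays k S then repl k S θ
    else if θ ≤ D.time (D.cut (k + 1) S) then
      repl k (S.left (D.cut (k + 1) S) (D.mid (k + 1) S)) θ
    else repl k (S.right (D.cut (k + 1) S) (D.mid (k + 1) S)) θ

open Classical in
/-- The jobs among the first `k` that become ready in the window. -/
noncomputable def jobs (k : ℕ) (S : Window) : Finset ℕ :=
  (Finset.range k).filter fun j => ¬ D.Stays j S

/-- `st` and `Q` describe a feasible solution for the jobs `< k` that become ready in the
window. -/
structure Fits (k : ℕ) (S : Window) (st : ℕ → ℕ) (Q : ℕ → Finset (Fin s)) : Prop where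
  le : D.time S.a ≤ D.time S.b
  old : ∀ i, D.last S.u i ≤ D.time S.a
  range : ∀ j ∈ D.jobs k S, D.time S.a ≤ st j ∧ st j < D.time S.b
  inj : Set.InjOn st (D.jobs k S : Set ℕ)
  ready : ∀ j ∈ D.jobs k S, ∀ i ∈ D.q j, D.r j < D.last S.u i ∨
    ∃ θ ∈ D.times S, i ∈ Q θ ∧ D.r j ≤ θ ∧ θ ≤ st j
  final : ∀ i, D.last S.v i = D.last S.u i ∨
    ∃ θ ∈ D.times S, D.last S.v i = θ + 1 ∧ i ∈ Q θ

noncomputable def windowCost (k : ℕ) (S : Window) (st : ℕ → ℕ) (Q : ℕ → Finset (Fin s)) : ℕ :=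
  ∑ j ∈ D.jobs k S, D.w j * (st j + 1) + ∑ θ ∈ D.times S, D.orderCost (Q θ)

end Data
end JRP

/-! ### Soundness: the recursion describes feasible solutions -/

namespace JRP
namespace Data

variable {s : ℕ} (D : Data s)

theorem mem_jobs {k j : ℕ} {S : Window} :
    j ∈ D.jobs k S ↔ j < k ∧ ¬ D.Ready S.u j ∧ D.Ready S.v j := by
  classical
  simp only [jobs, Finset.mem_filter, Finset.mem_range, Stays, not_or, not_not]

theorem mem_times {S : Window} {θ : ℕ} :
    θ ∈ D.times S ↔ D.time S.a ≤ θ ∧ θ ≤ D.time S.b := Finset.mem_Icc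

theorem jobs_succ_of_stays {k : ℕ} {S : Window} (h : D.Stays k S) :
    D.jobs (k + 1) S = D.jobs k S := by
  ext j
  simp only [jobs, Finset.mem_filter, Finset.mem_range]
  constructor
  · rintro ⟨h1, h2⟩
    exact ⟨lt_of_le_of_ne (Nat.lt_succ_iff.1 h1) (by rintro rfl; exact h2 h), h2⟩
  · rintro ⟨h1, h2⟩
    exact ⟨h1.trans (Nat.lt_succ_self k), h2⟩

variable {D}

theorem Ready.mono {u v j : ℕ} (h : D.Ready u j) (huv : ∀ i, D.last u i ≤ D.last v i) :
    D.Ready v j := fun i hi => (h i hi).trans_le (huv i)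

theorem Fits.last_le {k : ℕ} {S : Window} {st Q} (h : D.Fits k S st Q) (i : Fin s) :
    D.last S.u i ≤ D.last S.v i := by
  have h1 := h.old i
  rcases h.final i with h2 | ⟨θ, h2, h3, -⟩
  · exact h2.ge
  · have := (D.mem_times.1 h2).1
    omega

/-- Readiness is monotone along `u ≤ x ≤ v`, so each job of the window other than `k` becomes ready
in exactly one of the two parts. -/
theorem sum_jobs_split {k t x : ℕ} {S : Window} (hk : ¬ D.Stays k S)
    (hux : ∀ i, D.last S.u i ≤ D.last x i) (hxv : ∀ i, D.last x i ≤ D.last S.v i) (f : ℕ → ℕ) :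
    ∑ j ∈ D.jobs (k + 1) S, f j =
      f k + (∑ j ∈ D.jobs k (S.left t x), f j + ∑ j ∈ D.jobs k (S.right t x), f j) := by
  classical
  have hd : Disjoint (D.jobs k (S.left t x)) (D.jobs k (S.right t x)) := by
    rw [Finset.disjoint_left]
    intro j h1 h2
    exact ((D.mem_jobs.1 h2).2.1 (D.mem_jobs.1 h1).2.2)
  have hk' : k ∉ D.jobs k (S.left t x) ∪ D.jobs k (S.right t x) := by
    intro h
    rcases Finset.mem_union.1 h with h | h <;> exact absurd (D.mem_jobs.1 h).1 (lt_irrefl k)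
  rw [← Finset.sum_union hd, ← Finset.sum_insert hk']
  congr 1
  ext j
  have hs : ¬ D.Ready S.u k ∧ D.Ready S.v k := by simpa [Stays] using hk
  simp only [Finset.mem_insert, Finset.mem_union, D.mem_jobs, Window.left, Window.right]
  constructor
  · rintro ⟨h1, h2, h3⟩
    rcases Nat.lt_succ_iff_lt_or_eq.1 h1 with h | h
    · by_cases hx : D.Ready x j
      · exact Or.inr (Or.inl ⟨h, h2, hx⟩)
      · exact Or.inr (Or.inr ⟨h, hx, h3⟩)
    · exact Or.inl h
  · rintro (rfl | ⟨h1, h2, h3⟩ | ⟨h1, h2, h3⟩)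
    · exact ⟨Nat.lt_succ_self _, hs⟩
    · exact ⟨by omega, h2, h3.mono hxv⟩
    · exact ⟨by omega, fun h => h2 (h.mono hux), h3⟩

/-- The right part begins at code `t + 1`, which `h3` makes the moment right after `t`; hence no
moment is lost or counted twice. -/
theorem sum_times_split {t x : ℕ} {S : Window} (h1 : D.time S.a ≤ D.time t)
    (h2 : D.time t < D.time S.b) (h3 : D.time (t + 1) = D.time t + 1) (f : ℕ → ℕ) :
    ∑ θ ∈ D.times S, f θ =
      ∑ θ ∈ D.times (S.left t x), f θ + ∑ θ ∈ D.times (S.right t x), f θ := by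
  have hd : Disjoint (D.times (S.left t x)) (D.times (S.right t x)) := by
    rw [Finset.disjoint_left]
    intro θ h4 h5
    simp only [mem_times, Window.left, Window.right] at h4 h5
    omega
  rw [← Finset.sum_union hd]
  congr 1
  ext θ
  simp only [Finset.mem_union, mem_times, Window.left, Window.right]
  omega

/-- Feasible solutions of the two parts of a window are combined. -/
theorem Fits.glue {k t x : ℕ} {S : Window} {st st₁ st₂ : ℕ → ℕ} {Q Q₁ Q₂ : ℕ → Finset (Fin s)}
    (h₁ : D.Fits k (S.left t x) st₁ Q₁) (h₂ : D.Fits k (S.right t x) st₂ Q₂)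
    (hk : ¬ D.Stays k S) (h3 : D.time (t + 1) = D.time t + 1)
    (hx : D.Ready x k) (hst : st k = D.time t)
    (hst₁ : ∀ j < k, D.Ready x j → st j = st₁ j) (hst₂ : ∀ j < k, ¬ D.Ready x j → st j = st₂ j)
    (hQ₁ : ∀ θ ≤ D.time t, Q θ = Q₁ θ) (hQ₂ : ∀ θ, D.time t < θ → Q θ = Q₂ θ) :
    D.Fits (k + 1) S st Q ∧ D.windowCost (k + 1) S st Q =
      D.windowCost k (S.left t x) st₁ Q₁ + D.windowCost k (S.right t x) st₂ Q₂ +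
        D.w k * (D.time t + 1) := by
  have hux : ∀ i, D.last S.u i ≤ D.last x i := h₁.last_le
  have hxv : ∀ i, D.last x i ≤ D.last S.v i := h₂.last_le
  have hat : D.time S.a ≤ D.time t := h₁.le
  have htb : D.time t < D.time S.b := by have := h₂.le; simp only [Window.right] at this; omega
  have hs : ¬ D.Ready S.u k ∧ D.Ready S.v k := by simpa [Stays] using hk
  -- What `x` promises really happens by time `t`, either before the window or in its left part. Job
  -- `k` and the jobs of the right part rely on this.
  have hmid : ∀ i, D.last x i = D.last S.u i ∨
      ∃ θ ∈ D.times S, θ ≤ D.time t ∧ D.last x i = θ + 1 ∧ i ∈ Q θ := by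
    intro i
    rcases h₁.final i with h | ⟨θ, h4, h5, h6⟩
    · exact Or.inl h
    · obtain ⟨h7, h8⟩ := D.mem_times.1 h4
      simp only [Window.left] at h7 h8
      exact Or.inr ⟨θ, D.mem_times.2 ⟨h7, by omega⟩, h8, h5, by rwa [hQ₁ θ h8]⟩
  have hcase : ∀ j ∈ D.jobs (k + 1) S,
      (j = k ∧ st j = D.time t) ∨ (j ∈ D.jobs k (S.left t x) ∧ st j = st₁ j) ∨
      (j ∈ D.jobs k (S.right t x) ∧ st j = st₂ j) := by
    intro j hj
    obtain ⟨h4, h5, h6⟩ := D.mem_jobs.1 hj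
    rcases Nat.lt_succ_iff_lt_or_eq.1 h4 with h | rfl
    · by_cases hxj : D.Ready x j
      · exact Or.inr (Or.inl ⟨D.mem_jobs.2 ⟨h, h5, hxj⟩, hst₁ j h hxj⟩)
      · exact Or.inr (Or.inr ⟨D.mem_jobs.2 ⟨h, hxj, h6⟩, hst₂ j h hxj⟩)
    · exact Or.inl ⟨rfl, hst⟩
  have hl : ∀ j ∈ D.jobs k (S.left t x), D.time S.a ≤ st₁ j ∧ st₁ j < D.time t := h₁.range
  have hr : ∀ j ∈ D.jobs k (S.right t x), D.time t < st₂ j ∧ st₂ j < D.time S.b := fun j hj => by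
    have := h₂.range j hj
    simp only [Window.right] at this
    omega
  refine ⟨⟨by omega, h₁.old, ?_, ?_, ?_, ?_⟩, ?_⟩
  · intro j hj
    rcases hcase j hj with ⟨-, h⟩ | ⟨h4, h⟩ | ⟨h4, h⟩
    · omega
    · have := hl j h4; omega
    · have := hr j h4; omega
  · intro j hj j' hj' he
    rcases hcase j hj with ⟨h5, h⟩ | ⟨h4, h⟩ | ⟨h4, h⟩ <;>
      rcases hcase j' hj' with ⟨h5', h'⟩ | ⟨h4', h'⟩ | ⟨h4', h'⟩
    · omega
    · have := hl j' h4'; omega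
    · have := hr j' h4'; omega
    · have := hl j h4; omega
    · exact h₁.inj h4 h4' (by omega)
    · have := hl j h4; have := hr j' h4'; omega
    · have := hr j h4; omega
    · have := hr j h4; have := hl j' h4'; omega
    · exact h₂.inj h4 h4' (by omega)
  · intro j hj i hi
    have hready : D.Ready x j → D.time t ≤ st j → D.r j < D.last S.u i ∨
        ∃ θ ∈ D.times S, i ∈ Q θ ∧ D.r j ≤ θ ∧ θ ≤ st j := by
      intro h h'
      have h4 := h i hi
      rcases hmid i with h5 | ⟨θ, h5, h6, h7, h8⟩
      · exact Or.inl (by omega)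
      · exact Or.inr ⟨θ, h5, h8, by omega, by omega⟩
    rcases hcase j hj with ⟨rfl, h⟩ | ⟨h4, h⟩ | ⟨h4, h⟩
    · exact hready hx (by omega)
    · rcases h₁.ready j h4 i hi with h5 | ⟨θ, h5, h6, h7, h8⟩
      · exact Or.inl h5
      · obtain ⟨h9, h10⟩ := D.mem_times.1 h5
        simp only [Window.left] at h9 h10
        exact Or.inr ⟨θ, D.mem_times.2 ⟨h9, by omega⟩, by rwa [hQ₁ θ h10], h7, by omega⟩
    · have h11 := hr j h4
      rcases h₂.ready j h4 i hi with h5 | ⟨θ, h5, h6, h7, h8⟩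
      · simp only [Window.right] at h5
        rcases hmid i with h5 | ⟨θ, h5, h6, h7, h8⟩
        · exact Or.inl (by omega)
        · exact Or.inr ⟨θ, h5, h8, by omega, by omega⟩
      · obtain ⟨h9, h10⟩ := D.mem_times.1 h5
        simp only [Window.right] at h9 h10
        exact Or.inr ⟨θ, D.mem_times.2 ⟨by omega, h10⟩, by rwa [hQ₂ θ (by omega)], h7, by omega⟩
  · intro i
    rcases h₂.final i with h | ⟨θ, h4, h5, h6⟩
    · simp only [Window.right] at h
      rcases hmid i with h5 | ⟨θ, h5, h6, h7, h8⟩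
      · exact Or.inl (by omega)
      · exact Or.inr ⟨θ, h5, by omega, h8⟩
    · obtain ⟨h9, h10⟩ := D.mem_times.1 h4
      simp only [Window.right] at h9 h10
      exact Or.inr ⟨θ, D.mem_times.2 ⟨by omega, h10⟩, h5, by rwa [hQ₂ θ (by omega)]⟩
  · unfold windowCost
    rw [sum_jobs_split (t := t) hk hux hxv, sum_times_split (x := x) hat htb h3, hst]
    have e₁ : ∑ j ∈ D.jobs k (S.left t x), D.w j * (st j + 1) =
        ∑ j ∈ D.jobs k (S.left t x), D.w j * (st₁ j + 1) :=
      Finset.sum_congr rfl fun j hj => by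
        obtain ⟨h4, -, h5⟩ := D.mem_jobs.1 hj
        rw [hst₁ j h4 h5]
    have e₂ : ∑ j ∈ D.jobs k (S.right t x), D.w j * (st j + 1) =
        ∑ j ∈ D.jobs k (S.right t x), D.w j * (st₂ j + 1) :=
      Finset.sum_congr rfl fun j hj => by
        obtain ⟨h4, h5, -⟩ := D.mem_jobs.1 hj
        rw [hst₂ j h4 h5]
    have e₃ : ∑ θ ∈ D.times (S.left t x), D.orderCost (Q θ) =
        ∑ θ ∈ D.times (S.left t x), D.orderCost (Q₁ θ) :=
      Finset.sum_congr rfl fun θ hθ => by rw [hQ₁ θ (D.mem_times.1 hθ).2]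
    have e₄ : ∑ θ ∈ D.times (S.right t x), D.orderCost (Q θ) =
        ∑ θ ∈ D.times (S.right t x), D.orderCost (Q₂ θ) :=
      Finset.sum_congr rfl fun θ hθ => by
        rw [hQ₂ θ]
        have := (D.mem_times.1 hθ).1
        simp only [Window.right] at this
        omega
    rw [e₁, e₂, e₃, e₄]
    ring

/-- The value is attained: at each split the solutions of the two parts are glued, and the costs add
up. -/
theorem fits_start_repl (k : ℕ) (S : Window) (hv : D.value k S ≠ 0)
    (hab : D.time S.a ≤ D.time S.b) (hu : ∀ i, D.last S.u i ≤ D.time S.a) :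
    D.Fits k S (D.start k S) (D.repl k S) ∧
      D.windowCost k S (D.start k S) (D.repl k S) + 1 = D.value k S := by
  induction k generalizing S with
  | zero =>
    have hj : D.jobs 0 S = ∅ := by simp [jobs]
    rw [value_zero, base] at hv ⊢
    split_ifs at hv ⊢ with h
    · refine ⟨⟨hab, hu, by simp [hj], by simp [hj], by simp [hj], fun i => ?_⟩, ?_⟩
      · rcases h i with h | ⟨h1, h2⟩
        · exact Or.inl h
        · refine Or.inr ⟨D.last S.v i - 1, D.mem_times.2 ⟨by omega, by omega⟩, by omega, ?_⟩
          simp only [repl, finalRepl, Finset.mem_filter, Finset.mem_univ, true_and]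
          omega
      · simp [windowCost, hj, repl]
    · exact (hv rfl).elim
  | succ k ih =>
    by_cases hk : D.Stays k S
    · rw [D.value_succ_of_stays hk] at hv ⊢
      obtain ⟨h, h'⟩ := ih S hv hab hu
      have e₁ : D.start (k + 1) S = D.start k S := by funext j; simp [start, hk]
      have e₂ : D.repl (k + 1) S = D.repl k S := by funext j; simp [repl, hk]
      rw [e₁, e₂, ← h']
      have e₃ := D.jobs_succ_of_stays hk
      refine ⟨⟨h.le, h.old, by rw [e₃]; exact h.range, by rw [e₃]; exact h.inj,
        by rw [e₃]; exact h.ready, h.final⟩, by simp only [windowCost, e₃]⟩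
    · obtain ⟨-, -, ⟨h1, h2, h3, h4, h5, h6⟩, h7⟩ := D.splits_of_value_ne_zero hk hv
      obtain ⟨f₁, c₁⟩ := ih _ h5 h1 hu
      -- Replenishments recorded in `x` happen at time `t` or earlier, hence before the right part
      -- starts.
      obtain ⟨f₂, c₂⟩ := ih _ h6 (by simp only [Window.right]; omega) (fun i => by
        have h8 := hu i
        simp only [Window.right]
        rcases f₁.final i with h | ⟨θ, h9, h10, -⟩
        · simp only [Window.left] at h; omega
        · have := (D.mem_times.1 h9).2
          simp only [Window.left] at this h10
          omega)
      obtain ⟨f, c⟩ := f₁.glue (st := D.start (k + 1) S) (Q := D.repl (k + 1) S) f₂ hk h3 h4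
        (by simp [start, hk]) (fun j hj hr => by simp [start, hk, hj.ne, hr])
        (fun j hj hr => by simp [start, hk, hj.ne, hr]) (fun θ hθ => by simp [repl, hk, hθ])
        (fun θ hθ => by simp [repl, hk, hθ.not_ge])
      refine ⟨f, ?_⟩
      rw [c, h7, ← c₁, ← c₂]
      omega

end Data
end JRP

/-! ### Optimality: the exchange argument -/

namespace JRP
namespace Data

variable {s : ℕ} {D : Data s}

theorem orderCost_mono {A B : Finset (Fin s)} (h : A ⊆ B) : D.orderCost A ≤ D.orderCost B := by
  unfold orderCost
  split_ifs with hA hB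
  · exact le_rfl
  · exact Nat.zero_le _
  · subst_vars; exact (hA (Finset.subset_empty.1 h)).elim
  · exact Nat.add_le_add_left (Finset.sum_le_sum_of_subset h) _

/-- A vector of indices at most `n` is read as a number with `s` digits in base `n + 1`. -/
theorem exists_code (D : Data s) (f : Fin s → ℕ) (hf : ∀ i, f i ≤ D.n) :
    ∃ x < D.U, ∀ i : Fin s, x / (D.n + 1) ^ (i : ℕ) % (D.n + 1) = f i := by
  let g : Fin s → Fin (D.n + 1) := fun i => ⟨f i, Nat.lt_succ_of_le (hf i)⟩
  refine ⟨finFunctionFinEquiv g, (finFunctionFinEquiv g).2, fun i => ?_⟩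
  have h := finFunctionFinEquiv.symm_apply_apply g
  simpa [finFunctionFinEquiv, g] using congrArg Fin.val (congrFun h i)

/-- Feasible solutions of a window with starting times and replenishments at the times that the
recursion considers. -/
structure Normal (D : Data s) (k : ℕ) (S : Window) (st : ℕ → ℕ) (Q : ℕ → Finset (Fin s)) : Prop
    extends D.Fits k S st Q where
  code : ∀ j ∈ D.jobs k S, ∃ c < D.M, D.time c = st j ∧ D.time (c + 1) = st j + 1
  lt_last : ∀ θ ∈ D.times S, ∀ i ∈ Q θ, θ < D.last S.v i
  release : ∀ θ ∈ D.times S, ∀ i ∈ Q θ, ∃ c < D.n, D.r c = θ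

/-- Supplies the vector `x` of last replenishments up to time `t`; it has a code because all
replenishments are at release dates. -/
theorem exists_mid {S : Window} {Q : ℕ → Finset (Fin s)}
    (h : ∀ θ ∈ D.times S, ∀ i ∈ Q θ, ∃ c < D.n, D.r c = θ) (t : ℕ) :
    ∃ x < D.U, ∀ i, (D.last x i = D.last S.u i ∨
      ∃ θ ∈ D.times S, θ ≤ t ∧ D.last x i = θ + 1 ∧ i ∈ Q θ) ∧
      ∀ θ ∈ D.times S, θ ≤ t → i ∈ Q θ → θ < D.last x i := by
  have key : ∀ i, ∃ c ≤ D.n, (D.rel c = D.last S.u i ∨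
      ∃ θ ∈ D.times S, θ ≤ t ∧ D.rel c = θ + 1 ∧ i ∈ Q θ) ∧
      ∀ θ ∈ D.times S, θ ≤ t → i ∈ Q θ → θ < D.rel c := by
    intro i
    -- The digit of resource `i` is the index of its latest replenishment in `A`, or the digit of
    -- `u` if there is none.
    set A := (D.times S).filter fun θ => θ ≤ t ∧ i ∈ Q θ with hA
    rcases A.eq_empty_or_nonempty with he | hne
    · refine ⟨S.u / (D.n + 1) ^ (i : ℕ) % (D.n + 1),
        Nat.lt_succ_iff.1 (Nat.mod_lt _ (Nat.succ_pos _)), Or.inl rfl, fun θ h1 h2 h3 => ?_⟩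
      have : θ ∈ A := Finset.mem_filter.2 ⟨h1, h2, h3⟩
      rw [he] at this
      exact absurd this (Finset.notMem_empty θ)
    · obtain ⟨h1, h2, h3⟩ := Finset.mem_filter.1 (A.max'_mem hne)
      obtain ⟨c, hc, hr⟩ := h _ h1 i h3
      have hrel : D.rel c = A.max' hne + 1 := by rw [rel, if_pos hc, hr]
      refine ⟨c, hc.le, Or.inr ⟨_, h1, h2, hrel, h3⟩, fun θ h4 h5 h6 => ?_⟩
      have := A.le_max' θ (Finset.mem_filter.2 ⟨h4, h5, h6⟩)
      omega
  choose c hc h1 using key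
  obtain ⟨x, hx, hd⟩ := D.exists_code c hc
  refine ⟨x, hx, fun i => ?_⟩
  have : D.last x i = D.rel (c i) := by rw [last, hd]
  rw [this]
  exact h1 i

/-- Job `k` stays ready when it is moved to a later time, and `hready` allows job `j` to take its
place. The replenishments do not change. -/
theorem Normal.swap {k j : ℕ} {S : Window} {st Q} (h : D.Normal (k + 1) S st Q)
    (hk : k ∈ D.jobs (k + 1) S) (hj : j ∈ D.jobs (k + 1) S) (hlt : st k < st j)
    (hw : D.w k ≤ D.w j)
    (hready : ∀ i ∈ D.q j, D.r j < D.last S.u i ∨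
      ∃ θ ∈ D.times S, i ∈ Q θ ∧ D.r j ≤ θ ∧ θ ≤ st k) :
    D.Normal (k + 1) S (fun i => st (Equiv.swap k j i)) Q ∧
      D.windowCost (k + 1) S (fun i => st (Equiv.swap k j i)) Q ≤ D.windowCost (k + 1) S st Q := by
  have hmem : ∀ i ∈ D.jobs (k + 1) S, Equiv.swap k j i ∈ D.jobs (k + 1) S := fun i hi => by
    rcases eq_or_ne i k with rfl | h1
    · rwa [Equiv.swap_apply_left]
    rcases eq_or_ne i j with rfl | h2
    · rwa [Equiv.swap_apply_right]
    rwa [Equiv.swap_apply_of_ne_of_ne h1 h2]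
  refine ⟨⟨⟨h.le, h.old, fun i hi => h.range _ (hmem i hi), fun i hi i' hi' he => ?_,
    fun i hi l hl => ?_, h.final⟩, fun i hi => h.code _ (hmem i hi), h.lt_last, h.release⟩, ?_⟩
  · exact (Equiv.swap k j).injective (h.inj (hmem i hi) (hmem i' hi') he)
  · rcases eq_or_ne i k with rfl | h1
    · simp only [Equiv.swap_apply_left]
      rcases h.ready i hi l hl with h2 | ⟨θ, h2, h3, h4, h5⟩
      · exact Or.inl h2
      · exact Or.inr ⟨θ, h2, h3, h4, by omega⟩
    rcases eq_or_ne i j with rfl | h2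
    · simp only [Equiv.swap_apply_right]
      exact hready l hl
    rw [Equiv.swap_apply_of_ne_of_ne h1 h2]
    exact h.ready i hi l hl
  · unfold windowCost
    refine Nat.add_le_add_right ?_ _
    have hjk : j ≠ k := by rintro rfl; exact lt_irrefl _ hlt
    have hj' : j ∈ (D.jobs (k + 1) S).erase k := Finset.mem_erase.2 ⟨hjk, hj⟩
    rw [← Finset.add_sum_erase _ _ hk, ← Finset.add_sum_erase _ _ hk,
      ← Finset.add_sum_erase _ _ hj', ← Finset.add_sum_erase _ _ hj']
    beta_reduce
    rw [Equiv.swap_apply_left, Equiv.swap_apply_right, ← add_assoc, ← add_assoc]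
    refine add_le_add ?_ (Finset.sum_le_sum fun i hi => ?_)
    -- Rearrangement: the heavier job now has the earlier start.
    · nlinarith
    · simp only [Finset.mem_erase] at hi
      rw [Equiv.swap_apply_of_ne_of_ne hi.2.1 hi.1]

/-- The recursion bounds every normal solution from below. With nonincreasing weights, `k` is a
lightest job of the window; after exchanges that postpone it, the solution decomposes at its start
into normal solutions of two windows of level `k`. -/
theorem value_le (hw : ∀ i j, i ≤ j → j < D.n → D.w j ≤ D.w i) (k : ℕ) (hkn : k ≤ D.n)
    (S : Window) (st : ℕ → ℕ) (Q : ℕ → Finset (Fin s)) (h : D.Normal k S st Q) :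
    D.value k S ≠ 0 ∧ D.value k S ≤ D.windowCost k S st Q + 1 := by
  induction k generalizing S st with
  | zero =>
    have hc : ∀ i : Fin s, D.last S.v i = D.last S.u i ∨
        D.time S.a < D.last S.v i ∧ D.last S.v i ≤ D.time S.b + 1 := fun i => by
      rcases h.final i with h1 | ⟨θ, h1, h2, -⟩
      · exact Or.inl h1
      · have := D.mem_times.1 h1
        exact Or.inr ⟨by omega, by omega⟩
    rw [value_zero, base, if_pos hc]
    refine ⟨by omega, Nat.add_le_add_right ((Finset.sum_le_sum fun θ hθ => ?_).trans
      (Nat.le_add_left _ _)) 1⟩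
    -- A resource whose entry of `v` lies at `θ` is indeed replenished by `Q` at `θ`: the entry
    -- cannot come from `u`, which by `old` lies before the window.
    refine orderCost_mono fun i hi => ?_
    have hi' : D.last S.v i = θ + 1 := by simpa [finalRepl] using hi
    rcases h.final i with h1 | ⟨θ', -, h2, h3⟩
    · have h2 := h.old i
      have h3 := (D.mem_times.1 hθ).1
      omega
    · obtain rfl : θ = θ' := by omega
      exact h3
  | succ k ih =>
    by_cases hk : D.Stays k S
    · have e := D.jobs_succ_of_stays hk
      rw [D.value_succ_of_stays hk]
      have := ih (by omega) S st ⟨⟨h.le, h.old, e ▸ h.range, e ▸ h.inj, e ▸ h.ready, h.final⟩,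
        e ▸ h.code, h.lt_last, h.release⟩
      simpa only [windowCost, e] using this
    · have hs : ¬ D.Ready S.u k ∧ D.Ready S.v k := by simpa [Stays] using hk
      have hkj : k ∈ D.jobs (k + 1) S := D.mem_jobs.2 ⟨Nat.lt_succ_self k, hs⟩
      -- Each exchange moves `k` closer to the end of the window, so the process stops.
      obtain ⟨d, hd⟩ : ∃ d, D.time S.b - st k = d := ⟨_, rfl⟩
      induction d using Nat.strong_induction_on generalizing st with
      | _ d ihd =>
      obtain ⟨x, hxU, hx⟩ := exists_mid h.release (st k)
      by_cases hsw : ∃ j ∈ D.jobs (k + 1) S, st k < st j ∧ D.Ready x j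
      · obtain ⟨j, hj, hlt, hr⟩ := hsw
        have h1 := D.mem_jobs.1 hj
        obtain ⟨h2, h3⟩ := h.swap hkj hj hlt (hw j k (by omega) (by omega)) fun i hi => by
          have h4 := hr i hi
          rcases (hx i).1 with h5 | ⟨θ, h5, h6, h7, h8⟩
          · exact Or.inl (by omega)
          · exact Or.inr ⟨θ, h5, h8, by omega, h6⟩
        have h4 := (h.range k hkj).2
        obtain ⟨h5, h6⟩ := ihd (D.time S.b - st j) (by omega) _ h2
          (by simp only [Equiv.swap_apply_left])
        exact ⟨h5, h6.trans (by omega)⟩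
      · push Not at hsw
        obtain ⟨t, htM, ht, ht1⟩ := h.code k hkj
        obtain ⟨hat, htb⟩ := h.range k hkj
        have hux : ∀ i, D.last S.u i ≤ D.last x i := fun i => by
          rcases (hx i).1 with h5 | ⟨θ, h5, h6, h7, h8⟩
          · exact h5.ge
          · have := h.old i
            have := (D.mem_times.1 h5).1
            omega
        have hxv : ∀ i, D.last x i ≤ D.last S.v i := fun i => by
          rcases (hx i).1 with h5 | ⟨θ, h5, h6, h7, h8⟩
          · exact h5 ▸ h.toFits.last_le i
          · have := h.lt_last θ h5 i h8
            omega
        have hready : ∀ j ∈ D.jobs (k + 1) S, st j ≤ st k → D.Ready x j := by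
          intro j hj hjk i hi
          rcases h.ready j hj i hi with h5 | ⟨θ, h5, h6, h7, h8⟩
          · have := hux i
            omega
          · have := (hx i).2 θ h5 (h8.trans hjk) h6
            omega
        -- No further exchange is possible: a job ready for `x` cannot start after `k`, and starts
        -- are distinct.
        have hl : ∀ j ∈ D.jobs k (S.left t x), j ∈ D.jobs (k + 1) S ∧ st j < st k := by
          intro j hj
          obtain ⟨h1, h2, h3⟩ := D.mem_jobs.1 hj
          have hj' : j ∈ D.jobs (k + 1) S := D.mem_jobs.2 ⟨by omega, h2, h3.mono hxv⟩
          refine ⟨hj', lt_of_le_of_ne (not_lt.1 fun h4 => hsw j hj' h4 h3) fun h4 => ?_⟩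
          exact h1.ne (h.inj hj' hkj h4)
        have hr : ∀ j ∈ D.jobs k (S.right t x), j ∈ D.jobs (k + 1) S ∧ st k < st j := by
          intro j hj
          obtain ⟨h1, h2, h3⟩ := D.mem_jobs.1 hj
          have hj' : j ∈ D.jobs (k + 1) S :=
            D.mem_jobs.2 ⟨by omega, fun h4 => h2 (h4.mono hux), h3⟩
          exact ⟨hj', not_le.1 fun h4 => h2 (hready j hj' h4)⟩
        have tl : ∀ θ, θ ∈ D.times (S.left t x) ↔ θ ∈ D.times S ∧ θ ≤ st k := fun θ => by
          simp only [mem_times, Window.left]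
          omega
        have tr : ∀ θ, θ ∈ D.times (S.right t x) ↔ θ ∈ D.times S ∧ st k < θ := fun θ => by
          simp only [mem_times, Window.right]
          omega
        have nl : D.Normal k (S.left t x) st Q := by
          refine ⟨⟨by simp only [Window.left]; omega, h.old, fun j hj => ?_, fun j hj j' hj' he => ?_,
            fun j hj i hi => ?_, fun i => ?_⟩, fun j hj => h.code j (hl j hj).1,
            fun θ hθ i hi => ?_, fun θ hθ => h.release θ ((tl θ).1 hθ).1⟩
          · have h1 := h.range j (hl j hj).1
            have h2 := (hl j hj).2
            simp only [Window.left]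
            omega
          · exact h.inj (hl j hj).1 (hl j' hj').1 he
          · have h2 := (hl j hj).2
            rcases h.ready j (hl j hj).1 i hi with h5 | ⟨θ, h5, h6, h7, h8⟩
            · exact Or.inl h5
            · exact Or.inr ⟨θ, (tl θ).2 ⟨h5, by omega⟩, h6, h7, h8⟩
          · rcases (hx i).1 with h5 | ⟨θ, h5, h6, h7, h8⟩
            · exact Or.inl h5
            · exact Or.inr ⟨θ, (tl θ).2 ⟨h5, h6⟩, h7, h8⟩
          · exact (hx i).2 θ ((tl θ).1 hθ).1 ((tl θ).1 hθ).2 hi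
        have nr : D.Normal k (S.right t x) st Q := by
          refine ⟨⟨by simp only [Window.right]; omega, fun i => ?_, fun j hj => ?_,
            fun j hj j' hj' he => ?_,
            fun j hj i hi => ?_, fun i => ?_⟩, fun j hj => h.code j (hr j hj).1,
            fun θ hθ => h.lt_last θ ((tr θ).1 hθ).1, fun θ hθ => h.release θ ((tr θ).1 hθ).1⟩
          · simp only [Window.right]
            have := h.old i
            rcases (hx i).1 with h5 | ⟨θ, h5, h6, h7, h8⟩ <;> omega
          · have h1 := h.range j (hr j hj).1
            have h2 := (hr j hj).2
            simp only [Window.right]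
            omega
          · exact h.inj (hr j hj).1 (hr j' hj').1 he
          · have h2 := (hr j hj).2
            simp only [Window.right]
            rcases h.ready j (hr j hj).1 i hi with h5 | ⟨θ, h5, h6, h7, h8⟩
            · exact Or.inl (h5.trans_le (hux i))
            · rcases le_or_gt θ (st k) with h9 | h9
              · have := (hx i).2 θ h5 h9 h6
                exact Or.inl (by omega)
              · exact Or.inr ⟨θ, (tr θ).2 ⟨h5, h9⟩, h6, h7, h8⟩
          · simp only [Window.right]
            rcases h.final i with h5 | ⟨θ, h5, h6, h7⟩
            · exact Or.inl (le_antisymm (h5 ▸ hux i) (hxv i))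
            -- If the replenishment recorded in `v` took place by the start of `k`, then `x` already
            -- records it and the entries of `x` and `v` agree.
            · rcases le_or_gt θ (st k) with h9 | h9
              · have h10 := (hx i).2 θ h5 h9 h7
                have h11 := hxv i
                exact Or.inl (by omega)
              · exact Or.inr ⟨θ, (tr θ).2 ⟨h5, h9⟩, h6, h7⟩
        obtain ⟨vl, cl⟩ := ih (by omega) _ st nl
        obtain ⟨vr, cr⟩ := ih (by omega) _ st nr
        have hxk : D.Ready x k := hready k hkj le_rfl
        obtain ⟨v, c⟩ := D.value_le_of_splits hk htM hxU
          ⟨by omega, by omega, by omega, hxk, vl, vr⟩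
        refine ⟨v, c.trans ?_⟩
        obtain ⟨-, hc⟩ := nl.toFits.glue nr.toFits hk (by omega) hxk ht.symm
          (fun _ _ _ => rfl) (fun _ _ _ => rfl) (fun _ _ => rfl) (fun _ _ => rfl)
        rw [hc]
        omega

end Data
end JRP

/-! ### The root window and global optimality -/

namespace JRP
namespace Data

variable {s : ℕ} (D : Data s)

/-- The number of windows. -/
def Z : ℕ := D.M * D.M * D.U * D.U

def window (z : ℕ) : Window := ⟨z / D.U / D.U / D.M, z / D.U / D.U % D.M, z / D.U % D.U, z % D.U⟩

def index (S : Window) : ℕ := ((S.a * D.M + S.b) * D.U + S.u) * D.U + S.v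

structure InRange (S : Window) : Prop where
  a : S.a < D.M
  b : S.b < D.M
  u : S.u < D.U
  v : S.v < D.U

theorem M_pos : 0 < D.M := by unfold M; positivity

theorem mul_add_lt {a b m k : ℕ} (ha : a < k) (hb : b < m) : a * m + b < k * m := by
  have := Nat.mul_le_mul_right m (show a + 1 ≤ k from ha)
  rw [Nat.add_mul, one_mul] at this
  omega

theorem mul_add_div' (a : ℕ) {b m : ℕ} (hb : b < m) : (a * m + b) / m = a := by
  rw [mul_comm, Nat.mul_add_div (by omega), Nat.div_eq_of_lt hb, add_zero]

theorem mul_add_mod' (a : ℕ) {b m : ℕ} (hb : b < m) : (a * m + b) % m = b := by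
  rw [mul_comm, Nat.mul_add_mod, Nat.mod_eq_of_lt hb]

variable {D}

theorem InRange.index_lt {S : Window} (h : D.InRange S) : D.index S < D.Z :=
  mul_add_lt (mul_add_lt (mul_add_lt h.a h.b) h.u) h.v

theorem InRange.window_index {S : Window} (h : D.InRange S) : D.window (D.index S) = S := by
  simp only [window, index, mul_add_div' _ h.v, mul_add_div' _ h.u, mul_add_div' _ h.b,
    mul_add_mod' _ h.v, mul_add_mod' _ h.u, mul_add_mod' _ h.b]

theorem index_window (z : ℕ) : D.index (D.window z) = z := by
  simp only [window, index, Nat.div_add_mod']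

theorem window_inRange {z : ℕ} (hz : z < D.Z) : D.InRange (D.window z) := by
  have hM := D.M_pos
  have hU := D.U_pos
  refine ⟨?_, Nat.mod_lt _ hM, Nat.mod_lt _ hU, Nat.mod_lt _ hU⟩
  simp only [window]
  rw [Nat.div_lt_iff_lt_mul hM, Nat.div_lt_iff_lt_mul hU, Nat.div_lt_iff_lt_mul hU]
  exact hz

/-- The window can contain a solution for all jobs. -/
def IsRoot (D : Data s) (S : Window) : Prop :=
  (∀ i, D.last S.u i = 0) ∧ D.time S.a ≤ D.time S.b ∧ ∀ j < D.n, D.Ready S.v j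

open Classical in
noncomputable def rootValue (D : Data s) (z : ℕ) : ℕ :=
  if D.IsRoot (D.window z) then D.value D.n (D.window z) else 0

noncomputable def root (D : Data s) : ℕ := lastChange (scan D.rootValue) D.Z

/-- Feasible solutions for all jobs, with replenishments at release dates. -/
structure Schedules (D : Data s) (st : ℕ → ℕ) (Q : ℕ → Finset (Fin s)) : Prop where
  inj : Set.InjOn st (Finset.range D.n : Set ℕ)
  ready : ∀ j < D.n, ∀ i ∈ D.q j, ∃ θ, i ∈ Q θ ∧ D.r j ≤ θ ∧ θ ≤ st j
  release : ∀ θ, ∀ i ∈ Q θ, ∃ c < D.n, D.r c = θ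

noncomputable def totalCost (D : Data s) (st : ℕ → ℕ) (Q : ℕ → Finset (Fin s)) : ℕ :=
  ∑ j ∈ Finset.range D.n, D.w j * (st j + 1) +
    ∑ θ ∈ (Finset.range D.n).image D.r, D.orderCost (Q θ)

theorem time_code {c m : ℕ} (hc : c < D.n) (hm : m ≤ D.n + 1) :
    c * (D.n + 2) + m < D.M ∧ D.time (c * (D.n + 2) + m) = D.r c + m := by
  have h : c * (D.n + 2) + m < D.M := mul_add_lt (by omega) (by omega)
  refine ⟨h, ?_⟩
  rw [time, if_pos h, mul_add_div' _ (by omega), mul_add_mod' _ (by omega)]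

/-- Off the release dates nothing is ordered, so no set of moments costs more than the release
dates. -/
theorem sum_orderCost_le {Q : ℕ → Finset (Fin s)} (h : ∀ θ, ∀ i ∈ Q θ, ∃ c < D.n, D.r c = θ)
    (A : Finset ℕ) :
    ∑ θ ∈ A, D.orderCost (Q θ) ≤ ∑ θ ∈ (Finset.range D.n).image D.r, D.orderCost (Q θ) := by
  rw [← Finset.sum_filter_add_sum_filter_not A (fun θ => Q θ = ∅)]
  have h1 : ∑ θ ∈ A with Q θ = ∅, D.orderCost (Q θ) = 0 :=
    Finset.sum_eq_zero fun θ hθ => by simp [orderCost, (Finset.mem_filter.1 hθ).2]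
  rw [h1, zero_add]
  refine Finset.sum_le_sum_of_subset fun θ hθ => ?_
  obtain ⟨i, hi⟩ := Finset.nonempty_iff_ne_empty.2 (Finset.mem_filter.1 hθ).2
  obtain ⟨c, hc, hr⟩ := h θ i hi
  exact Finset.mem_image.2 ⟨c, Finset.mem_range.2 hc, hr⟩

/-- The window between the earliest and the latest coded moment, with empty history, contains every
discretized schedule; `value_le` applies to it. -/
theorem rootValue_le (hw : ∀ i j, i ≤ j → j < D.n → D.w j ≤ D.w i) {st Q}
    (h : D.Schedules st Q) (hc : ∀ j < D.n, ∃ c < D.n, ∃ m ≤ D.n, st j = D.r c + m) :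
    ∃ z < D.Z, D.rootValue z ≠ 0 ∧ D.rootValue z ≤ D.totalCost st Q + 1 := by
  have hne : (Finset.range D.M).Nonempty := ⟨0, Finset.mem_range.2 D.M_pos⟩
  obtain ⟨a, ha, hamin⟩ := Finset.exists_min_image _ D.time hne
  obtain ⟨b, hb, hbmax⟩ := Finset.exists_max_image _ D.time hne
  simp only [Finset.mem_range] at ha hb hamin hbmax
  -- The digit `n` is no release date and means "never replenished".
  obtain ⟨u, hu, hud⟩ := D.exists_code (fun _ => D.n) (fun _ => le_rfl)
  have hu0 : ∀ i, D.last u i = 0 := fun i => by simp [last, hud, rel]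
  have hcode : ∀ j < D.n, ∃ c < D.M, D.time c = st j ∧ D.time (c + 1) = st j + 1 ∧ c + 1 < D.M := by
    intro j hj
    obtain ⟨c, hc, m, hm, he⟩ := hc j hj
    have h1 := D.time_code hc (m := m) (by omega)
    have h2 := D.time_code hc (m := m + 1) (by omega)
    rw [← add_assoc] at h2
    exact ⟨_, h1.1, by omega, by omega, h2.1⟩
  have hrange : ∀ j < D.n, D.time a ≤ st j ∧ st j < D.time b := fun j hj => by
    obtain ⟨c, hc, h1, h2, h3⟩ := hcode j hj
    have := hamin c hc
    have := hbmax _ h3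
    omega
  obtain ⟨x, hx, hmid⟩ := exists_mid (S := ⟨a, b, u, 0⟩) (Q := Q) (fun θ _ => h.release θ)
    (D.time b)
  set S : Window := ⟨a, b, u, x⟩ with hS
  have htimes : D.times ⟨a, b, u, 0⟩ = D.times S := rfl
  rw [htimes] at hmid
  have hin : D.InRange S := ⟨ha, hb, hu, hx⟩
  have hmemt : ∀ j < D.n, ∀ i ∈ D.q j, ∃ θ ∈ D.times S, i ∈ Q θ ∧ D.r j ≤ θ ∧ θ ≤ st j := by
    intro j hj i hi
    obtain ⟨θ, h1, h2, h3⟩ := h.ready j hj i hi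
    refine ⟨θ, D.mem_times.2 ⟨?_, h3.trans (hrange j hj).2.le⟩, h1, h2, h3⟩
    obtain ⟨c, hc, rfl⟩ := h.release θ i h1
    have h4 := D.time_code hc (m := 0) (by omega)
    have := hamin _ h4.1
    simp only [hS]
    omega
  have hn : D.Normal D.n S st Q := by
    refine ⟨⟨hamin b hb, fun i => by simp [hS, hu0], fun j hj => hrange j (D.mem_jobs.1 hj).1,
      fun j hj j' hj' he => h.inj (by simpa using (D.mem_jobs.1 hj).1)
        (by simpa using (D.mem_jobs.1 hj').1) he, fun j hj i hi => ?_, fun i => ?_⟩,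
      fun j hj => ?_, fun θ hθ i hi => ?_, fun θ _ => h.release θ⟩
    · exact Or.inr (hmemt j (D.mem_jobs.1 hj).1 i hi)
    · rcases (hmid i).1 with h1 | ⟨θ, h1, -, h2⟩
      · exact Or.inl h1
      · exact Or.inr ⟨θ, h1, h2⟩
    · obtain ⟨c, hc, h1, h2, -⟩ := hcode j (D.mem_jobs.1 hj).1
      exact ⟨c, hc, h1, h2⟩
    · exact (hmid i).2 θ hθ (D.mem_times.1 hθ).2 hi
  have hroot : D.IsRoot S := by
    refine ⟨hu0, hn.le, fun j hj i hi => ?_⟩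
    obtain ⟨θ, h1, h2, h3, -⟩ := hmemt j hj i hi
    exact h3.trans_lt ((hmid i).2 θ h1 (D.mem_times.1 h1).2 h2)
  refine ⟨D.index S, hin.index_lt, ?_⟩
  rw [rootValue, hin.window_index, if_pos hroot]
  obtain ⟨h1, h2⟩ := value_le hw D.n le_rfl S st Q hn
  refine ⟨h1, h2.trans (Nat.add_le_add_right (add_le_add (Finset.sum_le_sum_of_subset ?_) ?_) 1)⟩
  · exact fun j hj => Finset.mem_range.2 (D.mem_jobs.1 hj).1
  · exact sum_orderCost_le h.release _

theorem repl_release {k : ℕ} {S : Window} {θ : ℕ} {i : Fin s} (h : i ∈ D.repl k S θ) :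
    ∃ c < D.n, D.r c = θ := by
  induction k generalizing S with
  | zero =>
    have : D.last S.v i = θ + 1 := by simpa [repl, finalRepl] using h
    rw [last, rel] at this
    split_ifs at this with hc
    exact ⟨_, hc, by omega⟩
  | succ k ih =>
    rw [repl] at h
    split_ifs at h <;> exact ih h

/-- The function `repl` is not cut off at the ends of the window; outside it can only repeat entries
of `u`. At the root there are none, so no cost is missed. -/
theorem repl_mem_times (k : ℕ) (S : Window) (hv : D.value k S ≠ 0)
    (hab : D.time S.a ≤ D.time S.b) (hu : ∀ i, D.last S.u i ≤ D.time S.a) {θ : ℕ} {i : Fin s}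
    (h : i ∈ D.repl k S θ) : θ ∈ D.times S ∨ D.last S.u i = θ + 1 := by
  induction k generalizing S with
  | zero =>
    have h1 : D.last S.v i = θ + 1 := by simpa [repl, finalRepl] using h
    rw [value_zero, base] at hv
    split_ifs at hv with h2
    · rcases h2 i with h3 | h3
      · exact Or.inr (by omega)
      · exact Or.inl (D.mem_times.2 (by omega))
    · exact (hv rfl).elim
  | succ k ih =>
    by_cases hk : D.Stays k S
    · rw [D.value_succ_of_stays hk] at hv
      exact ih S hv hab hu (by simpa [repl, hk] using h)
    · obtain ⟨-, -, ⟨h1, h2, h3, h4, h5, h6⟩, h7⟩ := D.splits_of_value_ne_zero hk hv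
      have f₁ := (fits_start_repl k _ h5 h1 hu).1
      have hx : ∀ i, D.last (D.mid (k + 1) S) i ≤ D.time (D.cut (k + 1) S) + 1 := fun i => by
        have h8 := hu i
        rcases f₁.final i with h | ⟨θ, h9, h10, -⟩
        · simp only [Window.left] at h; omega
        · have := (D.mem_times.1 h9).2
          simp only [Window.left] at this h10
          omega
      simp only [repl, hk, if_false] at h
      split_ifs at h with hθ
      · rcases ih _ h5 h1 hu h with h8 | h8
        · have := D.mem_times.1 h8
          simp only [Window.left] at this
          exact Or.inl (D.mem_times.2 (by omega))
        · exact Or.inr h8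
      · rcases ih _ h6 (by simp only [Window.right]; omega)
          (fun i => by have := hx i; simp only [Window.right]; omega) h with h8 | h8
        · have := D.mem_times.1 h8
          simp only [Window.right] at this
          exact Or.inl (D.mem_times.2 (by omega))
        · have := hx i
          simp only [Window.right] at h8
          omega

/-- Some solution exists, so the minimum over all roots is finite: replenish everything at the
latest release date and then run the jobs one after another. -/
theorem exists_schedules (D : Data s) : ∃ st Q, D.Schedules st Q ∧
    ∀ j < D.n, ∃ c < D.n, ∃ m ≤ D.n, st j = D.r c + m := by
  rcases Nat.eq_zero_or_pos D.n with h0 | hpos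
  · exact ⟨fun _ => 0, fun _ => ∅, ⟨by simp [h0], by simp [h0], by simp⟩, by simp [h0]⟩
  · obtain ⟨c, hc, hmax⟩ := Finset.exists_max_image (Finset.range D.n) D.r
      ⟨0, Finset.mem_range.2 hpos⟩
    simp only [Finset.mem_range] at hc hmax
    refine ⟨fun j => D.r c + j, fun θ => if θ = D.r c then Finset.univ else ∅,
      ⟨fun i _ j _ h => by simpa using h, fun j hj i _ => ⟨D.r c, by simp, hmax j hj, by simp⟩,
        fun θ i hi => ⟨c, hc, ?_⟩⟩, fun j hj => ⟨c, hc, j, hj.le, rfl⟩⟩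
    by_contra hne
    simp [Ne.symm hne] at hi

theorem root_spec (hw : ∀ i j, i ≤ j → j < D.n → D.w j ≤ D.w i) :
    D.root < D.Z ∧ D.IsRoot (D.window D.root) ∧ D.value D.n (D.window D.root) ≠ 0 ∧
      ∀ st Q, D.Schedules st Q → (∀ j < D.n, ∃ c < D.n, ∃ m ≤ D.n, st j = D.r c + m) →
        D.value D.n (D.window D.root) ≤ D.totalCost st Q + 1 := by
  obtain ⟨st, Q, h, hc⟩ := D.exists_schedules
  obtain ⟨z, hz, h1, h2⟩ := rootValue_le hw h hc
  obtain ⟨h3, h4⟩ := scan_lastChange _ (scan_le _ hz h1).1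
  change D.root < D.Z at h3
  change D.rootValue D.root = _ at h4
  have h5 := (scan_le _ hz h1).1
  rw [← h4, rootValue] at h5
  have hR : D.IsRoot (D.window D.root) := by
    by_contra hR
    rw [if_neg hR] at h5
    exact h5 rfl
  rw [if_pos hR] at h5
  refine ⟨h3, hR, h5, fun st Q h hc => ?_⟩
  obtain ⟨z, hz, h1, h2⟩ := rootValue_le hw h hc
  have h6 := (scan_le _ hz h1).2
  rw [← h4] at h6
  nth_rewrite 1 [rootValue] at h6
  rw [if_pos hR] at h6
  exact h6.trans h2

theorem root_optimal (hw : ∀ i j, i ≤ j → j < D.n → D.w j ≤ D.w i)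
    (hq : ∀ j < D.n, (D.q j).Nonempty) :
    D.Schedules (D.start D.n (D.window D.root)) (D.repl D.n (D.window D.root)) ∧
      ∀ st Q, D.Schedules st Q → (∀ j < D.n, ∃ c < D.n, ∃ m ≤ D.n, st j = D.r c + m) →
        D.totalCost (D.start D.n (D.window D.root)) (D.repl D.n (D.window D.root)) ≤
          D.totalCost st Q := by
  obtain ⟨-, ⟨hu, hab, hv⟩, hval, hle⟩ := root_spec hw
  set S := D.window D.root
  have hu' : ∀ i, D.last S.u i ≤ D.time S.a := fun i => by rw [hu i]; exact Nat.zero_le _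
  obtain ⟨f, c⟩ := fits_start_repl D.n S hval hab hu'
  have hjobs : D.jobs D.n S = Finset.range D.n := by
    ext j
    rw [D.mem_jobs, Finset.mem_range]
    -- With empty history no job is ready, since it requires at least one resource.
    refine ⟨fun h => h.1, fun h => ⟨h, fun h' => ?_, hv j h⟩⟩
    obtain ⟨i, hi⟩ := hq j h
    have := h' i hi
    rw [hu i] at this
    omega
  have htot : D.totalCost (D.start D.n S) (D.repl D.n S) + 1 = D.value D.n S := by
    rw [← c, totalCost, windowCost, hjobs]
    congr 2
    refine (sum_orderCost_le (fun θ i => repl_release) _).antisymm' ?_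
    rw [← Finset.sum_filter_add_sum_filter_not (Finset.image D.r _) (fun θ => θ ∈ D.times S)]
    have h0 : ∑ θ ∈ (Finset.range D.n).image D.r with θ ∉ D.times S,
        D.orderCost (D.repl D.n S θ) = 0 := by
      refine Finset.sum_eq_zero fun θ hθ => ?_
      rw [orderCost, if_pos]
      rw [Finset.eq_empty_iff_forall_notMem]
      intro i hi
      rcases repl_mem_times D.n S hval hab hu' hi with h1 | h1
      · exact (Finset.mem_filter.1 hθ).2 h1
      · rw [hu i] at h1; omega
    rw [h0, add_zero]
    exact Finset.sum_le_sum_of_subset fun θ hθ => (Finset.mem_filter.1 hθ).2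
  refine ⟨⟨?_, fun j hj i hi => ?_, fun θ i => repl_release⟩, fun st Q h hc => ?_⟩
  · rw [← hjobs]; exact f.inj
  · rcases f.ready j (by rw [hjobs]; exact Finset.mem_range.2 hj) i hi with h1 | ⟨θ, -, h1⟩
    · rw [hu i] at h1; omega
    · exact ⟨θ, h1⟩
  · have := hle st Q h hc
    omega

end Data
end JRP

/-! ### Discretization of real solutions -/

namespace JRP
namespace Data

variable {s : ℕ} {D : Data s}

/-- A schedule of unit jobs can be shifted to the left so that each job starts at most `n` time
units after the ready time of some job. -/
theorem exists_left_shifted (n : ℕ) (N ρ : ℕ → ℕ) (hN : Set.InjOn N (Finset.range n : Set ℕ))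
    (hρ : ∀ k < n, ρ k ≤ N k) :
    ∃ st : ℕ → ℕ, Set.InjOn st (Finset.range n : Set ℕ) ∧ ∀ k < n, ρ k ≤ st k ∧ st k ≤ N k ∧
      ∃ l < n, ∃ m ≤ n, st k = ρ l + m := by
  let A : ℕ → Finset ℕ := fun k => (Finset.range n).filter fun l => N l ≤ N k
  let B : ℕ → ℕ → Finset ℕ := fun k l => (Finset.range n).filter fun i => N l ≤ N i ∧ N i < N k
  -- Closed form of list scheduling in the order of `N`: for some earlier or equal `l`, the machine
  -- works without idle time from `ρ l` until `k` starts.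
  let st : ℕ → ℕ := fun k => (A k).sup fun l => ρ l + (B k l).card
  have hmem : ∀ k < n, k ∈ A k := fun k hk => by simp [A, hk]
  have hatt : ∀ k < n, ∃ l ∈ A k, st k = ρ l + (B k l).card := fun k hk =>
    Finset.exists_mem_eq_sup _ ⟨k, hmem k hk⟩ _
  have hle : ∀ k, ∀ l ∈ A k, ρ l + (B k l).card ≤ st k := fun k l hl =>
    Finset.le_sup (f := fun l => ρ l + (B k l).card) hl
  have hmono : ∀ k < n, ∀ l < n, N k < N l → st k < st l := by
    intro k hk l hl hkl
    obtain ⟨m, hm, he⟩ := hatt k hk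
    simp only [A, Finset.mem_filter, Finset.mem_range] at hm
    have h1 := hle l m (by simp only [A, Finset.mem_filter, Finset.mem_range]; omega)
    have h2 : (B k m).card < (B l m).card := by
      refine Finset.card_lt_card ⟨fun i hi => ?_, fun h => ?_⟩
      · simp only [B, Finset.mem_filter, Finset.mem_range] at hi ⊢
        omega
      · have := h (show k ∈ B l m by simp [B, hk, hm.2, hkl])
        simp [B] at this
    omega
  refine ⟨st, fun k hk l hl he => ?_, fun k hk => ⟨?_, ?_, ?_⟩⟩
  · simp only [Finset.coe_range, Set.mem_Iio] at hk hl
    rcases lt_trichotomy (N k) (N l) with h | h | h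
    · have := hmono k hk l hl h; omega
    · exact hN (by simpa using hk) (by simpa using hl) h
    · have := hmono l hl k hk h; omega
  · exact (Nat.le_add_right _ _).trans (hle k k (hmem k hk))
  · obtain ⟨l, hl, he⟩ := hatt k hk
    simp only [A, Finset.mem_filter, Finset.mem_range] at hl
    -- `N` maps these jobs injectively into the interval from `N l` to `N k`.
    have h1 : (B k l).card ≤ N k - N l := by
      rw [← Nat.card_Ico]
      refine Finset.card_le_card_of_injOn N (fun i hi => ?_) (fun i hi j hj h => hN ?_ ?_ h)
      · simpa [B] using (Finset.mem_filter.1 hi).2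
      · exact (Finset.mem_filter.1 hi).1
      · exact (Finset.mem_filter.1 hj).1
    have := hρ l hl.1
    omega
  · obtain ⟨l, hl, he⟩ := hatt k hk
    refine ⟨l, by simpa using (Finset.mem_filter.1 hl).1, _, ?_, he⟩
    exact (Finset.card_le_card (Finset.filter_subset _ _)).trans (by simp)

theorem orderCost_union_le (A B : Finset (Fin s)) :
    D.orderCost (A ∪ B) ≤ D.orderCost A + D.orderCost B := by
  rcases A.eq_empty_or_nonempty with rfl | hA
  · simp
  rcases B.eq_empty_or_nonempty with rfl | hB
  · simp
  have h := Finset.sum_union_inter (s₁ := A) (s₂ := B) (f := D.K)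
  simp only [orderCost, hA.ne_empty, hB.ne_empty, (hA.mono Finset.subset_union_left).ne_empty,
    if_false]
  omega

theorem orderCost_le (A : Finset (Fin s)) : D.orderCost A ≤ D.K₀ + ∑ i ∈ A, D.K i := by
  unfold orderCost
  split_ifs <;> omega

open Classical in
/-- The replenishments of the list, moved to the preceding release date. -/
noncomputable def rounded (D : Data s) (fl : ℝ → ℕ) (L : List (ℝ × Finset (Fin s))) (θ : ℕ) :
    Finset (Fin s) :=
  Finset.univ.filter fun i => ∃ e ∈ L, i ∈ e.2 ∧ (∃ c < D.n, (D.r c : ℝ) ≤ e.1) ∧ fl e.1 = θ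

/-- Rounding may put several replenishments at one moment; by subadditivity the union costs no more
than its parts. -/
theorem sum_orderCost_rounded_le (fl : ℝ → ℕ) (L : List (ℝ × Finset (Fin s))) (A : Finset ℕ) :
    ∑ θ ∈ A, D.orderCost (D.rounded fl L θ) ≤
      (L.map fun e => D.K₀ + ∑ i ∈ e.2, D.K i).sum := by
  induction L with
  | nil =>
    refine (Finset.sum_eq_zero fun θ _ => ?_).le
    simp [rounded, orderCost]
  | cons e L ih =>
    rw [List.map_cons, List.sum_cons]
    have h1 : ∀ θ, D.orderCost (D.rounded fl (e :: L) θ) ≤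
        (if θ = fl e.1 then D.K₀ + ∑ i ∈ e.2, D.K i else 0) + D.orderCost (D.rounded fl L θ) := by
      intro θ
      split_ifs with h
      · refine (orderCost_mono (B := e.2 ∪ D.rounded fl L θ) fun i hi => ?_).trans
          ((orderCost_union_le _ _).trans (Nat.add_le_add_right (orderCost_le _) _))
        simp only [rounded, List.mem_cons, Finset.mem_filter, Finset.mem_univ, true_and] at hi
        simp only [Finset.mem_union, rounded, Finset.mem_filter, Finset.mem_univ, true_and]
        obtain ⟨e', rfl | he, hi⟩ := hi
        · exact Or.inl hi.1
        · exact Or.inr ⟨e', he, hi⟩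
      · rw [zero_add]
        refine orderCost_mono fun i hi => ?_
        simp only [rounded, List.mem_cons, Finset.mem_filter, Finset.mem_univ, true_and] at hi ⊢
        obtain ⟨e', rfl | he, hi⟩ := hi
        · exact (h hi.2.2.symm).elim
        · exact ⟨e', he, hi⟩
    refine (Finset.sum_le_sum fun θ _ => h1 θ).trans ?_
    rw [Finset.sum_add_distrib, Finset.sum_ite_eq']
    refine add_le_add ?_ ih
    split_ifs <;> omega

/-- The data describe the instance, with the jobs renamed. -/
structure Describes (D : Data s) (I : Instance s) (e : Fin I.n ≃ Fin I.n) : Prop where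
  n : D.n = I.n
  K₀ : D.K₀ = I.K₀
  K : D.K = I.K
  r : ∀ k : Fin I.n, D.r k = I.r (e k)
  w : ∀ k : Fin I.n, D.w k = I.w (e k)
  q : ∀ k : Fin I.n, D.q k = I.R (e k)

/-- Rounding replaces an arbitrary real competitor by an integral one on the grid of the recursion,
at no greater cost. Only then can the minimum of the recursion be compared with all real solutions.
-/
theorem Describes.exists_schedules_le {I : Instance s} {e : Fin I.n ≃ Fin I.n}
    (h : D.Describes I e) (hp : ∀ j, I.p j = 1) (σ : Solution ℝ I.n s) (hσ : I.Feasible σ) :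
    ∃ st Q, D.Schedules st Q ∧ (∀ j < D.n, ∃ c < D.n, ∃ m ≤ D.n, st j = D.r c + m) ∧
      (D.totalCost st Q : ℝ) ≤ I.cost σ := by
  classical
  -- The latest release date not after `x`. Before the first release date the supremum defaults to
  -- `0`, which is why `rounded` demands that a release date precedes.
  let fl : ℝ → ℕ := fun x => ((Finset.range D.n).filter fun c => (D.r c : ℝ) ≤ x).sup D.r
  have fl_ge : ∀ c < D.n, ∀ x, (D.r c : ℝ) ≤ x → D.r c ≤ fl x := fun c hc x hx =>
    Finset.le_sup (f := D.r) (Finset.mem_filter.2 ⟨Finset.mem_range.2 hc, hx⟩)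
  have fl_eq : ∀ x, (∃ c < D.n, (D.r c : ℝ) ≤ x) → ∃ c < D.n, fl x = D.r c ∧ (D.r c : ℝ) ≤ x := by
    rintro x ⟨c, hc, hx⟩
    obtain ⟨c', h1, h2⟩ := Finset.exists_mem_eq_sup
      ((Finset.range D.n).filter fun c => (D.r c : ℝ) ≤ x)
      ⟨c, Finset.mem_filter.2 ⟨Finset.mem_range.2 hc, hx⟩⟩ D.r
    obtain ⟨h3, h4⟩ := Finset.mem_filter.1 h1
    exact ⟨c', Finset.mem_range.1 h3, h2, h4⟩
  have fl_mono : ∀ x y, x ≤ y → fl x ≤ fl y := fun x y hxy =>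
    Finset.sup_mono fun c hc => by
      obtain ⟨h1, h2⟩ := Finset.mem_filter.1 hc
      exact Finset.mem_filter.2 ⟨h1, h2.trans hxy⟩
  let x : ℕ → ℝ := fun k => if hk : k < I.n then σ.start (e ⟨k, hk⟩) else 0
  have hx : ∀ k : Fin I.n, x k = σ.start (e k) := fun k => by simp [x]
  have hready : ∀ k : Fin I.n, ∀ i ∈ D.q k, ∃ a ∈ σ.repl, (D.r k : ℝ) ≤ a.1 ∧ a.1 ≤ x k ∧
      i ∈ a.2 := fun k i hi => by
    rw [hx, h.r]
    exact hσ.ready (e k) i (h.q k ▸ hi)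
  have hrx : ∀ k : Fin I.n, (D.r k : ℝ) ≤ x k := fun k => by
    obtain ⟨i, hi⟩ := I.R_nonempty (e k)
    obtain ⟨a, -, h1, h2, -⟩ := hready k i (by rwa [h.q])
    exact h1.trans h2
  have hlt : ∀ k < D.n, k < I.n := fun k hk => by rwa [← h.n]
  have hrx' : ∀ k < D.n, (D.r k : ℝ) ≤ x k := fun k hk => hrx ⟨k, hlt k hk⟩
  have hx0 : ∀ k < D.n, 0 ≤ x k := fun k hk => (Nat.cast_nonneg _).trans (hrx' k hk)
  -- Starts that differ by at least one have different floors.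
  have hN : Set.InjOn (fun k => ⌊x k⌋₊) (Finset.range D.n : Set ℕ) := by
    intro k hk l hl he
    simp only [Finset.coe_range, Set.mem_Iio] at hk hl
    by_contra hne
    have hsep := hσ.no_overlap (e ⟨k, hlt k hk⟩) (e ⟨l, hlt l hl⟩) (by simpa using hne)
    rw [← hx, ← hx, hp, hp] at hsep
    simp only at hsep he
    have f1 : ⌊x k⌋₊ + 1 = ⌊x k + 1⌋₊ := (Nat.floor_add_one (hx0 k hk)).symm
    have f2 : ⌊x l⌋₊ + 1 = ⌊x l + 1⌋₊ := (Nat.floor_add_one (hx0 l hl)).symm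
    rcases hsep with hsep | hsep
    · have := Nat.floor_le_floor hsep
      simp only [Nat.cast_one] at this
      omega
    · have := Nat.floor_le_floor hsep
      simp only [Nat.cast_one] at this
      omega
  -- The ready time is `fl (x k)` and not `D.r k`: the replenishments serving `k` may be rounded to
  -- any release date up to this moment, so `k` must not be shifted below it.
  obtain ⟨st, hinj, hst⟩ := exists_left_shifted D.n (fun k => ⌊x k⌋₊) (fun k => fl (x k)) hN
    fun k hk => by
      obtain ⟨c, hc, h1, h2⟩ := fl_eq (x k) ⟨k, hk, hrx' k hk⟩
      simp only [h1]
      exact Nat.le_floor h2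
  refine ⟨st, D.rounded fl σ.repl, ⟨hinj, fun j hj i hi => ?_, fun θ i hi => ?_⟩,
    fun j hj => ?_, ?_⟩
  · obtain ⟨a, ha, h1, h2, h3⟩ := hready ⟨j, hlt j hj⟩ i hi
    refine ⟨fl a.1, ?_, fl_ge j hj _ h1, (fl_mono _ _ h2).trans (hst j hj).1⟩
    simp only [rounded, Finset.mem_filter, Finset.mem_univ, true_and]
    exact ⟨a, ha, h3, ⟨j, hj, h1⟩, rfl⟩
  · simp only [rounded, Finset.mem_filter, Finset.mem_univ, true_and] at hi
    obtain ⟨a, -, -, h1, h2⟩ := hi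
    obtain ⟨c, hc, h3, -⟩ := fl_eq a.1 h1
    exact ⟨c, hc, by omega⟩
  · obtain ⟨l, hl, m, hm, h1⟩ := (hst j hj).2.2
    obtain ⟨c, hc, h2, -⟩ := fl_eq (x l) ⟨l, hl, hrx' l hl⟩
    exact ⟨c, hc, m, hm, by rw [h1, h2]⟩
  · rw [totalCost, Nat.cast_add, Instance.cost]
    refine add_le_add ?_ ?_
    · rw [Instance.schedulingCost, ← Equiv.sum_comp e, h.n, Finset.sum_range, Nat.cast_sum]
      refine Finset.sum_le_sum fun k _ => ?_
      rw [h.w, hp, ← hx]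
      push_cast
      have hk : (k : ℕ) < D.n := by rw [h.n]; exact k.2
      have h1 : (st k : ℝ) ≤ x k :=
        (Nat.cast_le.2 (hst k hk).2.1).trans (Nat.floor_le (hx0 k hk))
      gcongr
    · refine (Nat.cast_le.2 (sum_orderCost_rounded_le fl σ.repl _)).trans (le_of_eq ?_)
      rw [Instance.replenishmentCost, Nat.cast_list_sum, List.map_map, ← h.K₀, ← h.K]
      congr 1
      refine List.map_congr_left fun a _ => ?_
      simp

/-- The solution read off from the root window, with the replenishments at the times in the list,
is optimal. -/
theorem Describes.isOptimal {I : Instance s} {e : Fin I.n ≃ Fin I.n}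
    (h : D.Describes I e) (hp : ∀ j, I.p j = 1)
    (hw : ∀ i j, i ≤ j → j < D.n → D.w j ≤ D.w i) (L : List ℕ) (hL : L.Pairwise (· < ·))
    (hmem : ∀ θ, θ ∈ L ↔ D.repl D.n (D.window D.root) θ ≠ ∅) :
    I.IsOptimal (Solution.toReal ⟨fun j => D.start D.n (D.window D.root) (e.symm j),
      L.map fun θ => (θ, D.repl D.n (D.window D.root) θ)⟩) := by
  have hlt : ∀ k < D.n, k < I.n := fun k hk => by rwa [← h.n]
  have hk : ∀ k : Fin I.n, (k : ℕ) < D.n := fun k => by rw [h.n]; exact k.2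
  obtain ⟨hs, hopt⟩ := root_optimal hw fun j hj => by
    have := h.q ⟨j, hlt j hj⟩
    rw [show D.q j = _ from this]
    exact I.R_nonempty _
  set st := D.start D.n (D.window D.root)
  set Q := D.repl D.n (D.window D.root)
  refine ⟨⟨?_, fun j k hjk => ?_, fun j i hi => ?_⟩, fun σ hσ => ?_⟩
  · simp only [Solution.toReal, List.map_map]
    rw [List.pairwise_map]
    exact hL.imp fun h => Nat.cast_lt.2 h
  · simp only [Solution.toReal, hp]
    have hne : st (e.symm j) ≠ st (e.symm k) := fun he => hjk <| by
      have := hs.inj (by simpa using hk _) (by simpa using hk _) he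
      exact e.symm.injective (Fin.ext this)
    rcases hne.lt_or_gt with h1 | h1
    · exact Or.inl (by exact_mod_cast h1)
    · exact Or.inr (by exact_mod_cast h1)
  · have hj : D.q (e.symm j) = I.R j := by rw [h.q, Equiv.apply_symm_apply]
    have hj' : D.r (e.symm j) = I.r j := by rw [h.r, Equiv.apply_symm_apply]
    obtain ⟨θ, h1, h2, h3⟩ := hs.ready (e.symm j) (hk _) i (by rwa [hj])
    rw [hj'] at h2
    refine ⟨((θ : ℝ), Q θ), ?_, Nat.cast_le.2 h2, Nat.cast_le.2 h3, h1⟩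
    simp only [Solution.toReal, List.map_map, List.mem_map]
    exact ⟨θ, (hmem θ).2 (Finset.ne_empty_of_mem h1), rfl⟩
  · obtain ⟨st', Q', h1, h2, h3⟩ := h.exists_schedules_le hp σ hσ
    refine le_trans (le_of_eq ?_) ((Nat.cast_le.2 (hopt st' Q' h1 h2)).trans h3)
    rw [totalCost, Nat.cast_add, Instance.cost]
    congr 1
    · rw [Instance.schedulingCost, ← Equiv.sum_comp e, h.n, Finset.sum_range, Nat.cast_sum]
      refine Finset.sum_congr rfl fun k _ => ?_
      rw [← h.w, hp]
      simp [Solution.toReal]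
    · have hsub : L.toFinset ⊆ (Finset.range D.n).image D.r := fun θ hθ => by
        obtain ⟨i, hi⟩ := Finset.nonempty_iff_ne_empty.2 ((hmem θ).1 (List.mem_toFinset.1 hθ))
        obtain ⟨c, hc, hr⟩ := hs.release θ i hi
        exact Finset.mem_image.2 ⟨c, Finset.mem_range.2 hc, hr⟩
      rw [← Finset.sum_subset hsub fun θ _ hθ => by
        have : Q θ = ∅ := by
          by_contra hne
          exact hθ (List.mem_toFinset.2 ((hmem θ).2 hne))
        rw [this, orderCost, if_pos rfl]]
      rw [List.sum_toFinset _ (hL.imp fun h => ne_of_lt h), Instance.replenishmentCost,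
        Nat.cast_list_sum]
      simp only [Solution.toReal, List.map_map]
      congr 1
      refine List.map_congr_left fun θ hθ => ?_
      simp [orderCost, (hmem θ).1 hθ, h.K₀, h.K]

end Data
end JRP

/-! ### Arithmetic and logic in expressions -/

namespace RAM
namespace Exp

def Holds (τ : Store) (e : Exp) : Prop := e.val τ ≠ 0

instance (τ : Store) (e : Exp) : Decidable (e.Holds τ) := inferInstanceAs (Decidable (_ ≠ 0))

/-- Expressions in the first input cell. -/
def IsBound : Exp → Prop
  | lit _ => True
  | read 0 (lit 0) => True
  | read _ _ => False
  | add e₁ e₂ => IsBound e₁ ∧ IsBound e₂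
  | mul e₁ e₂ => IsBound e₁ ∧ IsBound e₂
  | sub _ _ => False
  | div _ _ => False

theorem IsBound.exists_eq {e : Exp} (he : e.IsBound) :
    ∃ p : Polynomial ℕ, ∀ σ : Store, e.val σ = p.eval (σ 0 0) := by
  induction e with
  | lit m => exact ⟨Polynomial.C m, fun σ => by simp [val]⟩
  | read a idx =>
    match a, idx, he with
    | 0, lit 0, _ => exact ⟨Polynomial.X, fun σ => by simp [val]⟩
  | add e₁ e₂ ih₁ ih₂ =>
    obtain ⟨p, hp⟩ := ih₁ he.1
    obtain ⟨q, hq⟩ := ih₂ he.2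
    exact ⟨p + q, fun σ => by simp [val, hp, hq]⟩
  | mul e₁ e₂ ih₁ ih₂ =>
    obtain ⟨p, hp⟩ := ih₁ he.1
    obtain ⟨q, hq⟩ := ih₂ he.2
    exact ⟨p * q, fun σ => by simp [val, hp, hq]⟩
  | sub => exact he.elim
  | div => exact he.elim

/-- Nonzero values count as true. Truncated subtraction yields comparisons and negation, the product
is conjunction and the sum is disjunction. -/
def lt (x y : Exp) : Exp := sub y x
def le (x y : Exp) : Exp := sub (add y (lit 1)) x
def eq (x y : Exp) : Exp := sub (lit 1) (add (sub x y) (sub y x))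
def not (x : Exp) : Exp := sub (lit 1) x
def and (x y : Exp) : Exp := mul x y
def or (x y : Exp) : Exp := add x y
/-- `1` if the condition holds and `0` otherwise. -/
def flag (x : Exp) : Exp := sub (lit 1) (sub (lit 1) x)
def mod (x y : Exp) : Exp := sub x (mul y (div x y))

def all {s : ℕ} (f : Fin s → Exp) : Exp := (List.ofFn f).foldr and (lit 1)
def any {s : ℕ} (f : Fin s → Exp) : Exp := (List.ofFn f).foldr or (lit 0)
def sum {s : ℕ} (f : Fin s → Exp) : Exp := (List.ofFn f).foldr add (lit 0)

section
variable (τ : Store) (x y : Exp)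

@[simp] theorem holds_lt : (lt x y).Holds τ ↔ x.val τ < y.val τ := by
  simp only [Holds, lt, val]; omega
@[simp] theorem holds_le : (le x y).Holds τ ↔ x.val τ ≤ y.val τ := by
  simp only [Holds, le, val]; omega
@[simp] theorem holds_eq : (eq x y).Holds τ ↔ x.val τ = y.val τ := by
  simp only [Holds, eq, val]; omega
@[simp] theorem holds_not : (not x).Holds τ ↔ ¬ x.Holds τ := by
  simp only [Holds, not, val]; omega
@[simp] theorem holds_and : (and x y).Holds τ ↔ x.Holds τ ∧ y.Holds τ := by
  simp [Holds, and, val]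
@[simp] theorem holds_or : (or x y).Holds τ ↔ x.Holds τ ∨ y.Holds τ := by
  simp only [Holds, or, val]; omega
@[simp] theorem val_flag : (flag x).val τ = if x.Holds τ then 1 else 0 := by
  by_cases h : x.val τ = 0
  · simp [flag, val, Holds, h]
  · simp only [flag, val, Holds, ne_eq, h, not_false_eq_true, if_true]
    omega
@[simp] theorem val_mod : (mod x y).val τ = x.val τ % y.val τ := by
  simp only [mod, val]
  exact (Nat.mod_eq_sub _ _).symm
@[simp] theorem holds_all {s : ℕ} (f : Fin s → Exp) : (all f).Holds τ ↔ ∀ i, (f i).Holds τ := by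
  induction s with
  | zero => simp [all, Holds, val]
  | succ s ih =>
    rw [Fin.forall_fin_succ, ← ih, ← holds_and, all, List.ofFn_succ, List.foldr_cons, all]
@[simp] theorem holds_any {s : ℕ} (f : Fin s → Exp) : (any f).Holds τ ↔ ∃ i, (f i).Holds τ := by
  induction s with
  | zero => simp [any, Holds, val]
  | succ s ih =>
    rw [Fin.exists_fin_succ, ← ih, ← holds_or, any, List.ofFn_succ, List.foldr_cons, any]
@[simp] theorem val_sum {s : ℕ} (f : Fin s → Exp) : (sum f).val τ = ∑ i, (f i).val τ := by
  induction s with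
  | zero => simp [sum, val]
  | succ s ih =>
    rw [Fin.sum_univ_succ, ← ih, sum, List.ofFn_succ, List.foldr_cons, sum, val]

theorem tame_sum {s : ℕ} {f : Fin s → Exp} (h : ∀ i, (f i).Tame) : (sum f).Tame := by
  induction s with
  | zero => simp [sum, Tame]
  | succ s ih =>
    rw [sum, List.ofFn_succ, List.foldr_cons]
    exact ⟨h 0, ih fun i => h i.succ⟩

end

/-- The number of jobs. -/
def n : Exp := read 0 (lit 0)

/-- Multiplication by `n + 1`, and below by `M` and by powers, uses only products with the input
cell `n` in front. Window indices built this way are tame and may be stored. -/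
def mulSucc (e : Exp) : Exp := add (mul n e) e
def mulM (e : Exp) : Exp := mulSucc (add (mul n e) (add e e))
def mulPow (e : Exp) : ℕ → Exp
  | 0 => e
  | i + 1 => mulSucc (mulPow e i)

end Exp

open Exp

@[simp] theorem Tree.val_leaf (τ : Store) (e : Exp) : (Tree.leaf e).val τ = e.val τ := rfl
@[simp] theorem Tree.val_ite (τ : Store) (b : Exp) (t₁ t₂ : Tree) :
    (Tree.ite b t₁ t₂).val τ = if b.Holds τ then t₁.val τ else t₂.val τ := rfl

theorem Line.good {ℓ : Line} (h0 : ℓ.arr ≠ 0) (h2 : ℓ.arr ≠ 2) (hb : ℓ.bound.IsBound)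
    (ht : ℓ.tree.Tame) : ℓ.Good := by
  obtain ⟨p, hp⟩ := hb.exists_eq
  exact ⟨h0, h2, ht, fun σ σ' h => by rw [hp, hp, h], p, fun σ => (hp σ).le⟩

end RAM

/-! ### The program -/

namespace JRP
open RAM Exp

section Expressions

variable (s : ℕ)

def eM : Exp := mulM (lit 1)
def eU : Exp := mulPow (lit 1) s
def eZ : Exp := mul (mul (mul eM eM) (eU s)) (eU s)
/-- The number of slots of one window. -/
def eW : Exp := add (mul eM (eU s)) (lit 1)

/-- The original number of the `k`th job in the order of the weights. -/
def eJob (k : Exp) : Exp := read 4 (add (mulSucc k) n)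
-- The input has a header of `2 + s` numbers and a block of `3 + s` numbers per job: offset `1` is
-- the release date, `2` the weight, and the resource flags start at `3`.
def eInput (o : ℕ) (j : Exp) : Exp := read 0 (add (mul (lit (3 + s)) j) (lit (2 + s + o)))
def eRelease (k : Exp) : Exp := eInput s 1 (eJob k)
def eTime (c : Exp) : Exp := read 5 c
def eLast (u : Exp) (i : ℕ) : Exp := read 6 (mod (div u (mulPow (lit 1) i)) (add n (lit 1)))
def eReady (u k : Exp) : Exp :=
  all fun i : Fin s => or (eq (eInput s (3 + i) (eJob k)) (lit 0)) (lt (eRelease s k) (eLast u i))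
def eStays (k u v : Exp) : Exp := or (eReady s u k) (not (eReady s v k))

/-- Windows of expressions. -/
structure EWindow where
  a : Exp
  b : Exp
  u : Exp
  v : Exp

def eWindow (z : Exp) : EWindow :=
  ⟨div (div (div z (eU s)) (eU s)) eM, mod (div (div z (eU s)) (eU s)) eM,
    mod (div z (eU s)) (eU s), mod z (eU s)⟩
def eIndex (S : EWindow) : Exp :=
  add (mulPow (add (mulPow (add (mulM S.a) S.b) s) S.u) s) S.v
def EWindow.left (S : EWindow) (t x : Exp) : EWindow := ⟨S.a, t, S.u, x⟩
def EWindow.right (S : EWindow) (t x : Exp) : EWindow := ⟨add t (lit 1), S.b, x, S.v⟩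

/-- The number of slot `m` of the window `z` on level `k`. -/
def eSlot (k z m : Exp) : Exp := add (mul (add (mul k (eZ s)) z) (eW s)) m
def eValue (k z : Exp) : Exp := read 7 (eSlot s k z (mul eM (eU s)))
def eChoice (k z : Exp) : Exp := read 8 (eSlot s k z (mul eM (eU s)))

end Expressions

/-- The counts of the numbers `c' < m` that satisfy `before c' c`, in cell `c * (n + 1) + m`. -/
def countLine (arr : ℕ) (before : Exp → Exp → Exp) : Line where
  arr := arr
  bound := mulSucc n
  tree :=
    .ite (eq (mod counter (add n (lit 1))) (lit 0)) (.leaf (lit 0))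
      (.leaf (add (read arr (sub counter (lit 1)))
        (flag (before (sub (mod counter (add n (lit 1))) (lit 1))
          (div counter (add n (lit 1)))))))

/-- The number with property `sel` whose count in the array `cnt` is `k`, in cell
`k * (n + 1) + n`. -/
def inverseLine (arr cnt : ℕ) (sel : Exp → Exp) : Line where
  arr := arr
  bound := mulSucc n
  tree :=
    .ite (eq (mod counter (add n (lit 1))) (lit 0)) (.leaf (lit 0))
      (.ite (and (sel (sub (mod counter (add n (lit 1))) (lit 1)))
          (eq (read cnt (add (mulSucc (sub (mod counter (add n (lit 1))) (lit 1))) n))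
            (div counter (add n (lit 1)))))
        (.leaf (sub (mod counter (add n (lit 1))) (lit 1)))
        (.leaf (read arr (sub counter (lit 1)))))

section Lines

variable (s : ℕ)

/-- The job `c'` precedes the job `c` in the order of the weights. -/
def eHeavier (c' c : Exp) : Exp :=
  or (lt (eInput s 2 c) (eInput s 2 c')) (and (eq (eInput s 2 c) (eInput s 2 c')) (lt c' c))

def timeLine : Line where
  arr := 5
  bound := eM
  tree := .leaf (add (eRelease s (div counter (add n (lit 2)))) (mod counter (add n (lit 2))))

def relLine : Line where
  arr := 6
  bound := add n (lit 1)
  tree := .ite (lt counter n) (.leaf (add (eRelease s counter) (lit 1))) (.leaf (lit 0))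

def eNew (S : EWindow) (i : ℕ) : Exp :=
  and (lt (eTime S.a) (eLast S.v i)) (le (eLast S.v i) (add (eTime S.b) (lit 1)))

/-- A window may contain exponentially many moments, so the cost is summed over resources. The fixed
cost of a moment is charged to the least resource replenished there. -/
def baseTree (S : EWindow) : Tree :=
  .ite (all fun i : Fin s => or (eq (eLast S.v i) (eLast S.u i)) (eNew S i))
    (.leaf (add (add (sum fun i : Fin s => mul (read 0 (lit (2 + i))) (flag (eNew S i)))
      (mul (read 0 (lit 1)) (sum fun i : Fin s => flag (and (eNew S i)
        (all fun i' : Fin s => if i' < i then not (eq (eLast S.v i') (eLast S.v i)) else lit 1)))))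
      (lit 1)))
    (.leaf (lit 0))

def minTree (prev ok e : Exp) : Tree :=
  .ite ok (.ite (or (eq prev (lit 0)) (lt e prev)) (.leaf e) (.leaf prev)) (.leaf prev)

def eSplits (k : Exp) (S : EWindow) (t x : Exp) : Exp :=
  and (le (eTime S.a) (eTime t)) (and (lt (eTime t) (eTime S.b)) (and (lt (add t (lit 1)) eM)
    (and (eq (eTime (add t (lit 1))) (add (eTime t) (lit 1))) (and (eReady s x k)
      (and (eValue s k (eIndex s (S.left t x))) (eValue s k (eIndex s (S.right t x))))))))

def eCandidate (k : Exp) (S : EWindow) (t x : Exp) : Exp :=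
  sub (add (add (eValue s k (eIndex s (S.left t x))) (eValue s k (eIndex s (S.right t x))))
    (mul (eInput s 2 (eJob k)) (add (eTime t) (lit 1)))) (lit 1)

def slotTree (k z m : Exp) (S : EWindow) : Tree :=
  .ite (eq k (lit 0)) (baseTree s S)
    (.ite (eStays s (sub k (lit 1)) S.u S.v) (.leaf (eValue s (sub k (lit 1)) z))
      (.ite (eq m (lit 0)) (.leaf (lit 0))
        (minTree (read 7 (sub counter (lit 1)))
          (eSplits s (sub k (lit 1)) S (div (sub m (lit 1)) (eU s)) (mod (sub m (lit 1)) (eU s)))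
          (eCandidate s (sub k (lit 1)) S (div (sub m (lit 1)) (eU s))
            (mod (sub m (lit 1)) (eU s))))))

/-- The counter is decomposed lexicographically with the level as leading part, so all slots of
level `k` are filled before those of level `k + 1`. -/
def slotLine : Line where
  arr := 7
  bound := mul (mul (add n (lit 1)) (eZ s)) (eW s)
  tree := slotTree s (div (div counter (eW s)) (eZ s)) (mod (div counter (eW s)) (eZ s))
    (mod counter (eW s)) (eWindow s (mod (div counter (eW s)) (eZ s)))

/-- The last change of the array `src` among the positions counted by `m`. -/
def changeLine (arr src : ℕ) (bound m : Exp) : Line where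
  arr := arr
  bound := bound
  tree :=
    .ite (eq m (lit 0)) (.leaf (lit 0))
      (.ite (eq (read src counter) (read src (sub counter (lit 1))))
        (.leaf (read arr (sub counter (lit 1)))) (.leaf (sub m (lit 1))))

def choiceLine : Line :=
  changeLine 8 7 (mul (mul (add n (lit 1)) (eZ s)) (eW s)) (mod counter (eW s))

/-- Whether the first `m` jobs are ready for `v`, in cell `v * (n + 1) + m`. -/
def readyLine : Line where
  arr := 9
  bound := mulSucc (eU s)
  tree :=
    .ite (eq (mod counter (add n (lit 1))) (lit 0)) (.leaf (lit 1))
      (.ite (eReady s (div counter (add n (lit 1))) (sub (mod counter (add n (lit 1))) (lit 1)))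
        (.leaf (read 9 (sub counter (lit 1)))) (.leaf (lit 0)))

def eIsRoot (S : EWindow) : Exp :=
  and (all fun i : Fin s => eq (eLast S.u i) (lit 0)) (and (le (eTime S.a) (eTime S.b))
    (read 9 (add (mulSucc S.v) n)))

def rootValueLine : Line where
  arr := 10
  bound := add (eZ s) (lit 1)
  tree :=
    .ite (eq counter (lit 0)) (.leaf (lit 0))
      (minTree (read 10 (sub counter (lit 1)))
        (and (eIsRoot s (eWindow s (sub counter (lit 1))))
          (eValue s n (sub counter (lit 1))))
        (eValue s n (sub counter (lit 1))))

def rootLine : Line := changeLine 11 10 (add (eZ s) (lit 1)) counter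

def eRoot : Exp := read 11 (eZ s)

/-- The windows on the path from the root that takes the left branch according to
`goLeft c t x`, where `c` is the number of the path. -/
def walkLine (arr : ℕ) (goLeft : Exp → Exp → Exp → Exp) : Line where
  arr := arr
  bound := mulSucc n
  tree :=
    let c := div counter (add n (lit 1))
    let d := mod counter (add n (lit 1))
    let z := read arr (sub counter (lit 1))
    let k := sub n d
    let S := eWindow s z
    let t := div (eChoice s (add k (lit 1)) z) (eU s)
    let x := mod (eChoice s (add k (lit 1)) z) (eU s)
    .ite (eq d (lit 0)) (.leaf (eRoot s))
      (.ite (eStays s k S.u S.v) (.leaf z)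
        (.ite (goLeft c t x) (.leaf (eIndex s (S.left t x))) (.leaf (eIndex s (S.right t x)))))

/-- A job or a release date determines one path in the tree of splits. Storing these paths of length
at most `n` replaces a recursive reconstruction. -/
def jobWalkLine : Line := walkLine s 12 fun c _ x => eReady s x c

def timeWalkLine : Line := walkLine s 13 fun c t _ => le (eRelease s c) (eTime t)

/-- Resource `i` is replenished at the `c`th release date. -/
def eRepl (c : Exp) (i : ℕ) : Exp :=
  eq (eLast (eWindow s (read 13 (add (mulSucc c) n))).v i) (add (eRelease s c) (lit 1))

def dupLine : Line :=
  countLine 14 fun b c => and (eq (eRelease s b) (eRelease s c)) (lt b c)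

/-- The `c`th release date is the first of its value, and some resource is replenished there. -/
def eSelected (c : Exp) : Exp :=
  and (eq (read 14 (add (mulSucc c) n)) (lit 0)) (any fun i : Fin s => eRepl s c i)

def positionLine : Line :=
  countLine 15 fun c' c => and (eSelected s c') (lt (eRelease s c') (eRelease s c))

def momentLine : Line := inverseLine 16 15 (eSelected s)

/-- The condition ignores the row, so any row counts the selected release dates; row `0` is the one
read. -/
def totalLine : Line := countLine 17 fun c _ => eSelected s c

/-- The starting time of job `j`. -/
def startTree (j : Exp) : Tree :=
  let k := read 3 (add (mulSucc j) n)
  let z := read 12 (add (mulSucc k) (sub (sub n (lit 1)) k))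
  .ite (eStays s k (eWindow s z).u (eWindow s z).v) (.leaf (lit 0))
    (.leaf (eTime (div (eChoice s (add k (lit 1)) z) (eU s))))

/-- Entry `o` of the `p`th replenishment. -/
def replTree (p o : Exp) : Tree :=
  let c := read 16 (add (mulSucc p) n)
  .ite (eq o (lit 0)) (.leaf (eRelease s c))
    (.leaf (sum fun i : Fin s => flag (and (eq o (lit (i + 1))) (eRepl s c i))))

def outputLine : Line where
  arr := 1
  bound := add (add n (lit 1)) (mul n (lit (s + 1)))
  tree :=
    .ite (lt counter n) (startTree s counter)
      (.ite (eq counter n) (.ite n (.leaf (read 17 n)) (.leaf (lit 0)))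
        (replTree s (div (sub counter (add n (lit 1))) (lit (s + 1)))
          (mod (sub counter (add n (lit 1))) (lit (s + 1)))))

/-- The arrays are numbered in the order in which they are filled, with the output last. Each line
needs only the input, lower numbered arrays and earlier cells of its own. -/
def lines : List Line :=
  [countLine 3 (eHeavier s), inverseLine 4 3 (fun _ => lit 1), timeLine s, relLine s, slotLine s,
    choiceLine s, readyLine s, rootValueLine s, rootLine s, jobWalkLine s, timeWalkLine s,
    dupLine s, positionLine s, momentLine s, totalLine s, outputLine s]

end Lines

theorem good_of_mem_lines (s : ℕ) : ∀ ℓ ∈ lines s, ℓ.Good := by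
  have hM : eM.IsBound := by simp [eM, mulM, mulSucc, n, IsBound]
  have hn : Exp.n.IsBound := by simp [n, IsBound]
  have hpow : ∀ i, (mulPow (lit 1) i).IsBound := fun i => by
    induction i with
    | zero => simp [mulPow, IsBound]
    | succ i ih => simp [mulPow, mulSucc, IsBound, hn, ih]
  have hpt : ∀ e, e.Tame → ∀ i, (mulPow e i).Tame := fun e he i => by
    induction i with
    | zero => simpa [mulPow]
    | succ i ih => simp [mulPow, mulSucc, Tame, n, ih]
  have hidx : ∀ S : EWindow, S.a.Tame → S.b.Tame → S.u.Tame → S.v.Tame → (eIndex s S).Tame :=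
    fun S ha hb hu hv => by
      have h1 : (mulM S.a).Tame := by simp [mulM, mulSucc, Tame, n, ha]
      have h2 := hpt (add (mulM S.a) S.b) (by simp [Tame, h1, hb]) s
      have h3 := hpt (add (mulPow (add (mulM S.a) S.b) s) S.u) (by simp [Tame, h2, hu]) s
      simp [eIndex, Tame, h3, hv]
  have hU : (eU s).IsBound := hpow s
  have hZ : (eZ s).IsBound := by simp [eZ, IsBound, hM, hU]
  have hW : (eW s).IsBound := by simp [eW, IsBound, hM, hU]
  simp only [lines, List.forall_mem_cons]
  refine ⟨?_, ?_, ?_, ?_, ?_, ?_, ?_, ?_, ?_, ?_, ?_, ?_, ?_, ?_, ?_, ?_, by simp⟩ <;>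
    refine Line.good (by simp [countLine, inverseLine, timeLine, relLine, slotLine, choiceLine,
      changeLine, readyLine, rootValueLine, rootLine, jobWalkLine, timeWalkLine, walkLine, dupLine,
      positionLine, momentLine, totalLine, outputLine]) (by simp [countLine, inverseLine, timeLine,
      relLine, slotLine, choiceLine, changeLine, readyLine, rootValueLine, rootLine, jobWalkLine,
      timeWalkLine, walkLine, dupLine, positionLine, momentLine, totalLine, outputLine]) ?_ ?_
  all_goals first
    | simp [countLine, inverseLine, timeLine, relLine, slotLine, choiceLine,
      changeLine, readyLine, rootValueLine, rootLine, jobWalkLine, timeWalkLine, walkLine, dupLine,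
      positionLine, momentLine, totalLine, outputLine, IsBound, mulSucc, hM, hn, hU, hZ, hW]
      done
    | repeat' first
        | exact trivial
        | exact tame_sum fun _ => trivial
        | exact hidx _ trivial trivial trivial trivial
        | exact hidx _ ⟨trivial, trivial⟩ trivial trivial trivial
        | refine And.intro ?_ ?_

end JRP

/-! ### Evaluating expressions in the final memory; counting and ranking -/

namespace JRP
open RAM Exp

/-- The final memory `Ω` of a program contains the values of the line `ℓ`, which were computed
from the input and the arrays with numbers from `3` to `lim - 1`. -/
def Obeys (Ω : Store) (ℓ : Line) (lim : ℕ) : Prop :=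
  ∀ i < ℓ.bound.val Ω, ∃ τ : Store, Ω ℓ.arr i = ℓ.tree.val τ ∧ τ 2 0 = i ∧
    (∀ b, b = 0 ∨ 3 ≤ b ∧ b < lim → τ b = Ω b) ∧ ∀ k < i, τ ℓ.arr k = Ω ℓ.arr k

theorem obeys_of_run {s : ℕ} {σ Ω : Store} (hΩ : run (lines s) σ = Ω) (pre post : List Line)
    (ℓ : Line) (lim : ℕ) (h : lines s = pre ++ ℓ :: post)
    (hl : ∀ b ∈ (ℓ :: post).map Line.arr, b = 1 ∨ lim ≤ b)
    (hn : ℓ.arr ∉ post.map Line.arr) : Obeys Ω ℓ lim := by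
  intro i hi
  have hg := good_of_mem_lines s
  rw [h] at hΩ hg
  obtain ⟨τ, h1, h2, h3, h4⟩ := run_line pre post ℓ σ hg hn Ω hΩ i hi
  refine ⟨τ, h1, h2, fun b hb => h3 b (by omega) fun hmem => ?_, h4⟩
  rcases hl b hmem with h5 | h5
  · omega
  · rcases hb with rfl | hb
    · obtain ⟨ℓ', h6, h7⟩ := List.mem_map.1 hmem
      exact (hg ℓ' (List.mem_append_right _ h6)).arr_ne_zero h7
    · omega

/-- The original number of the `k`th job. -/
def jobAt (Ω : Store) (k : ℕ) : ℕ := Ω 4 (k * (Ω 0 0 + 1) + Ω 0 0)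

/-- The data of the instance in the order of the weights. -/
def dataOf (s : ℕ) (Ω : Store) : Data s where
  n := Ω 0 0
  K₀ := Ω 0 1
  K i := Ω 0 (2 + i)
  r k := Ω 0 ((3 + s) * jobAt Ω k + (2 + s + 1))
  w k := Ω 0 ((3 + s) * jobAt Ω k + (2 + s + 2))
  q k := Finset.univ.filter fun i => Ω 0 ((3 + s) * jobAt Ω k + (2 + s + (3 + i))) ≠ 0

/-- `τ` agrees with `Ω` on the input and the arrays from `3` to `lim - 1`. -/
def Agrees (τ Ω : Store) (lim : ℕ) : Prop := ∀ b, b = 0 ∨ 3 ≤ b ∧ b < lim → τ b = Ω b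

def EWindow.val (τ : Store) (S : EWindow) : Window := ⟨S.a.val τ, S.b.val τ, S.u.val τ, S.v.val τ⟩

namespace Agrees

variable {τ Ω : Store} {lim : ℕ} {s : ℕ}

theorem val_n (h : Agrees τ Ω lim) : n.val τ = Ω 0 0 := by simp [n, Exp.val, h 0 (Or.inl rfl)]

theorem val_mulSucc (h : Agrees τ Ω lim) (e : Exp) :
    (mulSucc e).val τ = e.val τ * (Ω 0 0 + 1) := by
  simp only [mulSucc, Exp.val, h.val_n]
  ring

theorem val_mulPow (h : Agrees τ Ω lim) (e : Exp) (i : ℕ) :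
    (mulPow e i).val τ = e.val τ * (Ω 0 0 + 1) ^ i := by
  induction i with
  | zero => simp [mulPow]
  | succ i ih => rw [mulPow, h.val_mulSucc, ih, pow_succ, mul_assoc]

theorem val_mulU (h : Agrees τ Ω lim) (e : Exp) :
    (mulPow e s).val τ = e.val τ * (dataOf s Ω).U := h.val_mulPow e s

theorem val_mulM (h : Agrees τ Ω lim) (e : Exp) :
    (mulM e).val τ = e.val τ * (dataOf s Ω).M := by
  simp only [mulM, h.val_mulSucc, Exp.val, h.val_n, Data.M, dataOf]
  ring

theorem val_eM (h : Agrees τ Ω lim) : eM.val τ = (dataOf s Ω).M := by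
  rw [eM, h.val_mulM (s := s), Exp.val, one_mul]

theorem val_eU (h : Agrees τ Ω lim) : (eU s).val τ = (dataOf s Ω).U := by
  rw [eU, h.val_mulU, Exp.val, one_mul]

theorem val_eZ (h : Agrees τ Ω lim) : (eZ s).val τ = (dataOf s Ω).Z := by
  simp only [eZ, Exp.val, h.val_eM (s := s), h.val_eU, Data.Z]

theorem val_eW (h : Agrees τ Ω lim) :
    (eW s).val τ = (dataOf s Ω).M * (dataOf s Ω).U + 1 := by
  simp only [eW, Exp.val, h.val_eM (s := s), h.val_eU]

theorem val_eInput (h : Agrees τ Ω lim) (o : ℕ) (j : Exp) :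
    (eInput s o j).val τ = Ω 0 ((3 + s) * j.val τ + (2 + s + o)) := by
  simp only [eInput, Exp.val, h 0 (Or.inl rfl)]

theorem val_eJob (h : Agrees τ Ω lim) (hl : 4 < lim) (k : Exp) :
    (eJob k).val τ = jobAt Ω (k.val τ) := by
  simp only [eJob, Exp.val, h.val_mulSucc, h.val_n, jobAt, h 4 (Or.inr ⟨by norm_num, hl⟩)]

theorem val_eRelease (h : Agrees τ Ω lim) (hl : 4 < lim) (k : Exp) :
    (eRelease s k).val τ = (dataOf s Ω).r (k.val τ) := by
  simp only [eRelease, h.val_eInput, h.val_eJob hl, dataOf]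

theorem val_weight (h : Agrees τ Ω lim) (hl : 4 < lim) (k : Exp) :
    (eInput s 2 (eJob k)).val τ = (dataOf s Ω).w (k.val τ) := by
  simp only [h.val_eInput, h.val_eJob hl, dataOf]

theorem val_eTime (h : Agrees τ Ω lim) (hl : 5 < lim)
    (hT : ∀ c < (dataOf s Ω).M, Ω 5 c = (dataOf s Ω).time c) (c : Exp)
    (hc : c.val τ < (dataOf s Ω).M) : (eTime c).val τ = (dataOf s Ω).time (c.val τ) := by
  rw [eTime, Exp.val, h 5 (Or.inr ⟨by norm_num, hl⟩), hT _ hc]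

theorem val_eLast (h : Agrees τ Ω lim) (hl : 6 < lim)
    (hR : ∀ c ≤ Ω 0 0, Ω 6 c = (dataOf s Ω).rel c) (u : Exp) (i : Fin s) :
    (eLast u i).val τ = (dataOf s Ω).last (u.val τ) i := by
  rw [eLast, Exp.val, h 6 (Or.inr ⟨by norm_num, hl⟩), val_mod]
  simp only [Exp.val, h.val_mulPow, h.val_n, one_mul]
  exact hR _ (Nat.lt_succ_iff.1 (Nat.mod_lt _ (Nat.succ_pos _)))

theorem holds_eReady (h : Agrees τ Ω lim) (hl : 6 < lim)
    (hR : ∀ c ≤ Ω 0 0, Ω 6 c = (dataOf s Ω).rel c) (u k : Exp) :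
    (eReady s u k).Holds τ ↔ (dataOf s Ω).Ready (u.val τ) (k.val τ) := by
  simp only [eReady, holds_all, holds_or, holds_eq, holds_lt, h.val_eInput,
    h.val_eJob (show 4 < lim by omega), h.val_eRelease (show 4 < lim by omega), h.val_eLast hl hR,
    Data.Ready, Exp.val]
  refine forall_congr' fun i => ?_
  simp only [dataOf, Finset.mem_filter, Finset.mem_univ, true_and]
  tauto

theorem holds_eStays (h : Agrees τ Ω lim) (hl : 6 < lim)
    (hR : ∀ c ≤ Ω 0 0, Ω 6 c = (dataOf s Ω).rel c) (k : Exp) (S : EWindow) :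
    (eStays s k S.u S.v).Holds τ ↔ (dataOf s Ω).Stays (k.val τ) (S.val τ) := by
  simp only [eStays, holds_or, holds_not, h.holds_eReady hl hR, Data.Stays, EWindow.val]

theorem val_eWindow (h : Agrees τ Ω lim) (z : Exp) :
    (eWindow s z).val τ = (dataOf s Ω).window (z.val τ) := by
  simp only [eWindow, EWindow.val, Data.window, Exp.val, val_mod, h.val_eM (s := s), h.val_eU]

theorem val_eIndex (h : Agrees τ Ω lim) (S : EWindow) :
    (eIndex s S).val τ = (dataOf s Ω).index (S.val τ) := by
  simp only [eIndex, Exp.val, h.val_mulM (s := s), h.val_mulU, Data.index, EWindow.val]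

end Agrees

/-- The position of slot `m` of window `z` on level `k`. -/
def slotAt {s : ℕ} (D : Data s) (k z m : ℕ) : ℕ := (k * D.Z + z) * (D.M * D.U + 1) + m

theorem Agrees.val_eSlot {τ Ω : Store} {lim s : ℕ} (h : Agrees τ Ω lim) (k z m : Exp) :
    (eSlot s k z m).val τ = slotAt (dataOf s Ω) (k.val τ) (z.val τ) (m.val τ) := by
  simp only [eSlot, Exp.val, h.val_eZ, h.val_eW, slotAt]

open Classical in
theorem countLine_spec {Ω : Store} {arr : ℕ} {before : Exp → Exp → Exp}
    (hΩ : Obeys Ω (countLine arr before) arr) (P : ℕ → ℕ → Prop)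
    (hP : ∀ τ, Agrees τ Ω arr → ∀ x y : Exp, x.val τ < Ω 0 0 → y.val τ < Ω 0 0 →
      ((before x y).Holds τ ↔ P (x.val τ) (y.val τ)))
    (c : ℕ) (hc : c < Ω 0 0) (m : ℕ) (hm : m ≤ Ω 0 0) :
    Ω arr (c * (Ω 0 0 + 1) + m) = ((Finset.range m).filter fun c' => P c' c).card := by
  have hbound : ∀ m ≤ Ω 0 0, c * (Ω 0 0 + 1) + m < (countLine arr before).bound.val Ω := by
    intro m hm
    have h : Agrees Ω Ω arr := fun _ _ => rfl
    simp only [countLine, h.val_mulSucc, h.val_n]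
    exact Data.mul_add_lt hc (by omega)
  induction m with
  | zero =>
    obtain ⟨τ, h1, h2, h3, h4⟩ := hΩ _ (hbound 0 hm)
    have h : Agrees τ Ω arr := h3
    have hc' : counter.val τ = c * (Ω 0 0 + 1) + 0 := h2
    change Ω arr _ = _ at h1
    rw [h1]
    simp [countLine, hc', Exp.val, h.val_n]
  | succ m ih =>
    obtain ⟨τ, h1, h2, h3, h4⟩ := hΩ _ (hbound (m + 1) hm)
    have h : Agrees τ Ω arr := h3
    have hc' : counter.val τ = c * (Ω 0 0 + 1) + (m + 1) := h2
    change Ω arr _ = _ at h1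
    have hmod : (c * (Ω 0 0 + 1) + (m + 1)) % (Ω 0 0 + 1) = m + 1 :=
      Data.mul_add_mod' _ (by omega)
    have hdiv : (c * (Ω 0 0 + 1) + (m + 1)) / (Ω 0 0 + 1) = c := Data.mul_add_div' _ (by omega)
    have hval : (sub (mod counter (add n (lit 1))) (lit 1)).val τ = m := by
      simp only [Exp.val, val_mod, hc', h.val_n, hmod]
      omega
    have hval' : (div counter (add n (lit 1))).val τ = c := by
      simp only [Exp.val, hc', h.val_n, hdiv]
    have hprev : τ arr (c * (Ω 0 0 + 1) + (m + 1) - 1) = Ω arr (c * (Ω 0 0 + 1) + m) :=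
      h4 _ (by simp only [← add_assoc, Nat.add_sub_cancel]; omega)
    have hb := hP τ h (sub (mod counter (add n (lit 1))) (lit 1)) (div counter (add n (lit 1)))
      (by rw [hval]; omega) (by rw [hval']; exact hc)
    rw [hval, hval'] at hb
    rw [h1, Finset.range_add_one, Finset.filter_insert]
    simp only [countLine, Tree.val_ite, Tree.val_leaf, holds_eq, val_mod, hc', Exp.val, h.val_n,
      hmod, Nat.succ_ne_zero, if_false, val_flag, hb, hprev, ih (by omega)]
    split_ifs with hPm
    · rw [Finset.card_insert_of_notMem (by simp)]
    · rfl

theorem inverseLine_spec {Ω : Store} {arr cnt : ℕ} {sel : Exp → Exp}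
    (hΩ : Obeys Ω (inverseLine arr cnt sel) arr) (hcnt : 3 ≤ cnt) (ha : cnt < arr)
    (Q : ℕ → Prop) (hQ : ∀ τ, Agrees τ Ω arr → ∀ x : Exp, x.val τ < Ω 0 0 →
      ((sel x).Holds τ ↔ Q (x.val τ)))
    (k : ℕ) (hk : k < Ω 0 0) (c : ℕ) (hc : c < Ω 0 0) (hQc : Q c)
    (hrank : Ω cnt (c * (Ω 0 0 + 1) + Ω 0 0) = k)
    (huniq : ∀ c' < Ω 0 0, Q c' → Ω cnt (c' * (Ω 0 0 + 1) + Ω 0 0) = k → c' = c) :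
    Ω arr (k * (Ω 0 0 + 1) + Ω 0 0) = c := by
  have key : ∀ m ≤ Ω 0 0, c < m → Ω arr (k * (Ω 0 0 + 1) + m) = c := by
    intro m hm
    induction m with
    | zero => omega
    | succ m ih =>
      intro hcm
      have hbound : k * (Ω 0 0 + 1) + (m + 1) < (inverseLine arr cnt sel).bound.val Ω := by
        have h : Agrees Ω Ω arr := fun _ _ => rfl
        simp only [inverseLine, h.val_mulSucc, h.val_n]
        exact Data.mul_add_lt hk (by omega)
      obtain ⟨τ, h1, h2, h3, h4⟩ := hΩ _ hbound
      have h : Agrees τ Ω arr := h3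
      have hc' : counter.val τ = k * (Ω 0 0 + 1) + (m + 1) := h2
      change Ω arr _ = _ at h1
      have hmod : (k * (Ω 0 0 + 1) + (m + 1)) % (Ω 0 0 + 1) = m + 1 :=
        Data.mul_add_mod' _ (by omega)
      have hdiv : (k * (Ω 0 0 + 1) + (m + 1)) / (Ω 0 0 + 1) = k := Data.mul_add_div' _ (by omega)
      have hval : (sub (mod counter (add n (lit 1))) (lit 1)).val τ = m := by
        simp only [Exp.val, val_mod, hc', h.val_n, hmod]
        omega
      have hprev : τ arr (k * (Ω 0 0 + 1) + (m + 1) - 1) = Ω arr (k * (Ω 0 0 + 1) + m) :=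
        h4 _ (by simp only [← add_assoc, Nat.add_sub_cancel]; omega)
      have hb := hQ τ h (sub (mod counter (add n (lit 1))) (lit 1)) (by rw [hval]; omega)
      rw [hval] at hb
      have hz : ¬ (mod counter (add n (lit 1))).val τ = (lit 0).val τ := by
        simp only [val_mod, hc', Exp.val, h.val_n, hmod]
        omega
      have hread : (read cnt (add (mulSucc (sub (mod counter (add n (lit 1))) (lit 1))) n)).val τ =
          Ω cnt (m * (Ω 0 0 + 1) + Ω 0 0) := by
        rw [Exp.val, h cnt (Or.inr ⟨hcnt, ha⟩), Exp.val, h.val_mulSucc, hval, h.val_n]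
      have hk' : (div counter (add n (lit 1))).val τ = k := by
        simp only [Exp.val, hc', h.val_n, hdiv]
      rw [h1]
      simp only [inverseLine, Tree.val_ite, Tree.val_leaf, holds_eq, hz, if_false, hval]
      split_ifs with hif <;> rw [holds_and, hb, holds_eq, hread, hk'] at hif
      · exact huniq m (by omega) hif.1 hif.2
      · rw [Exp.val, Exp.val, hc', Exp.val, hprev]
        refine ih (by omega) (lt_of_le_of_ne (Nat.lt_succ_iff.1 hcm) ?_)
        rintro rfl
        exact hif ⟨hQc, hrank⟩
  exact key _ le_rfl hc

open Classical in
-- Sorting by counting predecessors: a strict order that is total on the selected elements ranks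
-- them bijectively onto an initial segment. Used for the jobs by weight and for the replenishment
-- moments.
theorem rank_spec (n : ℕ) (Q : ℕ → Prop) (R : ℕ → ℕ → Prop) (hRQ : ∀ a b, R a b → Q a)
    (hirr : ∀ a, ¬ R a a) (htrans : ∀ a b c, R a b → R b c → R a c)
    (htot : ∀ a b, a < n → b < n → Q a → Q b → a ≠ b → R a b ∨ R b a) :
    (∀ c < n, Q c → ((Finset.range n).filter fun a => R a c).card <
      ((Finset.range n).filter Q).card) ∧
    (∀ a b, a < n → b < n → Q a → Q b → (R a b ↔
      ((Finset.range n).filter fun x => R x a).card <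
        ((Finset.range n).filter fun x => R x b).card)) ∧
    (∀ k < ((Finset.range n).filter Q).card,
      ∃ c < n, Q c ∧ ((Finset.range n).filter fun a => R a c).card = k) := by
  set f : ℕ → ℕ := fun c => ((Finset.range n).filter fun a => R a c).card with hf
  have h1 : ∀ c < n, Q c → f c < ((Finset.range n).filter Q).card := fun c hc hQ => by
    refine Finset.card_lt_card ⟨fun a ha => ?_, fun h => ?_⟩
    · obtain ⟨h1, h2⟩ := Finset.mem_filter.1 ha
      exact Finset.mem_filter.2 ⟨h1, hRQ a c h2⟩
    · have := h (Finset.mem_filter.2 ⟨Finset.mem_range.2 hc, hQ⟩)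
      exact hirr c (Finset.mem_filter.1 this).2
  have h2 : ∀ a b, a < n → R a b → f a < f b := fun a b ha h => by
    refine Finset.card_lt_card ⟨fun x hx => ?_, fun h' => ?_⟩
    · obtain ⟨h1, h2⟩ := Finset.mem_filter.1 hx
      exact Finset.mem_filter.2 ⟨h1, htrans x a b h2 h⟩
    · have := h' (Finset.mem_filter.2 ⟨Finset.mem_range.2 ha, h⟩)
      exact hirr a (Finset.mem_filter.1 this).2
  have h3 : ∀ a b, a < n → b < n → Q a → Q b → (R a b ↔ f a < f b) := by
    intro a b ha hb hQa hQb
    refine ⟨h2 a b ha, fun h => ?_⟩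
    rcases htot a b ha hb hQa hQb (by rintro rfl; exact lt_irrefl _ h) with h4 | h4
    · exact h4
    · exact absurd (h2 b a hb h4) h.not_gt
  refine ⟨h1, h3, fun k hk => ?_⟩
  -- The ranks are distinct and below the number of selected elements, so they exhaust this range.
  have himg : ((Finset.range n).filter Q).image f = Finset.range ((Finset.range n).filter Q).card := by
    refine Finset.eq_of_subset_of_card_le (fun x hx => ?_) ?_
    · obtain ⟨c, hc, rfl⟩ := Finset.mem_image.1 hx
      obtain ⟨h4, h5⟩ := Finset.mem_filter.1 hc
      exact Finset.mem_range.2 (h1 c (Finset.mem_range.1 h4) h5)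
    · rw [Finset.card_range, Finset.card_image_of_injOn]
      intro a ha b hb he
      obtain ⟨h4, h5⟩ := Finset.mem_filter.1 ha
      obtain ⟨h6, h7⟩ := Finset.mem_filter.1 hb
      rw [Finset.mem_range] at h4 h6
      by_contra hne
      rcases htot a b h4 h6 h5 h7 hne with h | h
      · exact (h2 a b h4 h).ne he
      · exact (h2 b a h6 h).ne' he
  obtain ⟨c, hc, he⟩ := Finset.mem_image.1 (himg ▸ Finset.mem_range.2 hk)
  obtain ⟨h4, h5⟩ := Finset.mem_filter.1 hc
  exact ⟨c, Finset.mem_range.1 h4, h5, he⟩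

end JRP

/-! ### Correctness of the tables of the recursion -/

namespace JRP
open RAM Exp

namespace Data

variable {s : ℕ} (D : Data s)

/-- Resource `i` is replenished in the window, when nothing happens before the last
replenishments. -/
def New (S : Window) (i : Fin s) : Prop :=
  D.time S.a < D.last S.v i ∧ D.last S.v i ≤ D.time S.b + 1

open Classical in
-- Turns the sum over all moments of the window into a sum over resources, the form in which the
-- program computes it.
theorem sum_orderCost_finalRepl (S : Window) :
    ∑ θ ∈ D.times S, D.orderCost (D.finalRepl S θ) =
      ∑ i, D.K i * (if D.New S i then 1 else 0) +
      D.K₀ * ∑ i, (if D.New S i ∧ ∀ i' < i, D.last S.v i' ≠ D.last S.v i then 1 else 0) := by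
  have h1 : ∀ θ, D.orderCost (D.finalRepl S θ) =
      ∑ i, D.K i * (if D.last S.v i = θ + 1 then 1 else 0) +
      D.K₀ * ∑ i, (if D.last S.v i = θ + 1 ∧ ∀ i' < i, D.last S.v i' ≠ D.last S.v i
        then 1 else 0) := by
    intro θ
    rcases (D.finalRepl S θ).eq_empty_or_nonempty with he | hne
    · have h2 : ∀ i, D.last S.v i ≠ θ + 1 := fun i hi => by
        have : i ∈ D.finalRepl S θ := by simp [finalRepl, hi]
        rw [he] at this
        exact absurd this (Finset.notMem_empty i)
      simp [orderCost, he, h2]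
    · have h2 : ∑ i, (if D.last S.v i = θ + 1 ∧ ∀ i' < i, D.last S.v i' ≠ D.last S.v i
          then 1 else 0) = 1 := by
        -- The least resource replenished at `θ` is the only one charged with the fixed cost.
        set j := (D.finalRepl S θ).min' hne with hj
        have hjm : D.last S.v j = θ + 1 := by
          exact (Finset.mem_filter.1 ((D.finalRepl S θ).min'_mem hne)).2
        rw [Finset.sum_eq_single j]
        · rw [if_pos]
          refine ⟨hjm, fun i hi he => ?_⟩
          have := (D.finalRepl S θ).min'_le i (by simp [finalRepl, he, hjm])
          exact absurd hi this.not_gt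
        · intro i _ hij
          rw [if_neg]
          rintro ⟨h3, h4⟩
          have h5 := (D.finalRepl S θ).min'_le i (by simp [finalRepl, h3])
          exact h4 j (lt_of_le_of_ne h5 (Ne.symm hij)) (by rw [hjm, h3])
        · simp
      rw [h2, orderCost, if_neg hne.ne_empty, mul_one, finalRepl, Finset.sum_filter, add_comm]
      simp [mul_ite]
  have h2 : ∀ (i : Fin s) (p : Prop), ∑ θ ∈ D.times S,
      (if D.last S.v i = θ + 1 ∧ p then 1 else 0) = if D.New S i ∧ p then 1 else 0 := by
    intro i p
    by_cases h : D.New S i ∧ p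
    · rw [if_pos h, Finset.sum_eq_single (D.last S.v i - 1)]
      · have := h.1.1
        rw [if_pos ⟨by omega, h.2⟩]
      · intro θ _ hθ
        rw [if_neg]
        rintro ⟨h3, -⟩
        omega
      · intro h3
        exact (h3 (Finset.mem_Icc.2 ⟨by have := h.1.1; omega, by have := h.1.2; omega⟩)).elim
    · rw [if_neg h]
      refine Finset.sum_eq_zero fun θ hθ => if_neg ?_
      rintro ⟨h3, h4⟩
      have := Finset.mem_Icc.1 hθ
      exact h ⟨⟨by omega, by omega⟩, h4⟩
  have h3 : ∀ i : Fin s, ∑ θ ∈ D.times S, (if D.last S.v i = θ + 1 then 1 else 0) =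
      if D.New S i then 1 else 0 := fun i => by simpa using h2 i True
  simp only [h1, Finset.sum_add_distrib, ← Finset.mul_sum]
  rw [Finset.sum_comm, Finset.sum_comm (s := D.times S)]
  simp only [← Finset.mul_sum, h3]
  congr 2
  refine Finset.sum_congr rfl fun i _ => ?_
  convert h2 i (∀ i' < i, D.last S.v i' ≠ D.last S.v i)

end Data

variable {s : ℕ} {Ω τ : Store} {lim : ℕ}

theorem Agrees.holds_eNew (h : Agrees τ Ω lim) (hl : 6 < lim)
    (hT : ∀ c < (dataOf s Ω).M, Ω 5 c = (dataOf s Ω).time c)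
    (hR : ∀ c ≤ Ω 0 0, Ω 6 c = (dataOf s Ω).rel c) (S : EWindow)
    (ha : S.a.val τ < (dataOf s Ω).M) (hb : S.b.val τ < (dataOf s Ω).M) (i : Fin s) :
    (eNew S i).Holds τ ↔ (dataOf s Ω).New (S.val τ) i := by
  simp only [eNew, holds_and, holds_lt, holds_le, Exp.val, h.val_eTime (by omega) hT _ ha,
    h.val_eTime (by omega) hT _ hb, h.val_eLast hl hR, Data.New, EWindow.val]

theorem Agrees.val_baseTree (h : Agrees τ Ω lim) (hl : 6 < lim)
    (hT : ∀ c < (dataOf s Ω).M, Ω 5 c = (dataOf s Ω).time c)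
    (hR : ∀ c ≤ Ω 0 0, Ω 6 c = (dataOf s Ω).rel c) (S : EWindow)
    (ha : S.a.val τ < (dataOf s Ω).M) (hb : S.b.val τ < (dataOf s Ω).M) :
    (baseTree s S).val τ = (dataOf s Ω).base (S.val τ) := by
  classical
  have hfirst : ∀ i : Fin s, (and (eNew S i) (all fun i' : Fin s => if i' < i then
      not (eq (eLast S.v i') (eLast S.v i)) else lit 1)).Holds τ ↔
      (dataOf s Ω).New (S.val τ) i ∧
        ∀ i' < i, (dataOf s Ω).last (S.val τ).v i' ≠ (dataOf s Ω).last (S.val τ).v i := by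
    intro i
    rw [holds_and, h.holds_eNew hl hT hR S ha hb, holds_all]
    refine and_congr_right fun _ => forall_congr' fun i' => ?_
    split_ifs with hi
    · simp [h.val_eLast hl hR, hi, EWindow.val]
    · simp [hi, Holds, Exp.val]
  have hc : (all fun i : Fin s => or (eq (eLast S.v i) (eLast S.u i)) (eNew S i)).Holds τ ↔
      ∀ i : Fin s, (dataOf s Ω).last (S.val τ).v i = (dataOf s Ω).last (S.val τ).u i ∨
        (dataOf s Ω).time (S.val τ).a < (dataOf s Ω).last (S.val τ).v i ∧
        (dataOf s Ω).last (S.val τ).v i ≤ (dataOf s Ω).time (S.val τ).b + 1 := by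
    simp only [holds_all, holds_or, holds_eq, h.holds_eNew hl hT hR S ha hb, h.val_eLast hl hR]
    rfl
  rw [baseTree, Tree.val_ite, Data.base]
  by_cases hh : (all fun i : Fin s => or (eq (eLast S.v i) (eLast S.u i)) (eNew S i)).Holds τ
  · rw [if_pos hh, if_pos (hc.1 hh), Data.sum_orderCost_finalRepl]
    simp only [Tree.val_leaf, Exp.val, val_sum, val_flag, hfirst, h.holds_eNew hl hT hR S ha hb,
      h 0 (Or.inl rfl)]
    rfl
  · rw [if_neg hh, if_neg (fun h' => hh (hc.2 h'))]
    rfl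

/-- The expression `e` need only be correct when `ok` holds; infeasible candidates are caught by the
test and never evaluated. -/
theorem val_minTree {prev ok e : Exp} {c : ℕ} (h1 : ok.Holds τ → e.val τ = c ∧ c ≠ 0)
    (h2 : ¬ ok.Holds τ → c = 0) : (minTree prev ok e).val τ = omin (prev.val τ) c := by
  rw [minTree, Tree.val_ite, Tree.val_ite, omin]
  by_cases h : ok.Holds τ
  · obtain ⟨h3, h4⟩ := h1 h
    simp only [h, if_true, h4, if_false, Tree.val_leaf, holds_or, holds_eq, holds_lt, h3, Exp.val]
  · simp [h, h2 h]

theorem time_spec (hΩ : Obeys Ω (timeLine s) 5) :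
    ∀ c < (dataOf s Ω).M, Ω 5 c = (dataOf s Ω).time c := by
  intro c hc
  have h0 : Agrees Ω Ω 5 := fun _ _ => rfl
  obtain ⟨τ, h1, h2, h3, -⟩ := hΩ c (by simp only [timeLine, h0.val_eM (s := s)]; exact hc)
  have h : Agrees τ Ω 5 := h3
  have hc' : counter.val τ = c := h2
  change Ω 5 c = _ at h1
  rw [h1, Data.time, if_pos hc]
  simp only [timeLine, Tree.val_leaf, Exp.val, h.val_eRelease (show 4 < 5 by norm_num), val_mod,
    hc', h.val_n]
  rfl

theorem rel_spec (hΩ : Obeys Ω (relLine s) 6) :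
    ∀ c ≤ Ω 0 0, Ω 6 c = (dataOf s Ω).rel c := by
  intro c hc
  have h0 : Agrees Ω Ω 6 := fun _ _ => rfl
  obtain ⟨τ, h1, h2, h3, -⟩ := hΩ c (by simp only [relLine, Exp.val, h0.val_n]; omega)
  have h : Agrees τ Ω 6 := h3
  have hc' : counter.val τ = c := h2
  change Ω 6 c = _ at h1
  rw [h1, Data.rel]
  simp only [relLine, Tree.val_ite, Tree.val_leaf, holds_lt, Exp.val,
    h.val_eRelease (show 4 < 6 by norm_num), hc', h.val_n]
  rfl

section Slots

variable (D : Data s)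

theorem slotAt_lt_succ {k z z' m m' : ℕ} (hz : z' < D.Z) (hm : m' ≤ D.M * D.U) :
    slotAt D k z' m' < slotAt D (k + 1) z m := by
  unfold slotAt
  have h1 : k * D.Z + z' < (k + 1) * D.Z := Data.mul_add_lt (Nat.lt_succ_self k) hz
  have h2 := Data.mul_add_lt h1 (Nat.lt_succ_of_le hm)
  have h3 := Nat.mul_le_mul_right (D.M * D.U + 1) (Nat.le_add_right ((k + 1) * D.Z) z)
  have h4 : (D.M * D.U).succ = D.M * D.U + 1 := rfl
  rw [h4] at h2
  omega

theorem slotAt_lt {k z m N : ℕ} (hk : k ≤ N) (hz : z < D.Z) (hm : m ≤ D.M * D.U) :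
    slotAt D k z m < (N + 1) * D.Z * (D.M * D.U + 1) :=
  Data.mul_add_lt (Data.mul_add_lt (Nat.lt_succ_of_le hk) hz) (Nat.lt_succ_of_le hm)

theorem slotAt_mod {k z m : ℕ} (hm : m ≤ D.M * D.U) :
    slotAt D k z m % (D.M * D.U + 1) = m := Data.mul_add_mod' _ (Nat.lt_succ_of_le hm)

theorem slotAt_div {k z m : ℕ} (hm : m ≤ D.M * D.U) :
    slotAt D k z m / (D.M * D.U + 1) = k * D.Z + z := Data.mul_add_div' _ (Nat.lt_succ_of_le hm)

end Slots

theorem Data.InRange.left {D : Data s} {S : Window} (h : D.InRange S) {t x : ℕ} (ht : t < D.M)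
    (hx : x < D.U) : D.InRange (S.left t x) := ⟨h.a, ht, h.u, hx⟩

theorem Data.InRange.right {D : Data s} {S : Window} (h : D.InRange S) {t x : ℕ}
    (ht : t + 1 < D.M) (hx : x < D.U) : D.InRange (S.right t x) := ⟨ht, h.b, hx, h.v⟩

theorem Data.lt_M_of_time_ne_zero {D : Data s} {c : ℕ} (h : D.time c ≠ 0) : c < D.M := by
  by_contra hc
  exact h (by rw [Data.time, if_neg hc])

theorem EWindow.val_left (S : EWindow) (t x : Exp) :
    (S.left t x).val τ = (S.val τ).left (t.val τ) (x.val τ) := rfl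

theorem EWindow.val_right (S : EWindow) (t x : Exp) :
    (S.right t x).val τ = (S.val τ).right (t.val τ) (x.val τ) := rfl

/-- The expressions for the candidates of the recursion. -/
theorem Agrees.candidate_spec (h : Agrees τ Ω lim) (hl : 6 < lim)
    (hT : ∀ c < (dataOf s Ω).M, Ω 5 c = (dataOf s Ω).time c)
    (hR : ∀ c ≤ Ω 0 0, Ω 6 c = (dataOf s Ω).rel c) (k : Exp) (S : EWindow) (m t x : Exp)
    (hS : (dataOf s Ω).InRange (S.val τ)) (hm : m.val τ < (dataOf s Ω).M * (dataOf s Ω).U)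
    (ht : t.val τ = m.val τ / (dataOf s Ω).U) (hx : x.val τ = m.val τ % (dataOf s Ω).U)
    (hV : ∀ z : Exp, z.val τ < (dataOf s Ω).Z → (eValue s k z).val τ =
      (dataOf s Ω).value (k.val τ) ((dataOf s Ω).window (z.val τ))) :
    ((eSplits s k S t x).Holds τ → (eCandidate s k S t x).val τ =
        (dataOf s Ω).candidate ((dataOf s Ω).value (k.val τ)) (k.val τ) (S.val τ) (m.val τ) ∧
      (dataOf s Ω).candidate ((dataOf s Ω).value (k.val τ)) (k.val τ) (S.val τ) (m.val τ) ≠ 0) ∧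
    (¬ (eSplits s k S t x).Holds τ →
      (dataOf s Ω).candidate ((dataOf s Ω).value (k.val τ)) (k.val τ) (S.val τ) (m.val τ) = 0) := by
  classical
  have hrel := fun k : Exp => h.val_eRelease (s := s) (by omega) k
  have hwt := h.val_weight (s := s) (by omega) k
  have hready := h.holds_eReady hl hR x k
  have htime := h.val_eTime (s := s) (by omega) hT
  have hindex := h.val_eIndex (s := s)
  have heM := h.val_eM (s := s)
  set D := dataOf s Ω with hD
  have htM : t.val τ < D.M := by
    rw [ht]; exact (Nat.div_lt_iff_lt_mul D.U_pos).2 hm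
  have hxU : x.val τ < D.U := by
    rw [hx]; exact Nat.mod_lt _ D.U_pos
  have hvl : (eValue s k (eIndex s (S.left t x))).val τ =
      D.value (k.val τ) ((S.val τ).left (t.val τ) (x.val τ)) := by
    have hr := hS.left htM hxU
    rw [hV _ (by rw [hindex]; exact hr.index_lt), hindex, EWindow.val_left,
      hr.window_index]
  have hvr : t.val τ + 1 < D.M → (eValue s k (eIndex s (S.right t x))).val τ =
      D.value (k.val τ) ((S.val τ).right (t.val τ) (x.val τ)) := by
    intro ht1
    have hr := hS.right ht1 hxU
    rw [hV _ (by rw [hindex]; exact hr.index_lt), hindex, EWindow.val_right,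
      hr.window_index]
  have hsplits : (eSplits s k S t x).Holds τ ↔
      t.val τ + 1 < D.M ∧ D.Splits (D.value (k.val τ)) (k.val τ) (S.val τ) (t.val τ) (x.val τ) := by
    have ha : (eTime S.a).val τ = D.time (S.val τ).a := htime _ hS.a
    have hb : (eTime S.b).val τ = D.time (S.val τ).b := htime _ hS.b
    simp only [eSplits, holds_and, holds_le, holds_lt, holds_eq, ha, hb, htime t htM, heM, Exp.val,
      hready, Data.Splits]
    by_cases ht1 : t.val τ + 1 < D.M
    · have h5 := htime (add t (lit 1)) ht1
      have h6 := hvr ht1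
      simp only [Exp.val] at h5
      simp only [h5, ht1, Holds, hvl, h6, true_and]
    · simp [ht1]
  have hcand : D.candidate (D.value (k.val τ)) (k.val τ) (S.val τ) (m.val τ) =
      if D.Splits (D.value (k.val τ)) (k.val τ) (S.val τ) (t.val τ) (x.val τ) then
        D.value (k.val τ) ((S.val τ).left (t.val τ) (x.val τ)) +
        D.value (k.val τ) ((S.val τ).right (t.val τ) (x.val τ)) +
        D.w (k.val τ) * (D.time (t.val τ) + 1) - 1 else 0 := by
    rw [Data.candidate, ← ht, ← hx]
  rw [hsplits, hcand]
  refine ⟨fun h5 => ?_, fun h5 => if_neg fun h6 => h5 ⟨?_, h6⟩⟩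
  · rw [if_pos h5.2]
    refine ⟨?_, ?_⟩
    · simp only [eCandidate, Exp.val, hvl, hvr h5.1, hwt, htime t htM]
    · have := h5.2.2.2.2.2
      omega
  -- The program tests `t + 1 < M` explicitly, while `Splits` implies it: `time` vanishes beyond the
  -- codes and cannot equal a successor there.
  · refine Data.lt_M_of_time_ne_zero (D := D) ?_
    have := h6.2.2.1
    omega

/-- Induction on the level and, within a level, on the slot, following the dependencies of the
table. -/
theorem slot_spec (hΩ : Obeys Ω (slotLine s) 7)
    (hT : ∀ c < (dataOf s Ω).M, Ω 5 c = (dataOf s Ω).time c)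
    (hR : ∀ c ≤ Ω 0 0, Ω 6 c = (dataOf s Ω).rel c) (k : ℕ) (hk : k ≤ Ω 0 0) :
    ∀ z < (dataOf s Ω).Z, ∀ m ≤ (dataOf s Ω).M * (dataOf s Ω).U,
      Ω 7 (slotAt (dataOf s Ω) k z m) = (dataOf s Ω).slots k ((dataOf s Ω).window z) m := by
  have hbound : (slotLine s).bound.val Ω =
      (Ω 0 0 + 1) * (dataOf s Ω).Z * ((dataOf s Ω).M * (dataOf s Ω).U + 1) := by
    have h0 : Agrees Ω Ω 7 := fun _ _ => rfl
    simp only [slotLine, Exp.val, h0.val_n, h0.val_eZ, h0.val_eW]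
  -- the values of the parts of the line for a given slot
  have parts : ∀ k ≤ Ω 0 0, ∀ z < (dataOf s Ω).Z, ∀ m ≤ (dataOf s Ω).M * (dataOf s Ω).U,
      ∃ τ ek ez em, Agrees τ Ω 7 ∧ counter.val τ = slotAt (dataOf s Ω) k z m ∧ ek.val τ = k ∧
        ez.val τ = z ∧ em.val τ = m ∧ (eWindow s ez).val τ = (dataOf s Ω).window z ∧
        Ω 7 (slotAt (dataOf s Ω) k z m) = (slotTree s ek ez em (eWindow s ez)).val τ ∧
        ∀ i < slotAt (dataOf s Ω) k z m, τ 7 i = Ω 7 i := by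
    intro k hk z hz m hm
    obtain ⟨τ, h1, h2, h3, h4⟩ := hΩ (slotAt (dataOf s Ω) k z m)
      (by rw [hbound]; exact slotAt_lt _ hk hz hm)
    have h : Agrees τ Ω 7 := h3
    have hc : counter.val τ = slotAt (dataOf s Ω) k z m := h2
    have hez : (mod (div counter (eW s)) (eZ s)).val τ = z := by
      simp only [val_mod, Exp.val, hc, h.val_eW, h.val_eZ, slotAt_div _ hm]
      exact Data.mul_add_mod' _ hz
    refine ⟨τ, _, _, _, h, hc, ?_, hez, ?_, ?_, h1, h4⟩
    · simp only [Exp.val, hc, h.val_eW, h.val_eZ, slotAt_div _ hm]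
      exact Data.mul_add_div' _ hz
    · simp only [val_mod, hc, h.val_eW, slotAt_mod _ hm]
    · rw [h.val_eWindow, hez]
  induction k with
  | zero =>
    intro z hz m hm
    obtain ⟨τ, ek, ez, em, h, hc, hek, hez, hem, hwin, h1, h4⟩ := parts 0 hk z hz m hm
    have hr := Data.window_inRange hz
    rw [← hwin] at hr
    rw [h1, slotTree, Tree.val_ite, if_pos (by simp [hek, Exp.val]),
      h.val_baseTree (by norm_num) hT hR _ hr.a hr.b, hwin]
    rfl
  | succ k ih =>
    intro z hz m
    induction m with
    | zero =>
      intro hm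
      obtain ⟨τ, ek, ez, em, h, hc, hek, hez, hem, hwin, h1, h4⟩ := parts (k + 1) hk z hz 0 hm
      have hk1 : (sub ek (lit 1)).val τ = k := by simp [Exp.val, hek]
      have hst := h.holds_eStays (by norm_num) hR (sub ek (lit 1)) (eWindow s ez)
      rw [hk1, hwin] at hst
      rw [h1, slotTree, Tree.val_ite, if_neg (by simp [hek, Exp.val]), Tree.val_ite]
      by_cases hs : (dataOf s Ω).Stays k ((dataOf s Ω).window z)
      · rw [if_pos (hst.2 hs), Tree.val_leaf, eValue, Exp.val, h.val_eSlot, hk1, hez]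
        simp only [Exp.val, h.val_eM (s := s), h.val_eU]
        rw [h4 _ (slotAt_lt_succ _ hz le_rfl), ih (by omega) z hz _ le_rfl]
        simp [Data.slots, hs]
      · rw [if_neg (fun h' => hs (hst.1 h')), Tree.val_ite, if_pos (by simp [hem, Exp.val])]
        simp [Data.slots, hs, Exp.val, scan]
    | succ m ihm =>
      intro hm
      obtain ⟨τ, ek, ez, em, h, hc, hek, hez, hem, hwin, h1, h4⟩ :=
        parts (k + 1) hk z hz (m + 1) hm
      have hk1 : (sub ek (lit 1)).val τ = k := by simp [Exp.val, hek]
      have hst := h.holds_eStays (by norm_num) hR (sub ek (lit 1)) (eWindow s ez)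
      rw [hk1, hwin] at hst
      -- Cells of level `k` come before the present one, so their final contents are already
      -- available.
      have hV : ∀ z' : Exp, z'.val τ < (dataOf s Ω).Z → (eValue s (sub ek (lit 1)) z').val τ =
          (dataOf s Ω).value k ((dataOf s Ω).window (z'.val τ)) := by
        intro z' hz'
        rw [eValue, Exp.val, h.val_eSlot, hk1]
        simp only [Exp.val, h.val_eM (s := s), h.val_eU]
        rw [h4 _ (slotAt_lt_succ _ hz' le_rfl), ih (by omega) _ hz' _ le_rfl]
        rfl
      rw [h1, slotTree, Tree.val_ite, if_neg (by simp [hek, Exp.val]), Tree.val_ite]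
      by_cases hs : (dataOf s Ω).Stays k ((dataOf s Ω).window z)
      · rw [if_pos (hst.2 hs), Tree.val_leaf, hV _ (by rw [hez]; exact hz), hez]
        simp [Data.slots, hs, Data.value]
      · rw [if_neg (fun h' => hs (hst.1 h')), Tree.val_ite, if_neg (by simp [hem, Exp.val])]
        have hm1 : (sub em (lit 1)).val τ = m := by simp [Exp.val, hem]
        have hr := Data.window_inRange hz
        rw [← hwin] at hr
        obtain ⟨c1, c2⟩ := h.candidate_spec (by norm_num) hT hR (sub ek (lit 1)) (eWindow s ez)
          (sub em (lit 1)) (div (sub em (lit 1)) (eU s)) (mod (sub em (lit 1)) (eU s)) hr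
          (by rw [hm1]; omega) (by simp only [Exp.val, h.val_eU]) (by rw [val_mod, h.val_eU])
          (fun z' hz' => by rw [hV z' hz', hk1])
        rw [val_minTree c1 c2, hk1, hm1, hwin]
        have hprev : (read 7 (sub counter (lit 1))).val τ =
            (dataOf s Ω).slots (k + 1) ((dataOf s Ω).window z) m := by
          rw [← ihm (by omega)]
          simp only [Exp.val, hc]
          exact h4 _ (by unfold slotAt; omega)
        rw [hprev]
        simp only [Data.slots, hs, if_false, scan]
        rfl

/-- Here `p` is the first cell of a block of `T + 1` cells in which the source array holds the
sequence `g`. -/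
theorem changeLine_spec {arr src : ℕ} {bound m : Exp} (hΩ : Obeys Ω (changeLine arr src bound m) arr)
    (hsrc : 3 ≤ src) (hlt : src < arr) (p T : ℕ) (g : ℕ → ℕ)
    (hb : ∀ j ≤ T, p + j < bound.val Ω)
    (hm : ∀ τ, Agrees τ Ω arr → ∀ j ≤ T, counter.val τ = p + j → m.val τ = j)
    (hg : ∀ j ≤ T, Ω src (p + j) = g j) (j : ℕ) (hj : j ≤ T) :
    Ω arr (p + j) = lastChange g j := by
  induction j with
  | zero =>
    obtain ⟨τ, h1, h2, h3, h4⟩ := hΩ _ (hb 0 hj)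
    have h5 := hm τ h3 0 hj h2
    change Ω arr _ = _ at h1
    rw [h1]
    simp [changeLine, h5, Exp.val, lastChange]
  | succ j ih =>
    obtain ⟨τ, h1, h2, h3, h4⟩ := hΩ _ (hb (j + 1) hj)
    have h : Agrees τ Ω arr := h3
    have hc : counter.val τ = p + (j + 1) := h2
    have h5 := hm τ h (j + 1) hj hc
    have h6 : p + (j + 1) - 1 = p + j := by omega
    change Ω arr _ = _ at h1
    change ∀ k < p + (j + 1), τ arr k = Ω arr k at h4
    rw [h1, lastChange]
    simp only [changeLine, Tree.val_ite, Tree.val_leaf, holds_eq, Exp.val, hc, h5, h6,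
      h src (Or.inr ⟨hsrc, hlt⟩), hg _ hj, hg j (by omega), h4 (p + j) (by omega), ih (by omega)]
    simp

theorem choice_spec (hΩ : Obeys Ω (choiceLine s) 8)
    (hV : ∀ k ≤ Ω 0 0, ∀ z < (dataOf s Ω).Z, ∀ m ≤ (dataOf s Ω).M * (dataOf s Ω).U,
      Ω 7 (slotAt (dataOf s Ω) k z m) = (dataOf s Ω).slots k ((dataOf s Ω).window z) m)
    (k : ℕ) (hk : k ≤ Ω 0 0) (z : ℕ) (hz : z < (dataOf s Ω).Z) :
    Ω 8 (slotAt (dataOf s Ω) k z ((dataOf s Ω).M * (dataOf s Ω).U)) =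
      (dataOf s Ω).choice k ((dataOf s Ω).window z) := by
  have h0 : Agrees Ω Ω 8 := fun _ _ => rfl
  refine changeLine_spec hΩ (by norm_num) (by norm_num) (slotAt (dataOf s Ω) k z 0)
    ((dataOf s Ω).M * (dataOf s Ω).U) ((dataOf s Ω).slots k ((dataOf s Ω).window z))
    (fun j hj => ?_) (fun τ h j hj hc => ?_) (fun j hj => ?_) _ le_rfl
  · simp only [Exp.val, h0.val_n, h0.val_eZ, h0.val_eW]
    exact slotAt_lt _ hk hz hj
  · rw [val_mod, hc, h.val_eW]
    exact slotAt_mod (dataOf s Ω) (k := k) (z := z) hj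
  · exact hV k hk z hz j hj

theorem ready_spec (hΩ : Obeys Ω (readyLine s) 9)
    (hR : ∀ c ≤ Ω 0 0, Ω 6 c = (dataOf s Ω).rel c) (v : ℕ) (hv : v < (dataOf s Ω).U) :
    Ω 9 (v * (Ω 0 0 + 1) + Ω 0 0) ≠ 0 ↔ ∀ j < Ω 0 0, (dataOf s Ω).Ready v j := by
  have parts : ∀ m ≤ Ω 0 0, ∃ τ, Agrees τ Ω 9 ∧ counter.val τ = v * (Ω 0 0 + 1) + m ∧
      (mod counter (add n (lit 1))).val τ = m ∧ (div counter (add n (lit 1))).val τ = v ∧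
      Ω 9 (v * (Ω 0 0 + 1) + m) = (readyLine s).tree.val τ ∧
      ∀ i < v * (Ω 0 0 + 1) + m, τ 9 i = Ω 9 i := by
    intro m hm
    have hb : v * (Ω 0 0 + 1) + m < (readyLine s).bound.val Ω := by
      have h0 : Agrees Ω Ω 9 := fun _ _ => rfl
      simp only [readyLine, h0.val_mulSucc, h0.val_eU]
      exact Data.mul_add_lt hv (by omega)
    obtain ⟨τ, h1, h2, h3, h4⟩ := hΩ _ hb
    have h : Agrees τ Ω 9 := h3
    have hc : counter.val τ = v * (Ω 0 0 + 1) + m := h2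
    refine ⟨τ, h, hc, ?_, ?_, h1, h4⟩
    · simp only [val_mod, hc, Exp.val, h.val_n]
      exact Data.mul_add_mod' _ (by omega)
    · simp only [hc, Exp.val, h.val_n]
      exact Data.mul_add_div' _ (by omega)
  have key : ∀ m ≤ Ω 0 0, (Ω 9 (v * (Ω 0 0 + 1) + m) ≠ 0 ↔ ∀ j < m, (dataOf s Ω).Ready v j) := by
    intro m
    induction m with
    | zero =>
      intro hm
      obtain ⟨τ, h, hc, hmod, hdiv, h1, h4⟩ := parts 0 hm
      rw [h1]
      simp [readyLine, hmod, Exp.val]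
    | succ m ih =>
      intro hm
      obtain ⟨τ, h, hc, hmod, hdiv, h1, h4⟩ := parts (m + 1) hm
      have hr := h.holds_eReady (s := s) (by norm_num) hR (div counter (add n (lit 1)))
        (sub (mod counter (add n (lit 1))) (lit 1))
      rw [hdiv, Exp.val, hmod] at hr
      change _ ↔ (dataOf s Ω).Ready v m at hr
      have hprev : (read 9 (sub counter (lit 1))).val τ = Ω 9 (v * (Ω 0 0 + 1) + m) := by
        simp only [Exp.val, hc, ← add_assoc, Nat.add_sub_cancel]
        exact h4 _ (Nat.lt_succ_self _)
      rw [h1]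
      simp only [readyLine, Tree.val_ite, holds_eq, hmod]
      rw [if_neg (by simp [Exp.val]), Nat.forall_lt_succ_right]
      by_cases hrm : (dataOf s Ω).Ready v m
      · rw [if_pos (hr.2 hrm), Tree.val_leaf, hprev, ih (by omega)]
        simp [hrm]
      · rw [if_neg (fun h' => hrm (hr.1 h'))]
        simp [hrm, Exp.val]
  exact key _ le_rfl

theorem rootValue_spec (hΩ : Obeys Ω (rootValueLine s) 10)
    (hT : ∀ c < (dataOf s Ω).M, Ω 5 c = (dataOf s Ω).time c)
    (hR : ∀ c ≤ Ω 0 0, Ω 6 c = (dataOf s Ω).rel c)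
    (hV : ∀ k ≤ Ω 0 0, ∀ z < (dataOf s Ω).Z, ∀ m ≤ (dataOf s Ω).M * (dataOf s Ω).U,
      Ω 7 (slotAt (dataOf s Ω) k z m) = (dataOf s Ω).slots k ((dataOf s Ω).window z) m)
    (hready : ∀ v < (dataOf s Ω).U,
      (Ω 9 (v * (Ω 0 0 + 1) + Ω 0 0) ≠ 0 ↔ ∀ j < Ω 0 0, (dataOf s Ω).Ready v j))
    (m : ℕ) (hm : m ≤ (dataOf s Ω).Z) : Ω 10 m = scan (dataOf s Ω).rootValue m := by
  classical
  have hb : ∀ m ≤ (dataOf s Ω).Z, m < (rootValueLine s).bound.val Ω := fun m hm => by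
    have h0 : Agrees Ω Ω 10 := fun _ _ => rfl
    simp only [rootValueLine, Exp.val, h0.val_eZ]
    omega
  induction m with
  | zero =>
    obtain ⟨τ, h1, h2, h3, h4⟩ := hΩ _ (hb 0 hm)
    have hc : counter.val τ = 0 := h2
    change Ω 10 _ = _ at h1
    rw [h1]
    simp [rootValueLine, hc, Exp.val, scan]
  | succ m ih =>
    obtain ⟨τ, h1, h2, h3, h4⟩ := hΩ _ (hb (m + 1) hm)
    have h : Agrees τ Ω 10 := h3
    have hc : counter.val τ = m + 1 := h2
    change Ω 10 _ = _ at h1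
    have hz : (sub counter (lit 1)).val τ = m := by simp [Exp.val, hc]
    have hval : (eValue s n (sub counter (lit 1))).val τ =
        (dataOf s Ω).value (Ω 0 0) ((dataOf s Ω).window m) := by
      rw [eValue, Exp.val, h.val_eSlot, hz, h.val_n, h 7 (Or.inr (by norm_num))]
      simp only [Exp.val, h.val_eM (s := s), h.val_eU]
      exact hV _ le_rfl m (by omega) _ le_rfl
    have hr := Data.window_inRange (show m < (dataOf s Ω).Z by omega)
    have hwin : (eWindow s (sub counter (lit 1))).val τ = (dataOf s Ω).window m := by
      rw [h.val_eWindow, hz]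
    rw [← hwin] at hr
    have hroot : (eIsRoot s (eWindow s (sub counter (lit 1)))).Holds τ ↔
        (dataOf s Ω).IsRoot ((dataOf s Ω).window m) := by
      have hv : (eWindow s (sub counter (lit 1))).v.val τ = ((dataOf s Ω).window m).v := by
        rw [← hwin]; rfl
      have hread : (read 9 (add (mulSucc (eWindow s (sub counter (lit 1))).v) n)).Holds τ ↔
          ∀ j < Ω 0 0, (dataOf s Ω).Ready ((dataOf s Ω).window m).v j := by
        rw [← hready _ (hv ▸ hr.v), Holds, Exp.val, h 9 (Or.inr (by norm_num)), Exp.val,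
          h.val_mulSucc, h.val_n, hv]
      rw [eIsRoot, holds_and, holds_and, hread, holds_all, holds_le,
        h.val_eTime (by norm_num) hT _ hr.a, h.val_eTime (by norm_num) hT _ hr.b]
      simp only [holds_eq, h.val_eLast (show 6 < 10 by norm_num) hR, Exp.val]
      rw [← hwin]
      rfl
    rw [h1, scan, ← ih (by omega)]
    have hprev : (read 10 (sub counter (lit 1))).val τ = Ω 10 m := by
      rw [Exp.val, hz]
      exact h4 m (Nat.lt_succ_self m)
    rw [← hprev]
    simp only [rootValueLine]
    rw [Tree.val_ite, if_neg (by simp [hc, Exp.val])]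
    refine val_minTree (fun h5 => ?_) (fun h5 => ?_)
    · rw [holds_and, hroot, Holds, hval] at h5
      rw [hval, Data.rootValue, if_pos h5.1]
      exact ⟨rfl, h5.2⟩
    · rw [holds_and, hroot, Holds, hval, not_and, not_not] at h5
      rw [Data.rootValue]
      split_ifs with h6
      · exact h5 h6
      · rfl

theorem root_table_spec (hΩ : Obeys Ω (rootLine s) 11)
    (hV : ∀ m ≤ (dataOf s Ω).Z, Ω 10 m = scan (dataOf s Ω).rootValue m) :
    Ω 11 (dataOf s Ω).Z = (dataOf s Ω).root := by
  have h0 : Agrees Ω Ω 11 := fun _ _ => rfl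
  have := changeLine_spec hΩ (by norm_num) (by norm_num) 0 (dataOf s Ω).Z
    (scan (dataOf s Ω).rootValue)
    (fun j hj => by simp only [Exp.val, h0.val_eZ]; omega)
    (fun τ h j hj hc => by rw [hc, zero_add]) (fun j hj => by rw [zero_add]; exact hV j hj) _ le_rfl
  rwa [zero_add] at this

end JRP

/-! ### Backtracking along paths of windows -/

namespace JRP
open RAM Exp

namespace Data

variable {s : ℕ} (D : Data s)

open Classical in
/-- The windows on a path down from the root, where `goLeft t x` tells whether to follow the left
part of a window that is split at time `t` with last replenishments `x`. -/
noncomputable def walk (goLeft : ℕ → ℕ → Prop) : ℕ → Window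
  | 0 => D.window D.root
  | d + 1 =>
    let S := walk goLeft d
    let k := D.n - (d + 1)
    if D.Stays k S then S
    else if goLeft (D.cut (k + 1) S) (D.mid (k + 1) S) then
      S.left (D.cut (k + 1) S) (D.mid (k + 1) S)
    else S.right (D.cut (k + 1) S) (D.mid (k + 1) S)

variable {D}

open Classical in
theorem walk_succ {goLeft : ℕ → ℕ → Prop} {d k : ℕ} (hk : D.n - (d + 1) = k) :
    D.walk goLeft (d + 1) =
      if D.Stays k (D.walk goLeft d) then D.walk goLeft d
      else if goLeft (D.cut (k + 1) (D.walk goLeft d)) (D.mid (k + 1) (D.walk goLeft d)) then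
        (D.walk goLeft d).left (D.cut (k + 1) (D.walk goLeft d)) (D.mid (k + 1) (D.walk goLeft d))
      else
        (D.walk goLeft d).right (D.cut (k + 1) (D.walk goLeft d))
          (D.mid (k + 1) (D.walk goLeft d)) := by
  subst hk
  rfl

theorem InRange.cut {S : Window} {k : ℕ} (hS : D.InRange S) (hv : D.value (k + 1) S ≠ 0)
    (hs : ¬ D.Stays k S) :
    D.InRange (S.left (D.cut (k + 1) S) (D.mid (k + 1) S)) ∧
    D.InRange (S.right (D.cut (k + 1) S) (D.mid (k + 1) S)) := by
  obtain ⟨h1, h2, ⟨-, -, h3, -⟩, -⟩ := D.splits_of_value_ne_zero hs hv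
  exact ⟨hS.left h1 h2, hS.right (lt_M_of_time_ne_zero (by omega)) h2⟩

/-- The split chosen for a finite value has finite parts, so every window on a path is a valid table
index with a meaningful choice. -/
theorem walk_valid (hw : ∀ i j, i ≤ j → j < D.n → D.w j ≤ D.w i) (goLeft : ℕ → ℕ → Prop)
    (d : ℕ) (hd : d ≤ D.n) :
    D.InRange (D.walk goLeft d) ∧ D.value (D.n - d) (D.walk goLeft d) ≠ 0 := by
  induction d with
  | zero =>
    obtain ⟨h1, -, h2, -⟩ := root_spec hw
    exact ⟨window_inRange h1, h2⟩
  | succ d ih =>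
    obtain ⟨h1, h2⟩ := ih (by omega)
    have hk : D.n - d = D.n - (d + 1) + 1 := by omega
    rw [hk] at h2
    simp only [walk]
    split_ifs with hs hg
    · rw [D.value_succ_of_stays hs] at h2
      exact ⟨h1, h2⟩
    · obtain ⟨-, -, ⟨-, -, -, -, h3, -⟩, -⟩ := D.splits_of_value_ne_zero hs h2
      exact ⟨(h1.cut h2 hs).1, h3⟩
    · obtain ⟨-, -, ⟨-, -, -, -, -, h3⟩, -⟩ := D.splits_of_value_ne_zero hs h2
      exact ⟨(h1.cut h2 hs).2, h3⟩

theorem start_eq_zero {k j : ℕ} (h : k ≤ j) (S : Window) : D.start k S j = 0 := by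
  induction k generalizing S with
  | zero => rfl
  | succ k ih =>
    rw [start]
    split_ifs with h1 h2
    · exact ih (by omega) S
    · omega
    · exact ih (by omega) _
    · exact ih (by omega) _

/-- Down to depth `n - 1 - j` the splitting jobs are those above `j`, so `start` merely descends;
the next level is the one that may place `j` itself. -/
theorem start_walk {j : ℕ} (d : ℕ) (hd : d + j + 1 ≤ D.n) :
    D.start D.n (D.window D.root) j = D.start (D.n - d) (D.walk (fun _ x => D.Ready x j) d) j := by
  induction d with
  | zero => rfl
  | succ d ih =>
    rw [ih (by omega)]
    have hk : D.n - d = D.n - (d + 1) + 1 := by omega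
    have hj : j ≠ D.n - (d + 1) := by omega
    rw [hk, start, walk]
    simp only [hj, if_false]
    split_ifs <;> rfl

open Classical in
theorem start_eq {j : ℕ} (hj : j < D.n) :
    D.start D.n (D.window D.root) j =
      if D.Stays j (D.walk (fun _ x => D.Ready x j) (D.n - 1 - j)) then 0
      else D.time (D.cut (j + 1) (D.walk (fun _ x => D.Ready x j) (D.n - 1 - j))) := by
  rw [start_walk (D.n - 1 - j) (by omega), show D.n - (D.n - 1 - j) = j + 1 by omega, start]
  split_ifs with h1 h2
  · exact start_eq_zero le_rfl _
  · rfl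
  all_goals exact (h2 rfl).elim

/-- Unlike for jobs, the descent goes on to level `0`, where the last vector of the window tells
what is replenished at `θ`. -/
theorem repl_walk {θ : ℕ} (d : ℕ) (hd : d ≤ D.n) :
    D.repl D.n (D.window D.root) θ =
      D.repl (D.n - d) (D.walk (fun t _ => θ ≤ D.time t) d) θ := by
  induction d with
  | zero => rfl
  | succ d ih =>
    rw [ih (by omega)]
    have hk : D.n - d = D.n - (d + 1) + 1 := by omega
    rw [hk, repl, walk]
    split_ifs <;> rfl

theorem repl_eq (θ : ℕ) : D.repl D.n (D.window D.root) θ =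
    D.finalRepl (D.walk (fun t _ => θ ≤ D.time t) D.n) θ := by
  rw [repl_walk D.n le_rfl, Nat.sub_self, repl]

end Data

variable {s : ℕ} {Ω : Store}

theorem walkLine_spec {arr : ℕ} {goLeft : Exp → Exp → Exp → Exp}
    (hΩ : Obeys Ω (walkLine s arr goLeft) arr) (harr : 11 < arr)
    (hw : ∀ i j, i ≤ j → j < Ω 0 0 → (dataOf s Ω).w j ≤ (dataOf s Ω).w i)
    (hR : ∀ c ≤ Ω 0 0, Ω 6 c = (dataOf s Ω).rel c)
    (hC : ∀ k ≤ Ω 0 0, ∀ z < (dataOf s Ω).Z,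
      Ω 8 (slotAt (dataOf s Ω) k z ((dataOf s Ω).M * (dataOf s Ω).U)) =
        (dataOf s Ω).choice k ((dataOf s Ω).window z))
    (hroot : Ω 11 (dataOf s Ω).Z = (dataOf s Ω).root) (go : ℕ → ℕ → ℕ → Prop)
    (hgo : ∀ τ, Agrees τ Ω arr → ∀ c t x : Exp, c.val τ < Ω 0 0 → t.val τ < (dataOf s Ω).M →
      ((goLeft c t x).Holds τ ↔ go (c.val τ) (t.val τ) (x.val τ)))
    (c : ℕ) (hc : c < Ω 0 0) (d : ℕ) (hd : d ≤ Ω 0 0) :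
    Ω arr (c * (Ω 0 0 + 1) + d) = (dataOf s Ω).index ((dataOf s Ω).walk (go c) d) := by
  have parts : ∀ d ≤ Ω 0 0, ∃ τ, Agrees τ Ω arr ∧ counter.val τ = c * (Ω 0 0 + 1) + d ∧
      (mod counter (add n (lit 1))).val τ = d ∧ (div counter (add n (lit 1))).val τ = c ∧
      Ω arr (c * (Ω 0 0 + 1) + d) = (walkLine s arr goLeft).tree.val τ ∧
      ∀ i < c * (Ω 0 0 + 1) + d, τ arr i = Ω arr i := by
    intro d hd
    have hb : c * (Ω 0 0 + 1) + d < (walkLine s arr goLeft).bound.val Ω := by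
      have h0 : Agrees Ω Ω arr := fun _ _ => rfl
      simp only [walkLine, h0.val_mulSucc, h0.val_n]
      exact Data.mul_add_lt hc (by omega)
    obtain ⟨τ, h1, h2, h3, h4⟩ := hΩ _ hb
    have h : Agrees τ Ω arr := h3
    have hc : counter.val τ = c * (Ω 0 0 + 1) + d := h2
    refine ⟨τ, h, hc, ?_, ?_, h1, h4⟩
    · simp only [val_mod, hc, Exp.val, h.val_n]
      exact Data.mul_add_mod' _ (by omega)
    · simp only [hc, Exp.val, h.val_n]
      exact Data.mul_add_div' _ (by omega)
  induction d with
  | zero =>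
    obtain ⟨τ, h, hcount, hmod, hdiv, h1, h4⟩ := parts 0 hd
    rw [h1]
    simp only [walkLine, Tree.val_ite, holds_eq, hmod]
    rw [if_pos (by simp [Exp.val]), Tree.val_leaf, eRoot, Exp.val, h.val_eZ, h 11 (Or.inr ⟨by norm_num, harr⟩),
      hroot, Data.walk, Data.index_window]
  | succ d ih =>
    obtain ⟨τ, h, hcount, hmod, hdiv, h1, h4⟩ := parts (d + 1) hd
    obtain ⟨hr, hv⟩ := Data.walk_valid (D := dataOf s Ω) hw (go c) d (show d ≤ Ω 0 0 by omega)
    have hz : (read arr (sub counter (lit 1))).val τ =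
        (dataOf s Ω).index ((dataOf s Ω).walk (go c) d) := by
      rw [← ih (by omega)]
      simp only [Exp.val, hcount, ← add_assoc, Nat.add_sub_cancel]
      exact h4 _ (Nat.lt_succ_self _)
    have hwin : (eWindow s (read arr (sub counter (lit 1)))).val τ =
        (dataOf s Ω).walk (go c) d := by
      rw [h.val_eWindow, hz, hr.window_index]
    have hk : (sub n (mod counter (add n (lit 1)))).val τ = Ω 0 0 - (d + 1) := by
      rw [Exp.val, hmod, h.val_n]
    set k := Ω 0 0 - (d + 1) with hkdef
    have hk1 : Ω 0 0 - d = k + 1 := by omega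
    change (dataOf s Ω).value (Ω 0 0 - d) _ ≠ 0 at hv
    rw [hk1] at hv
    have hst := h.holds_eStays (show 6 < arr by omega) hR (sub n (mod counter (add n (lit 1))))
      (eWindow s (read arr (sub counter (lit 1))))
    rw [hk, hwin] at hst
    have hch : (eChoice s (add (sub n (mod counter (add n (lit 1)))) (lit 1))
        (read arr (sub counter (lit 1)))).val τ =
        (dataOf s Ω).choice (k + 1) ((dataOf s Ω).walk (go c) d) := by
      have hadd : (add (sub n (mod counter (add n (lit 1)))) (lit 1)).val τ = k + 1 := by
        rw [Exp.val, hk, Exp.val]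
      rw [eChoice, Exp.val, h 8 (Or.inr ⟨by norm_num, by omega⟩), h.val_eSlot, hadd, hz]
      simp only [Exp.val, h.val_eM (s := s), h.val_eU]
      rw [hC _ (by omega) _ hr.index_lt, hr.window_index]
    have ht : (div (eChoice s (add (sub n (mod counter (add n (lit 1)))) (lit 1))
        (read arr (sub counter (lit 1)))) (eU s)).val τ =
        (dataOf s Ω).cut (k + 1) ((dataOf s Ω).walk (go c) d) := by
      rw [Exp.val, hch, h.val_eU, Data.cut]
    have hx : (mod (eChoice s (add (sub n (mod counter (add n (lit 1)))) (lit 1))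
        (read arr (sub counter (lit 1)))) (eU s)).val τ =
        (dataOf s Ω).mid (k + 1) ((dataOf s Ω).walk (go c) d) := by
      rw [val_mod, hch, h.val_eU, Data.mid]
    rw [h1, Data.walk_succ (D := dataOf s Ω) (k := k) rfl]
    simp only [walkLine, Tree.val_ite, Tree.val_leaf, holds_eq, hmod]
    rw [if_neg (by simp [Exp.val])]
    by_cases hs : (dataOf s Ω).Stays k ((dataOf s Ω).walk (go c) d)
    · rw [if_pos (hst.2 hs), if_pos hs, hz]
    · rw [if_neg (fun h' => hs (hst.1 h')), if_neg hs]
      obtain ⟨htM, -⟩ := Data.splits_of_value_ne_zero _ hs hv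
      have hg := hgo τ h (div counter (add n (lit 1)))
        (div (eChoice s (add (sub n (mod counter (add n (lit 1)))) (lit 1))
          (read arr (sub counter (lit 1)))) (eU s))
        (mod (eChoice s (add (sub n (mod counter (add n (lit 1)))) (lit 1))
          (read arr (sub counter (lit 1)))) (eU s)) (by rw [hdiv]; exact hc)
        (by rw [ht]; exact htM)
      rw [hdiv, ht, hx] at hg
      by_cases hgl : go c ((dataOf s Ω).cut (k + 1) ((dataOf s Ω).walk (go c) d))
          ((dataOf s Ω).mid (k + 1) ((dataOf s Ω).walk (go c) d))
      · rw [if_pos (hg.2 hgl), if_pos hgl, h.val_eIndex, EWindow.val_left, hwin, ht, hx]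
      · rw [if_neg (fun h' => hgl (hg.1 h')), if_neg hgl, h.val_eIndex, EWindow.val_right, hwin, ht,
          hx]

end JRP

/-! ### The input encoding and the order of the jobs -/

namespace JRP
open RAM Exp

section Encoding

theorem getD_flatten (m : ℕ) (l : List (List ℕ)) (hl : ∀ b ∈ l, b.length = m) (j o : ℕ)
    (ho : o < m) : l.flatten.getD (m * j + o) 0 = (l.getD j []).getD o 0 := by
  induction l generalizing j with
  | nil => simp
  | cons b l ih =>
    have hb : b.length = m := hl b (by simp)
    rw [List.flatten_cons]
    cases j with
    | zero =>
      rw [List.getD_append _ _ _ _ (by omega)]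
      simp
    | succ j =>
      rw [List.getD_append_right _ _ _ _ (by rw [hb, Nat.mul_succ]; omega), hb,
        show m * (j + 1) + o - m = m * j + o by rw [Nat.mul_succ]; omega,
        ih (fun b hb => hl b (by simp [hb]))]
      simp

theorem length_flatten (m : ℕ) (l : List (List ℕ)) (hl : ∀ b ∈ l, b.length = m) :
    l.flatten.length = m * l.length := by
  induction l with
  | nil => simp
  | cons b l ih =>
    rw [List.flatten_cons, List.length_append, ih fun b hb => hl b (by simp [hb]),
      hl b (by simp), List.length_cons, Nat.mul_succ, add_comm]

theorem getD_ofFn {α : Type} {n : ℕ} (f : Fin n → α) (d : α) (i : ℕ) (hi : i < n) :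
    (List.ofFn f).getD i d = f ⟨i, hi⟩ := by
  rw [List.getD_eq_getElem _ _ (by simpa using hi), List.getElem_ofFn]

variable {s : ℕ} (I : Instance s)

theorem length_encode : I.encode.length = 2 + s + (3 + s) * I.n := by
  rw [Instance.encode]
  simp only [List.length_cons, List.length_append, List.length_ofFn]
  rw [length_flatten (3 + s)]
  · simp only [List.length_ofFn]
    omega
  · intro b hb
    rw [List.mem_ofFn] at hb
    obtain ⟨j, rfl⟩ := hb
    simp [encodeSet]
    omega

theorem encode_n : I.encode.getD 0 0 = I.n := rfl

theorem encode_K₀ : I.encode.getD 1 0 = I.K₀ := rfl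

theorem encode_K (i : Fin s) : I.encode.getD (2 + i) 0 = I.K i := by
  rw [Instance.encode, add_comm, List.getD_cons_succ, List.getD_cons_succ,
    List.getD_append _ _ _ _ (by simp), getD_ofFn _ _ _ i.2]

theorem encode_job (j : Fin I.n) (o : ℕ) (ho : o < 3 + s) :
    I.encode.getD ((3 + s) * j + (2 + s + o)) 0 =
      (I.p j :: I.r j :: I.w j :: encodeSet (I.R j)).getD o 0 := by
  rw [Instance.encode, show (3 + s) * (j : ℕ) + (2 + s + o) = (s + ((3 + s) * j + o)) + 2 by ring,
    List.getD_cons_succ, List.getD_cons_succ, List.getD_append_right _ _ _ _ (by simp)]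
  simp only [List.length_ofFn, Nat.add_sub_cancel_left]
  rw [getD_flatten (3 + s) _ _ _ _ ho, getD_ofFn _ _ _ j.2]
  intro b hb
  rw [List.mem_ofFn] at hb
  obtain ⟨j, rfl⟩ := hb
  simp [encodeSet]
  omega

theorem length_le_bitSize (x : List ℕ) : x.length ≤ bitSize x := by
  induction x with
  | nil => simp [bitSize]
  | cons a x ih =>
    simp only [bitSize, List.map_cons, List.sum_cons, List.length_cons] at ih ⊢
    omega

theorem size_getD_le_bitSize (x : List ℕ) (i : ℕ) : (x.getD i 0).size ≤ bitSize x := by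
  induction x generalizing i with
  | nil => simp
  | cons a x ih =>
    simp only [bitSize, List.map_cons, List.sum_cons] at ih ⊢
    cases i with
    | zero => simp only [List.getD_cons_zero]; omega
    | succ i => simp only [List.getD_cons_succ]; have := ih i; omega

end Encoding

variable {s : ℕ} {Ω : Store}

/-- The jobs are sorted by nonincreasing weights. -/
theorem exists_order (h3 : Obeys Ω (countLine 3 (eHeavier s)) 3)
    (h4 : Obeys Ω (inverseLine 4 3 (fun _ => lit 1)) 4) (N : ℕ) (hN : Ω 0 0 = N) :
    ∃ e : Fin N ≃ Fin N, (∀ k, (e k : ℕ) = jobAt Ω k) ∧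
      (∀ j, (e.symm j : ℕ) = Ω 3 (j * (N + 1) + N)) ∧
      ∀ i j, i ≤ j → j < N → (dataOf s Ω).w j ≤ (dataOf s Ω).w i := by
  classical
  subst hN
  set W : ℕ → ℕ := fun j => Ω 0 ((3 + s) * j + (2 + s + 2)) with hW
  -- Ties in weight are broken by the input number, which makes the order total.
  obtain ⟨P, hP⟩ : ∃ P : ℕ → ℕ → Prop, ∀ a b, P a b ↔ W b < W a ∨ W b = W a ∧ a < b :=
    ⟨_, fun _ _ => Iff.rfl⟩
  obtain ⟨Q, hQ⟩ : ∃ Q : ℕ → Prop, ∀ a, Q a := ⟨fun _ => True, fun _ => trivial⟩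
  have hcnt : ∀ c < Ω 0 0, Ω 3 (c * (Ω 0 0 + 1) + Ω 0 0) =
      ((Finset.range (Ω 0 0)).filter fun a => P a c).card := fun c hc => by
    refine countLine_spec h3 P (fun τ h x y _ _ => ?_) c hc _ le_rfl
    simp only [eHeavier, holds_or, holds_lt, holds_and, holds_eq, h.val_eInput, hP, hW]
  obtain ⟨r1, r2, r3⟩ := rank_spec (Ω 0 0) Q P (fun _ _ _ => hQ _)
    (fun a h => by simp only [hP] at h; omega)
    (fun a b c h h' => by simp only [hP] at h h' ⊢; omega)
    (fun a b _ _ _ _ hne => by simp only [hP]; omega)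
  have hcard : ((Finset.range (Ω 0 0)).filter Q).card = Ω 0 0 := by
    rw [Finset.filter_true_of_mem fun a _ => hQ a, Finset.card_range]
  rw [hcard] at r1 r3
  have hinj : ∀ a < Ω 0 0, ∀ b < Ω 0 0, Ω 3 (a * (Ω 0 0 + 1) + Ω 0 0) =
      Ω 3 (b * (Ω 0 0 + 1) + Ω 0 0) → a = b := by
    intro a ha b hb hab
    rw [hcnt a ha, hcnt b hb] at hab
    have h5 := r2 a b ha hb (hQ _) (hQ _)
    have h6 := r2 b a hb ha (hQ _) (hQ _)
    rw [hP] at h5 h6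
    by_contra hne
    rcases lt_trichotomy (W a) (W b) with h7 | h7 | h7
    · exact (h6.1 (Or.inl h7)).ne' hab
    · rcases Nat.lt_or_gt_of_ne hne with h8 | h8
      · exact (h5.1 (Or.inr ⟨h7.symm, h8⟩)).ne hab
      · exact (h6.1 (Or.inr ⟨h7, h8⟩)).ne' hab
    · exact (h5.1 (Or.inl h7)).ne hab
  have hjob : ∀ c < Ω 0 0, jobAt Ω (Ω 3 (c * (Ω 0 0 + 1) + Ω 0 0)) = c := by
    intro c hc
    refine inverseLine_spec h4 le_rfl (by norm_num) Q (fun τ _ x _ => ?_) _ ?_ c hc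
      (hQ c) rfl fun c' hc' _ he => hinj c' hc' c hc he
    · simp [Holds, Exp.val, hQ]
    · rw [hcnt c hc]; exact r1 c hc (hQ _)
  have hrank : ∀ k < Ω 0 0, jobAt Ω k < Ω 0 0 ∧
      Ω 3 (jobAt Ω k * (Ω 0 0 + 1) + Ω 0 0) = k := by
    intro k hk
    obtain ⟨c, hc, -, he⟩ := r3 k hk
    rw [← hcnt c hc] at he
    have := hjob c hc
    rw [he] at this
    rw [this]
    exact ⟨hc, he⟩
  refine ⟨⟨fun k => ⟨jobAt Ω k, (hrank k k.2).1⟩, fun j => ⟨Ω 3 (j * (Ω 0 0 + 1) + Ω 0 0), ?_⟩,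
    fun k => Fin.ext (hrank k k.2).2, fun j => Fin.ext (hjob j j.2)⟩, fun k => rfl, fun j => rfl, ?_⟩
  · rw [hcnt j j.2]; exact r1 j j.2 (hQ _)
  · intro i j hij hj
    rcases hij.eq_or_lt with rfl | hlt
    · exact le_rfl
    obtain ⟨h5, h6⟩ := hrank i (by omega)
    obtain ⟨h7, h8⟩ := hrank j hj
    have h9 := (r2 _ _ h5 h7 (hQ _) (hQ _)).2 (by rw [← hcnt _ h5, ← hcnt _ h7, h6, h8]; exact hlt)
    change W (jobAt Ω j) ≤ W (jobAt Ω i)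
    simp only [hP] at h9
    omega

theorem describes_dataOf (I : Instance s) (h0 : Ω 0 = initial I.encode 0)
    (e : Fin I.n ≃ Fin I.n) (he : ∀ k, (e k : ℕ) = jobAt Ω k) : (dataOf s Ω).Describes I e := by
  have hget : ∀ i, Ω 0 i = I.encode.getD i 0 := fun i => by rw [h0]; rfl
  refine ⟨?_, ?_, ?_, fun k => ?_, fun k => ?_, fun k => ?_⟩
  · simp only [dataOf, hget, encode_n]
  · simp only [dataOf, hget, encode_K₀]
  · funext i
    simp only [dataOf, hget, encode_K]
  · simp only [dataOf, hget, ← he]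
    rw [encode_job I _ 1 (by omega)]
    rfl
  · simp only [dataOf, hget, ← he]
    rw [encode_job I _ 2 (by omega)]
    rfl
  · ext i
    simp only [dataOf, hget, ← he, Finset.mem_filter, Finset.mem_univ, true_and]
    rw [encode_job I _ (3 + i) (by omega), show 3 + (i : ℕ) = i + 1 + 1 + 1 by ring,
      List.getD_cons_succ, List.getD_cons_succ, List.getD_cons_succ, encodeSet,
      getD_ofFn _ _ _ i.2]
    split_ifs with h <;> simp [h]

end JRP

/-! ### The output and the final assembly -/

namespace JRP
open RAM Exp

variable {s : ℕ} {Ω : Store}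

theorem Agrees.holds_eRepl {τ : Store} {lim : ℕ} (h : Agrees τ Ω lim) (hl : 13 < lim)
    (hw : ∀ i j, i ≤ j → j < Ω 0 0 → (dataOf s Ω).w j ≤ (dataOf s Ω).w i)
    (hR : ∀ c ≤ Ω 0 0, Ω 6 c = (dataOf s Ω).rel c)
    (h13 : ∀ c < Ω 0 0, Ω 13 (c * (Ω 0 0 + 1) + Ω 0 0) = (dataOf s Ω).index
      ((dataOf s Ω).walk (fun t _ => (dataOf s Ω).r c ≤ (dataOf s Ω).time t) (Ω 0 0)))
    (c : Exp) (hc : c.val τ < Ω 0 0) (i : Fin s) :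
    (eRepl s c i).Holds τ ↔
      i ∈ (dataOf s Ω).repl (Ω 0 0) ((dataOf s Ω).window (dataOf s Ω).root)
        ((dataOf s Ω).r (c.val τ)) := by
  have hr := (Data.walk_valid (D := dataOf s Ω) hw
    (fun t _ => (dataOf s Ω).r (c.val τ) ≤ (dataOf s Ω).time t) (Ω 0 0) le_rfl).1
  have hz : (read 13 (add (mulSucc c) n)).val τ = (dataOf s Ω).index
      ((dataOf s Ω).walk (fun t _ => (dataOf s Ω).r (c.val τ) ≤ (dataOf s Ω).time t)
        (Ω 0 0)) := by
    rw [Exp.val, h 13 (Or.inr ⟨by norm_num, hl⟩), Exp.val, h.val_mulSucc, h.val_n, h13 _ hc]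
  have hwin := h.val_eWindow (s := s) (read 13 (add (mulSucc c) n))
  rw [hz, hr.window_index] at hwin
  have hv : (eWindow s (read 13 (add (mulSucc c) n))).v.val τ = _ := congrArg Window.v hwin
  have he : (dataOf s Ω).repl (Ω 0 0) ((dataOf s Ω).window (dataOf s Ω).root) _ = _ :=
    Data.repl_eq (D := dataOf s Ω) ((dataOf s Ω).r (c.val τ))
  rw [he, eRepl, holds_eq, h.val_eLast (show 6 < lim by omega) hR, hv, Exp.val,
    h.val_eRelease (show 4 < lim by omega), Exp.val, Data.finalRepl, Finset.mem_filter]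
  simp only [Finset.mem_univ, true_and]
  rfl

/-- The moments of replenishment in increasing order. -/
theorem moments_spec (h14 : Obeys Ω (dupLine s) 14) (h15 : Obeys Ω (positionLine s) 15)
    (h16 : Obeys Ω (momentLine s) 16) (h17 : Obeys Ω (totalLine s) 17) (Q : ℕ → Finset (Fin s))
    (hQ : ∀ θ, Q θ ≠ ∅ → ∃ c < Ω 0 0, (dataOf s Ω).r c = θ)
    (hrepl : ∀ τ lim, 13 < lim → Agrees τ Ω lim → ∀ c : Exp, c.val τ < Ω 0 0 → ∀ i : Fin s,
      ((eRepl s c i).Holds τ ↔ i ∈ Q ((dataOf s Ω).r (c.val τ)))) :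
    ∃ T ≤ Ω 0 0, (0 < Ω 0 0 → Ω 17 (Ω 0 0) = T) ∧
      (∀ p < T, Ω 16 (p * (Ω 0 0 + 1) + Ω 0 0) < Ω 0 0) ∧
      (∀ p p', p < p' → p' < T → (dataOf s Ω).r (Ω 16 (p * (Ω 0 0 + 1) + Ω 0 0)) <
        (dataOf s Ω).r (Ω 16 (p' * (Ω 0 0 + 1) + Ω 0 0))) ∧
      ∀ θ, (∃ p < T, (dataOf s Ω).r (Ω 16 (p * (Ω 0 0 + 1) + Ω 0 0)) = θ) ↔ Q θ ≠ ∅ := by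
  classical
  set r := (dataOf s Ω).r with hr
  -- Several jobs may share a release date; only the first index of each value represents the
  -- moment, so the listed moments increase strictly.
  obtain ⟨Sel, hSel⟩ : ∃ Sel : ℕ → Prop, ∀ c, Sel c ↔ (∀ c' < c, r c' ≠ r c) ∧ Q (r c) ≠ ∅ :=
    ⟨_, fun _ => Iff.rfl⟩
  obtain ⟨P, hP⟩ : ∃ P : ℕ → ℕ → Prop, ∀ a b, P a b ↔ r a = r b ∧ a < b :=
    ⟨_, fun _ _ => Iff.rfl⟩
  obtain ⟨R, hRdef⟩ : ∃ R : ℕ → ℕ → Prop, ∀ a b, R a b ↔ Sel a ∧ r a < r b :=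
    ⟨_, fun _ _ => Iff.rfl⟩
  have hdup : ∀ c < Ω 0 0, Ω 14 (c * (Ω 0 0 + 1) + Ω 0 0) =
      ((Finset.range (Ω 0 0)).filter fun a => P a c).card := fun c hc => by
    refine countLine_spec h14 P (fun τ h x y _ _ => ?_) c hc _ le_rfl
    simp only [holds_and, holds_eq, holds_lt, h.val_eRelease (show 4 < 14 by norm_num), hP, hr]
  have hsel : ∀ τ lim, 14 < lim → Agrees τ Ω lim → ∀ x : Exp, x.val τ < Ω 0 0 →
      ((eSelected s x).Holds τ ↔ Sel (x.val τ)) := by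
    intro τ lim hl h x hx
    have hread : (read 14 (add (mulSucc x) n)).val τ =
        Ω 14 (x.val τ * (Ω 0 0 + 1) + Ω 0 0) := by
      rw [Exp.val, h 14 (Or.inr ⟨by norm_num, hl⟩), Exp.val, h.val_mulSucc, h.val_n]
    rw [eSelected, holds_and, holds_eq, holds_any, hread, hdup _ hx, Exp.val, Finset.card_eq_zero,
      Finset.filter_eq_empty_iff, hSel]
    refine and_congr ⟨fun h1 c hc he => ?_, fun h1 c hc hp => ?_⟩ ?_
    · exact h1 (Finset.mem_range.2 (hc.trans hx)) ((hP _ _).2 ⟨he, hc⟩)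
    · obtain ⟨h2, h3⟩ := (hP _ _).1 hp
      exact h1 c h3 h2
    · rw [← Finset.nonempty_iff_ne_empty]
      exact exists_congr fun i => hrepl τ lim (by omega) h x hx i
  have hpos : ∀ c < Ω 0 0, Ω 15 (c * (Ω 0 0 + 1) + Ω 0 0) =
      ((Finset.range (Ω 0 0)).filter fun a => R a c).card := fun c hc => by
    refine countLine_spec h15 R (fun τ h x y hx _ => ?_) c hc _ le_rfl
    rw [holds_and, holds_lt, hsel τ 15 (by norm_num) h x hx, hRdef,
      h.val_eRelease (show 4 < 15 by norm_num), h.val_eRelease (show 4 < 15 by norm_num)]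
  obtain ⟨r1, r2, r3⟩ := rank_spec (Ω 0 0) Sel R (fun a b h => ((hRdef a b).1 h).1)
    (fun a h => lt_irrefl _ ((hRdef a a).1 h).2)
    (fun a b c h h' => (hRdef a c).2 ⟨((hRdef a b).1 h).1,
      ((hRdef a b).1 h).2.trans ((hRdef b c).1 h').2⟩)
    (fun a b _ _ ha hb hne => by
      have hrne : r a ≠ r b := fun he => by
        rcases Nat.lt_or_gt_of_ne hne with h | h
        · exact ((hSel b).1 hb).1 a h he
        · exact ((hSel a).1 ha).1 b h he.symm
      rw [hRdef, hRdef]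
      rcases Nat.lt_or_gt_of_ne hrne with h | h
      · exact Or.inl ⟨ha, h⟩
      · exact Or.inr ⟨hb, h⟩)
  have hinj : ∀ a < Ω 0 0, ∀ b < Ω 0 0, Sel a → Sel b →
      ((Finset.range (Ω 0 0)).filter fun x => R x a).card =
        ((Finset.range (Ω 0 0)).filter fun x => R x b).card → a = b := by
    intro a ha b hb hsa hsb he
    by_contra hne
    rcases lt_trichotomy (r a) (r b) with h | h | h
    · exact ((r2 a b ha hb hsa hsb).1 ((hRdef a b).2 ⟨hsa, h⟩)).ne he
    · rcases Nat.lt_or_gt_of_ne hne with h' | h'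
      · exact ((hSel b).1 hsb).1 a h' h
      · exact ((hSel a).1 hsa).1 b h' h.symm
    · exact ((r2 b a hb ha hsb hsa).1 ((hRdef b a).2 ⟨hsb, h⟩)).ne' he
  have hmom : ∀ c < Ω 0 0, Sel c →
      Ω 16 (((Finset.range (Ω 0 0)).filter fun a => R a c).card * (Ω 0 0 + 1) + Ω 0 0) = c := by
    intro c hc hs
    refine inverseLine_spec h16 (by norm_num) (by norm_num) Sel
      (fun τ h x hx => hsel τ 16 (by norm_num) h x hx) _ ?_ c hc hs (hpos c hc)
      fun c' hc' hs' he => hinj c' hc' c hc hs' hs (by rw [← hpos c' hc', he])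
    exact (r1 c hc hs).trans_le ((Finset.card_filter_le _ _).trans (Finset.card_range _).le)
  have hspec : ∀ p < ((Finset.range (Ω 0 0)).filter Sel).card,
      Ω 16 (p * (Ω 0 0 + 1) + Ω 0 0) < Ω 0 0 ∧ Sel (Ω 16 (p * (Ω 0 0 + 1) + Ω 0 0)) ∧
      ((Finset.range (Ω 0 0)).filter fun a => R a (Ω 16 (p * (Ω 0 0 + 1) + Ω 0 0))).card = p := by
    intro p hp
    obtain ⟨c, hc, hs, he⟩ := r3 p hp
    have := hmom c hc hs
    rw [he] at this
    rw [this]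
    exact ⟨hc, hs, he⟩
  refine ⟨((Finset.range (Ω 0 0)).filter Sel).card,
    (Finset.card_filter_le _ _).trans (Finset.card_range _).le, fun hN => ?_,
    fun p hp => (hspec p hp).1, fun p p' hpp hp' => ?_, fun θ => ⟨?_, fun hθ => ?_⟩⟩
  · have := countLine_spec h17 (fun a _ => Sel a)
      (fun τ h x _ hx _ => hsel τ 17 (by norm_num) h x hx) 0 hN _ le_rfl
    rwa [zero_mul, zero_add] at this
  · obtain ⟨h1, h2, h3⟩ := hspec p (hpp.trans hp')
    obtain ⟨h4, h5, h6⟩ := hspec p' hp'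
    exact ((hRdef _ _).1 ((r2 _ _ h1 h4 h2 h5).2 (by rw [h3, h6]; exact hpp))).2
  · rintro ⟨p, hp, rfl⟩
    exact ((hSel _).1 (hspec p hp).2.1).2
  · have hex := hQ θ hθ
    -- The least index with release date `θ` is the selected one.
    obtain ⟨h1, h2⟩ := Nat.find_spec hex
    have hs : Sel (Nat.find hex) := (hSel _).2 ⟨fun c' hc' he => Nat.find_min hex hc'
      ⟨hc'.trans h1, he.trans h2⟩, by rw [h2]; exact hθ⟩
    exact ⟨_, r1 _ h1 hs, by rw [hmom _ h1 hs, h2]⟩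

theorem outputs_encode {n : ℕ} (y : Solution ℕ n s) (h1 : ∀ j : Fin n, Ω 1 j = y.start j)
    (h2 : Ω 1 n = y.repl.length)
    (h3 : ∀ p (hp : p < y.repl.length), Ω 1 (n + 1 + (s + 1) * p) = (y.repl[p]).1)
    (h4 : ∀ p (hp : p < y.repl.length) (i : Fin s),
      Ω 1 (n + 1 + ((s + 1) * p + (i + 1))) = if i ∈ (y.repl[p]).2 then 1 else 0) :
    Outputs Ω y.encode := by
  intro k hk
  have hl : ∀ b ∈ y.repl.map fun e => e.1 :: encodeSet e.2, b.length = s + 1 := by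
    intro b hb
    obtain ⟨e, -, rfl⟩ := List.mem_map.1 hb
    simp [encodeSet]
  rw [← List.getD_eq_getElem _ 0 hk]
  have hlen : y.encode.length = n + (1 + (s + 1) * y.repl.length) := by
    rw [Solution.encode, List.length_append, List.length_ofFn, List.length_cons,
      length_flatten (s + 1) _ hl, List.length_map, add_comm 1]
  rw [hlen] at hk
  rcases Nat.lt_or_ge k n with hkn | hkn
  · rw [Solution.encode, List.getD_append _ _ _ _ (by simpa using hkn), getD_ofFn _ _ _ hkn]
    exact h1 ⟨k, hkn⟩
  obtain ⟨d, rfl⟩ := Nat.exists_eq_add_of_le hkn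
  rw [Solution.encode, List.getD_append_right _ _ _ _ (by simp), List.length_ofFn,
    Nat.add_sub_cancel_left]
  rcases d with - | d
  · exact h2
  rw [List.getD_cons_succ]
  have hd : d < (s + 1) * y.repl.length := by omega
  obtain ⟨p, o, hpo, hp, ho⟩ : ∃ p o, d = (s + 1) * p + o ∧ p < y.repl.length ∧ o < s + 1 :=
    ⟨_, _, (Nat.div_add_mod d (s + 1)).symm, Nat.div_lt_of_lt_mul hd, Nat.mod_lt _ (Nat.succ_pos s)⟩
  subst hpo
  rw [getD_flatten (s + 1) _ hl p o ho, List.getD_eq_getElem _ [] (by simpa using hp),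
    List.getElem_map]
  rcases o with - | o
  · rw [List.getD_cons_zero, ← h3 p hp]
    congr 1
    ring
  · rw [List.getD_cons_succ, encodeSet, getD_ofFn _ _ _ (by omega), ← h4 p hp ⟨o, by omega⟩]
    congr 1
    simp only
    ring

open Classical in
theorem Agrees.val_startTree {τ : Store} {lim : ℕ} (h : Agrees τ Ω lim) (hl : 12 < lim)
    (hw : ∀ i j, i ≤ j → j < Ω 0 0 → (dataOf s Ω).w j ≤ (dataOf s Ω).w i)
    (hT : ∀ c < (dataOf s Ω).M, Ω 5 c = (dataOf s Ω).time c)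
    (hR : ∀ c ≤ Ω 0 0, Ω 6 c = (dataOf s Ω).rel c)
    (hC : ∀ k ≤ Ω 0 0, ∀ z < (dataOf s Ω).Z,
      Ω 8 (slotAt (dataOf s Ω) k z ((dataOf s Ω).M * (dataOf s Ω).U)) =
        (dataOf s Ω).choice k ((dataOf s Ω).window z))
    (h12 : ∀ c < Ω 0 0, ∀ d ≤ Ω 0 0, Ω 12 (c * (Ω 0 0 + 1) + d) = (dataOf s Ω).index
      ((dataOf s Ω).walk (fun _ x => (dataOf s Ω).Ready x c) d))
    (j : Exp) (k : ℕ) (hj : Ω 3 (j.val τ * (Ω 0 0 + 1) + Ω 0 0) = k) (hk : k < Ω 0 0) :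
    (startTree s j).val τ =
      (dataOf s Ω).start (Ω 0 0) ((dataOf s Ω).window (dataOf s Ω).root) k := by
  have hek : (read 3 (add (mulSucc j) n)).val τ = k := by
    rw [Exp.val, h 3 (Or.inr ⟨le_rfl, by omega⟩), Exp.val, h.val_mulSucc, h.val_n, hj]
  rw [startTree]
  generalize (read 3 (add (mulSucc j) n)) = ek at hek
  obtain ⟨hr, hv⟩ := Data.walk_valid (D := dataOf s Ω) hw (fun _ x => (dataOf s Ω).Ready x k)
    (Ω 0 0 - 1 - k) (show Ω 0 0 - 1 - k ≤ Ω 0 0 by omega)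
  have hez : (read 12 (add (mulSucc ek) (sub (sub n (lit 1)) ek))).val τ = (dataOf s Ω).index
      ((dataOf s Ω).walk (fun _ x => (dataOf s Ω).Ready x k) (Ω 0 0 - 1 - k)) := by
    rw [Exp.val, h 12 (Or.inr ⟨by norm_num, hl⟩), Exp.val, h.val_mulSucc, Exp.val, Exp.val, h.val_n,
      hek, Exp.val, h12 k hk _ (by omega)]
  generalize (read 12 (add (mulSucc ek) (sub (sub n (lit 1)) ek))) = ez at hez
  have hwin := h.val_eWindow (s := s) ez
  rw [hez, hr.window_index] at hwin
  have hst := h.holds_eStays (show 6 < lim by omega) hR ek (eWindow s ez)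
  rw [hek, hwin] at hst
  have he : (dataOf s Ω).start (Ω 0 0) ((dataOf s Ω).window (dataOf s Ω).root) k =
      if (dataOf s Ω).Stays k ((dataOf s Ω).walk (fun _ x => (dataOf s Ω).Ready x k)
        (Ω 0 0 - 1 - k)) then 0
      else (dataOf s Ω).time ((dataOf s Ω).cut (k + 1)
        ((dataOf s Ω).walk (fun _ x => (dataOf s Ω).Ready x k) (Ω 0 0 - 1 - k))) :=
    Data.start_eq (D := dataOf s Ω) hk
  change Data.value _ (Ω 0 0 - (Ω 0 0 - 1 - k)) _ ≠ 0 at hv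
  rw [show Ω 0 0 - (Ω 0 0 - 1 - k) = k + 1 by omega] at hv
  rw [he]
  simp only [Tree.val_ite, Tree.val_leaf]
  by_cases hs : (dataOf s Ω).Stays k
      ((dataOf s Ω).walk (fun _ x => (dataOf s Ω).Ready x k) (Ω 0 0 - 1 - k))
  · rw [if_pos (hst.2 hs), if_pos hs, Exp.val]
  · rw [if_neg (fun h' => hs (hst.1 h')), if_neg hs]
    have hcut : (div (eChoice s (add ek (lit 1)) ez) (eU s)).val τ = (dataOf s Ω).cut (k + 1)
        ((dataOf s Ω).walk (fun _ x => (dataOf s Ω).Ready x k) (Ω 0 0 - 1 - k)) := by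
      have hadd : (add ek (lit 1)).val τ = k + 1 := by rw [Exp.val, hek, Exp.val]
      rw [Exp.val, h.val_eU, eChoice, Exp.val, h 8 (Or.inr ⟨by norm_num, by omega⟩), h.val_eSlot,
        hadd, hez]
      simp only [Exp.val, h.val_eM (s := s), h.val_eU]
      rw [hC _ (by omega) _ hr.index_lt, hr.window_index]
      rfl
    rw [h.val_eTime (show 5 < lim by omega) hT _ ?_, hcut]
    rw [hcut]
    exact (Data.splits_of_value_ne_zero _ hs hv).1

theorem outputLine_spec (hΩ : Obeys Ω (outputLine s) 18) {N : ℕ} (hN : Ω 0 0 = N)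
    (hw : ∀ i j, i ≤ j → j < Ω 0 0 → (dataOf s Ω).w j ≤ (dataOf s Ω).w i)
    (hT : ∀ c < (dataOf s Ω).M, Ω 5 c = (dataOf s Ω).time c)
    (hR : ∀ c ≤ Ω 0 0, Ω 6 c = (dataOf s Ω).rel c)
    (hC : ∀ k ≤ Ω 0 0, ∀ z < (dataOf s Ω).Z,
      Ω 8 (slotAt (dataOf s Ω) k z ((dataOf s Ω).M * (dataOf s Ω).U)) =
        (dataOf s Ω).choice k ((dataOf s Ω).window z))
    (h12 : ∀ c < Ω 0 0, ∀ d ≤ Ω 0 0, Ω 12 (c * (Ω 0 0 + 1) + d) = (dataOf s Ω).index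
      ((dataOf s Ω).walk (fun _ x => (dataOf s Ω).Ready x c) d))
    (e : Fin N ≃ Fin N) (he : ∀ j, (e.symm j : ℕ) = Ω 3 (j * (N + 1) + N))
    (Q : ℕ → Finset (Fin s))
    (hrepl : ∀ τ lim, 13 < lim → Agrees τ Ω lim → ∀ c : Exp, c.val τ < Ω 0 0 → ∀ i : Fin s,
      ((eRepl s c i).Holds τ ↔ i ∈ Q ((dataOf s Ω).r (c.val τ))))
    (T : ℕ) (hTN : T ≤ Ω 0 0) (h17 : 0 < Ω 0 0 → Ω 17 (Ω 0 0) = T)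
    (h16 : ∀ p < T, Ω 16 (p * (Ω 0 0 + 1) + Ω 0 0) < Ω 0 0) :
    Outputs Ω (Solution.encode
      ⟨fun j : Fin N => (dataOf s Ω).start (Ω 0 0) ((dataOf s Ω).window (dataOf s Ω).root)
          (e.symm j),
        ((List.range T).map fun p => (dataOf s Ω).r (Ω 16 (p * (Ω 0 0 + 1) + Ω 0 0))).map
          fun θ => (θ, Q θ)⟩) := by
  subst hN
  have hbound : (outputLine s).bound.val Ω = Ω 0 0 + 1 + Ω 0 0 * (s + 1) := by
    have h0 : Agrees Ω Ω 18 := fun _ _ => rfl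
    simp only [outputLine, Exp.val, h0.val_n]
  have cell : ∀ i < Ω 0 0 + 1 + Ω 0 0 * (s + 1), ∃ τ, Agrees τ Ω 18 ∧ counter.val τ = i ∧
      Ω 1 i = (outputLine s).tree.val τ := fun i hi => by
    obtain ⟨τ, h1, h2, h3, -⟩ := hΩ i (by rwa [hbound])
    exact ⟨τ, h3, h2, h1⟩
  have block : ∀ p < T, ∀ o < s + 1, ∃ (τ : Store) (ep eo : Exp), Agrees τ Ω 18 ∧
      Ω 1 (Ω 0 0 + 1 + ((s + 1) * p + o)) = (replTree s ep eo).val τ ∧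
      ep.val τ = p ∧ eo.val τ = o := by
    intro p hp o ho
    obtain ⟨τ, h, hc, h1⟩ := cell (Ω 0 0 + 1 + ((s + 1) * p + o)) (by
      have := Data.mul_add_lt (hp.trans_le hTN) ho
      rw [mul_comm (s + 1) p]
      omega)
    refine ⟨τ, div (sub counter (add n (lit 1))) (lit (s + 1)),
      mod (sub counter (add n (lit 1))) (lit (s + 1)), h, ?_, ?_, ?_⟩
    · rw [h1]
      simp only [outputLine, Tree.val_ite, holds_lt, holds_eq, hc, h.val_n]
      rw [if_neg (by omega), if_neg (by omega)]
    · simp only [Exp.val, hc, h.val_n]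
      rw [Nat.add_sub_cancel_left, mul_comm]
      exact Data.mul_add_div' _ ho
    · rw [val_mod]
      simp only [Exp.val, hc, h.val_n]
      rw [Nat.add_sub_cancel_left, mul_comm]
      exact Data.mul_add_mod' _ ho
  have moment : ∀ τ, Agrees τ Ω 18 → ∀ ep : Exp,
      (read 16 (add (mulSucc ep) n)).val τ = Ω 16 (ep.val τ * (Ω 0 0 + 1) + Ω 0 0) := by
    intro τ h ep
    rw [Exp.val, h 16 (Or.inr (by norm_num)), Exp.val, h.val_mulSucc, h.val_n]
  refine outputs_encode _ (fun j => ?_) ?_ (fun p hp => ?_) (fun p hp i => ?_)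
  · obtain ⟨τ, h, hc, h1⟩ := cell j (by have := j.2; omega)
    rw [h1]
    simp only [outputLine, Tree.val_ite, holds_lt, hc, h.val_n, j.2, if_true]
    exact h.val_startTree (by norm_num) hw hT hR hC h12 counter _ (by rw [hc, he]) (e.symm j).2
  · obtain ⟨τ, h, hc, h1⟩ := cell (Ω 0 0) (by omega)
    rw [h1]
    simp only [outputLine, Tree.val_ite, holds_lt, holds_eq, hc, h.val_n, List.length_map,
      List.length_range]
    rw [if_neg (lt_irrefl _), if_pos trivial]
    -- Without jobs the counting array is empty, so the program writes the count `0` directly.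
    by_cases h0 : Ω 0 0 = 0
    · rw [if_neg (by rw [Holds, h.val_n, not_not]; exact h0), Tree.val_leaf, Exp.val]
      omega
    · rw [if_pos (by rw [Holds, h.val_n]; exact h0), Tree.val_leaf, Exp.val,
        h 17 (Or.inr (by norm_num)), h.val_n]
      exact h17 (by omega)
  · simp only [List.length_map, List.length_range] at hp
    obtain ⟨τ, ep, eo, h, h1, h2, h3⟩ := block p hp 0 (by omega)
    rw [add_zero] at h1
    rw [h1]
    simp only [replTree, Tree.val_ite, holds_eq, h3, Tree.val_leaf,
      h.val_eRelease (show 4 < 18 by norm_num), moment τ h, h2, List.getElem_map,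
      List.getElem_range]
    rw [if_pos (by rw [Exp.val])]
  · simp only [List.length_map, List.length_range] at hp
    obtain ⟨τ, ep, eo, h, h1, h2, h3⟩ := block p hp (i + 1) (by omega)
    have hm := moment τ h ep
    rw [h2] at hm
    have hr := hrepl τ 18 (by norm_num) h (read 16 (add (mulSucc ep) n)) (by rw [hm]; exact h16 p hp)
    rw [hm] at hr
    rw [h1, replTree]
    simp only [Tree.val_ite, holds_eq, h3, Tree.val_leaf, val_sum, val_flag, List.getElem_map,
      List.getElem_range]
    rw [if_neg (by simp [Exp.val]), Finset.sum_eq_single i]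
    · by_cases hi : i ∈ Q ((dataOf s Ω).r (Ω 16 (p * (Ω 0 0 + 1) + Ω 0 0)))
      · rw [if_pos hi, if_pos]
        rw [holds_and, holds_eq, h3]
        exact ⟨rfl, (hr i).2 hi⟩
      · rw [if_neg hi, if_neg]
        rw [holds_and]
        exact fun h' => hi ((hr i).1 h'.2)
    · intro i' _ hne
      rw [if_neg]
      rw [holds_and, holds_eq, h3]
      rintro ⟨h', -⟩
      simp only [Exp.val] at h'
      exact hne (Fin.ext (by omega))
    · intro hi
      exact absurd (Finset.mem_univ i) hi

/-- Line `i` fills array `i + 3`, except for the last, which fills array `1`; the conditions on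
array numbers are checked on the explicit list. -/
theorem obeys_getElem {σ : Store} (hΩ : run (lines s) σ = Ω) (i : ℕ) (hi : i < 16) :
    Obeys Ω ((lines s)[i]'hi) (i + 3) := by
  have harr : (lines s).map Line.arr = [3, 4, 5, 6, 7, 8, 9, 10, 11, 12, 13, 14, 15, 16, 17, 1] :=
    rfl
  have h1 : ∀ i < 16, ∀ b ∈ [3, 4, 5, 6, 7, 8, 9, 10, 11, 12, 13, 14, 15, 16, 17, 1].drop i,
      b = 1 ∨ i + 3 ≤ b := by decide
  have h2 : ∀ i < 16, [3, 4, 5, 6, 7, 8, 9, 10, 11, 12, 13, 14, 15, 16, 17, 1].getD i 0 ∉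
      [3, 4, 5, 6, 7, 8, 9, 10, 11, 12, 13, 14, 15, 16, 17, 1].drop (i + 1) := by decide
  have hcons : (lines s).drop i = (lines s)[i]'hi :: (lines s).drop (i + 1) :=
    List.drop_eq_getElem_cons hi
  refine obeys_of_run hΩ ((lines s).take i) ((lines s).drop (i + 1)) _ _ ?_ ?_ ?_
  · rw [← hcons, List.take_append_drop]
  · rw [← hcons, List.map_drop, harr]
    exact h1 i hi
  · have h3 := h2 i hi
    rw [← harr, ← List.map_drop, List.getD_eq_getElem _ _ (by simpa [lines] using hi),
      List.getElem_map] at h3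
    exact h3

/-- The final memory contains an optimal solution. -/
theorem exists_solution (I : Instance s) (hp : ∀ j, I.p j = 1)
    (hΩ : run (lines s) (initial I.encode) = Ω) :
    ∃ y : Solution ℕ I.n s, Outputs Ω y.encode ∧ I.IsOptimal y.toReal := by
  have h0 : Ω 0 = initial I.encode 0 := by
    rw [← hΩ]
    refine run_of_not_mem _ _ 0 (by norm_num) fun h => ?_
    obtain ⟨ℓ, h1, h2⟩ := List.mem_map.1 h
    exact (good_of_mem_lines s ℓ h1).arr_ne_zero h2
  have hN : Ω 0 0 = I.n := by rw [h0]; rfl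
  have obeys := obeys_getElem hΩ
  obtain ⟨e, he, hes, hw⟩ := exists_order (obeys 0 (by norm_num)) (obeys 1 (by norm_num)) I.n hN
  have hw' : ∀ i j, i ≤ j → j < Ω 0 0 → (dataOf s Ω).w j ≤ (dataOf s Ω).w i := by rwa [hN]
  have hT := time_spec (s := s) (obeys 2 (by norm_num))
  have hR := rel_spec (s := s) (obeys 3 (by norm_num))
  have hV := slot_spec (s := s) (obeys 4 (by norm_num)) hT hR
  have hC := choice_spec (s := s) (obeys 5 (by norm_num)) hV
  have hready := ready_spec (s := s) (obeys 6 (by norm_num)) hR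
  have hroot := root_table_spec (s := s) (obeys 8 (by norm_num))
    (rootValue_spec (obeys 7 (by norm_num)) hT hR hV hready)
  have h12 := walkLine_spec (s := s) (arr := 12) (obeys 9 (by norm_num)) (by norm_num) hw' hR hC
    hroot (fun c _ x => (dataOf s Ω).Ready x c)
    fun τ h c _ x _ _ => h.holds_eReady (by norm_num) hR x c
  have h13 := walkLine_spec (s := s) (arr := 13)
    (goLeft := fun c t _ => le (eRelease s c) (eTime t)) (obeys 10 (by norm_num)) (by norm_num) hw' hR hC
    hroot (fun c t _ => (dataOf s Ω).r c ≤ (dataOf s Ω).time t)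
    fun τ h c t _ _ ht => by
      rw [holds_le, h.val_eRelease (s := s) (by norm_num), h.val_eTime (by norm_num) hT t ht]
  have hrepl := fun (τ : Store) (lim : ℕ) (hl : 13 < lim) (h : Agrees τ Ω lim) =>
    h.holds_eRepl hl hw' hR fun c hc => h13 c hc _ le_rfl
  obtain ⟨T, hTN, h17, h16, hlt, hmem⟩ := moments_spec (s := s) (obeys 11 (by norm_num))
    (obeys 12 (by norm_num)) (obeys 13 (by norm_num)) (obeys 14 (by norm_num))
    ((dataOf s Ω).repl (Ω 0 0) ((dataOf s Ω).window (dataOf s Ω).root))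
    (fun θ hθ => by
      obtain ⟨i, hi⟩ := Finset.nonempty_iff_ne_empty.2 hθ
      exact Data.repl_release hi) hrepl
  refine ⟨_, outputLine_spec (obeys 15 (by norm_num)) hN hw' hT hR hC h12 e hes _ hrepl T hTN h17
    h16, (describes_dataOf I h0 e he).isOptimal hp hw' _ ?_ fun θ => ?_⟩
  · rw [List.pairwise_map]
    refine List.pairwise_lt_range.imp_of_mem fun _ hb h => hlt _ _ h (List.mem_range.1 hb)
  · refine Iff.trans ?_ (hmem θ)
    simp only [List.mem_map, List.mem_range]

end JRP

theorem theorem4 (s : ℕ) :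
    RAM.SolvableInPolyTime
      (α := JRP.UnitInstance s)
      (β := fun I => JRP.Solution ℕ I.1.n s)
      (fun I => I.1.encode)
      (fun _ y => y.encode)
      (fun I y => I.1.IsOptimal y.toReal) := by
  obtain ⟨p, hp⟩ := RAM.exec_program
    (fun I : JRP.UnitInstance s => RAM.bitSize I.1.encode) (JRP.lines s)
    (JRP.good_of_mem_lines s) (fun I => RAM.initial I.1.encode)
    ⟨Polynomial.X, fun I a i => by
      rw [Polynomial.eval_X, RAM.initial]
      split_ifs
      · exact JRP.size_getD_le_bitSize _ _
      · simp⟩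
    -- Although `n` is written in binary, the input contains a block for each of the `n` jobs. Hence
    -- `n` itself, not only its length, is bounded by the input size.
    ⟨Polynomial.X, fun I => by
      rw [Polynomial.eval_X]
      refine le_trans ?_ (JRP.length_le_bitSize _)
      rw [JRP.length_encode]
      change I.1.n ≤ _
      nlinarith⟩
  refine ⟨RAM.program (JRP.lines s), p, fun I => ?_⟩
  obtain ⟨t, h1, h2⟩ := hp I
  obtain ⟨y, h3, h4⟩ := JRP.exists_solution I.1 I.2 rfl
  exact ⟨y, _, t, h1, h2, h3, h4⟩
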